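/- **Setting.** A differential condition is a finite linear combination of the functionals $d(l,a):f\mapsto f^{(l)}(a)$, $l\ge 0$, $a\in\mathbb C$. A *rational KP solution in the bispectral gauge* is given by linearly independent conditions $c_1,\dots,c_N$, where $c_i$ involves only one point $\lambda_i\in\mathbb C$ (the $\lambda_i$ need not be distinct), together with $q(z)=\prod_{i}(z-\lambda_i)$. It stands for the space $W$ of all $f/q$ with $c_1(f)=\dots=c_N(f)=0$. Let $t=(t_1,t_2,\dots)$ be times, finitely many of them non-zero, $x=t_1$, and $\xi(t,z)=\sum_{k\ge1}t_kz^k$. Put $$\tau_W(t)=\det\bigl(c_i(z^{j}e^{\xi(t,z)})\bigr)_{1\le i\le N,\;0\le j<N}\;\prod_i e^{-\xi(t,\lambda_i)} .$$ The wave function $\psi_W(t,z)$, defined where $\tau_W(t)\ne0$, is the unique function $\bigl(1+p(t,z)/q(z)\bigr)e^{\xi(t,z)}$ with $p$ a polynomial in $z$ of degree $<N$ such that $q\,\psi_W(t,\cdot)$ satisfies all $c_i$. The stationary wave function $\psi_W(x,z)$ is its restriction to $t=(x,0,0,\dots)$. The KP flow sends $W$ to $W(t)=e^{-\xi(t,\cdot)}W$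 (same $\lambda_i$ and $q$, conditions $f\mapsto c_i(e^{\xi(t,\cdot)}f)$). The *positions* of $W$ are the roots, with multiplicities, of the polynomial $x\mapsto\tau_W(x,0,0,\dots)$. If they are distinct, the *particle system* of $W$ is the unordered set of pairs $(x_i,y_i)$, where the $x_i$ are the positions and $y_i=\frac12\frac{d}{dt_2}x_i\big|_{t_2=0}$ is half of the velocity of the root $x_i$ of $\tau_W(\cdot,t_2,0,\dots)$. A *Calogero–Moser particle system with distinct positions* is any finite set $P$ of pairs $(x_i,y_i)\in\mathbb C^2$ with the $x_i$ distinct. The KP flow takes $P$ to $P(t)$ if for some $W$ the particle systems of $W$ and $W(t)$ are $P$ and $P(t)$; in particular both have distinct positions. The *bispectral involution* $\beta$ sends $W$ to $V$ if $\psi_V(x,z)=\psi_W(z,x)$; on particle systems, the positions of $\beta(P)$ are the positions, with multiplicities, of any $V=\beta(W)$ for which $W$ has particle system $P$, and $\beta(P)$ is the particle system of such a $V$, provided that these positions are distinct. **Theorem.** $\beta$, acting on Calogero–Moser particle systems with distinct positions, is a linearizing map: under composition with the KP time flows the positions are fixed and the momenta are linear in the times. Precisely, let $P$ be a Calogero–Moser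 particle system with distinct positions. Then the positions of $\beta(P)$ are a well-defined multiset $Z$ of complex numbers, and for all times $t$ such that the KP flow takes $P$ to a particle system $P(t)$ with distinct positions, the positions of $\beta(P(t))$ are well defined and again equal to $Z$. If the elements of $Z$ are distinct, then $\beta(P)=\{(\zeta_i,\mu_i)\}$ is a well-defined particle system with positions $Z$, and for all such $t$, $\beta(P(t))$ is well defined and $$\beta(P(t))=\Bigl\{\Bigl(\zeta_i,\ \mu_i+\sum_{k\ge1}k\,t_k\,\zeta_i^{\,k-1}\Bigr)\Bigr\}.$$ -/

import Mathlib

open Filter Topology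

noncomputable section

namespace CalogeroMoser

/-! ### The KP times -/

/-- A choice of finitely many non-zero KP times `t₁ = x, t₂ = y, t₃, …`. -/
abbrev Times := ℕ+ →₀ ℂ

/-- The KP phase `∑ t_k z ^ k`. -/
def phase (t : Times) (z : ℂ) : ℂ := t.sum fun k a => a * z ^ (k : ℕ)

/-- The derivative `∑ k t_k z ^ (k - 1)` of the phase with respect to `z`. -/
def phaseDeriv (t : Times) (z : ℂ) : ℂ := t.sum fun k a => ((k : ℕ) : ℂ) * a * z ^ ((k : ℕ) - 1)

/-- The times `(x, y, 0, 0, …)`. -/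
def times₂ (x y : ℂ) : Times := Finsupp.single 1 x + Finsupp.single 2 y

/-! ### Differential conditions -/

/-- The space of differential conditions: the vector space with basis `d (l, a)`, where `d (l, a)`
is the functional sending `f` to its `l`-th derivative at the point `a`. The basis vector `d (l, a)`
is `Finsupp.single (a, l) 1`. -/
abbrev DiffCond := ℂ × ℕ →₀ ℂ

/-- The value of a differential condition on a function. -/
def DiffCond.eval (c : DiffCond) (f : ℂ → ℂ) : ℂ := c.sum fun p a => a * iteratedDeriv p.2 f p.1

/-- The condition `c` involves the point `a` only. -/
def DiffCond.SupportedAt (c : DiffCond) (a : ℂ) : Prop := ∀ p ∈ c.support, p.1 = a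

/-- The action of the KP flow for the times `t` on conditions, `c ↦ c (exp (∑ t_k z ^ k) · _)`,
written out by the Leibniz rule. It is the action of the element `exp (-∑ t_k z ^ k)` of the group
`Γ₊`: a function `f` satisfies `c` if and only if `exp (-∑ t_k z ^ k) * f` satisfies
the new condition. -/
def flowCond (t : Times) : DiffCond →ₗ[ℂ] DiffCond :=
  Finsupp.linearCombination ℂ fun p : ℂ × ℕ =>
    ∑ j ∈ Finset.range (p.2 + 1),
      Finsupp.single (p.1, j)
        ((p.2.choose j : ℂ) * iteratedDeriv (p.2 - j) (fun z => Complex.exp (phase t z)) p.1)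

theorem flowCond_apply (t : Times) (c : DiffCond) (q : ℂ × ℕ) :
    flowCond t c q = ∑ p ∈ c.support, c p * (if p.1 = q.1 ∧ q.2 ≤ p.2 then
      (p.2.choose q.2 : ℂ) * iteratedDeriv (p.2 - q.2) (fun z => Complex.exp (phase t z)) p.1
      else 0) := by
  classical
  rw [flowCond, Finsupp.linearCombination_apply, Finsupp.sum, Finsupp.finsetSum_apply]
  refine Finset.sum_congr rfl fun p _ => ?_
  rw [Finsupp.smul_apply, smul_eq_mul, Finsupp.finsetSum_apply]
  congr 1
  obtain ⟨b, m⟩ := q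
  simp only [Finsupp.single_apply, Prod.mk.injEq]
  by_cases h : p.1 = b
  · simp only [h, true_and]
    rw [Finset.sum_ite_eq']
    simp
  · simp [h]

theorem flowCond_supportedAt (t : Times) {c : DiffCond} {a : ℂ} (h : c.SupportedAt a) :
    DiffCond.SupportedAt (flowCond t c) a := by
  intro q hq
  rw [Finsupp.mem_support_iff, flowCond_apply] at hq
  obtain ⟨p, hp, hne⟩ := Finset.exists_ne_zero_of_sum_ne_zero hq
  have h1 : p.1 = q.1 ∧ q.2 ≤ p.2 := by
    by_contra h2
    simp [h2] at hne
  rw [← h1.1]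
  exact h p hp

theorem flowCond_ker (t : Times) : LinearMap.ker (flowCond t) = ⊥ := by
  rw [LinearMap.ker_eq_bot']
  intro c hc
  by_contra hne
  obtain ⟨p, hp, hmax⟩ :=
    Finset.exists_max_image c.support (fun p => p.2) (Finsupp.support_nonempty_iff.mpr hne)
  have h0 : flowCond t c p = 0 := by rw [hc]; rfl
  rw [flowCond_apply, Finset.sum_eq_single p] at h0
  · simp at h0
    exact (Finsupp.mem_support_iff.mp hp) h0
  · intro r hr hrp
    have h3 : ¬ (r.1 = p.1 ∧ p.2 ≤ r.2) := fun h4 =>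
      hrp (Prod.ext h4.1 (le_antisymm (hmax r hr) h4.2))
    simp [h3]
  · intro h5
    exact absurd hp h5

/-! ### Rational KP solutions in the bispectral gauge -/

/-- A rational solution of the KP hierarchy in the bispectral gauge, presented by a point `(C, q)`
of the dual Grassmannian: `C` is a finite dimensional space of differential conditions with
a basis of conditions `c_i`, each involving one point `λ_i` only, and `q = ∏ (z - λ_i)`.
It stands for the space `W` of all `f / q`, where `f` satisfies the conditions in `C`. -/
structure RationalSolution where
  /-- the number of conditions -/
  N : ℕ
  /-- the points `λ_i` -/
  pt : Fin N → ℂ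
  /-- the conditions `c_i` -/
  cond : Fin N → DiffCond
  supported : ∀ i, (cond i).SupportedAt (pt i)
  linInd : LinearIndependent ℂ cond

namespace RationalSolution

variable (W : RationalSolution)

/-- The polynomial `q (z) = ∏ (z - λ_i)`. -/
def q (z : ℂ) : ℂ := ∏ i, (z - W.pt i)

/-- The `τ`-function in the bispectral gauge: the determinant of the matrix
`c_i (z ^ j exp (∑ t_k z ^ k))`, divided by the exponentials `exp (∑ t_k λ_i ^ k)`. -/
def tau (t : Times) : ℂ :=
  Matrix.det (Matrix.of fun i j : Fin W.N =>
      (W.cond i).eval fun z => z ^ (j : ℕ) * Complex.exp (phase t z)) *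
    ∏ i, Complex.exp (-phase t (W.pt i))

/-- `ψ (t, z)` is the wave function of `W`: for all times with `τ (t) ≠ 0` it belongs to `W` and
has the form `(1 + p (t, z) / q (z)) exp (∑ t_k z ^ k)` with `p` a polynomial in `z` of degree less
than `N`. Here `R = q + p`. -/
def IsWaveFunction (ψ : Times → ℂ → ℂ) : Prop :=
  ∀ t, W.tau t ≠ 0 → ∃ R : Polynomial ℂ, R.Monic ∧ R.natDegree = W.N ∧
    (∀ i, (W.cond i).eval (fun z => R.eval z * Complex.exp (phase t z)) = 0) ∧
    ∀ z, W.q z ≠ 0 → ψ t z = R.eval z / W.q z * Complex.exp (phase t z)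

/-- The KP flow: the solution at the times `t`, i.e. the space `exp (-∑ t_k z ^ k) W`. -/
def flow (t : Times) : RationalSolution where
  N := W.N
  pt := W.pt
  cond := fun i => flowCond t (W.cond i)
  supported := fun i => flowCond_supportedAt t (W.supported i)
  linInd := W.linInd.map' (flowCond t) (flowCond_ker t)

/-- `V` is the image of `W` under the bispectral involution: the stationary wave functions
`ψ (x, z)` (all times but `x = t₁` are zero) are related by `ψ_V (x, z) = ψ_W (z, x)`, at all points
where both sides are defined. -/
def IsBispectralImage (V : RationalSolution) : Prop :=
  ∃ ψW ψV : Times → ℂ → ℂ, W.IsWaveFunction ψW ∧ V.IsWaveFunction ψV ∧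
    ∀ x z : ℂ, V.tau (times₂ x 0) ≠ 0 → V.q z ≠ 0 → W.tau (times₂ z 0) ≠ 0 → W.q x ≠ 0 →
      ψV (times₂ x 0) z = ψW (times₂ z 0) x

/-- The particle positions of `W` with multiplicities: the roots of the polynomial
`τ (x, 0, 0, …)`. -/
def HasPositions (M : Multiset ℂ) : Prop :=
  ∃ a : ℂ, a ≠ 0 ∧ ∀ x, W.tau (times₂ x 0) = a * (M.map fun r => x - r).prod

end RationalSolution

/-! ### Calogero-Moser particle systems -/

/-- A Calogero-Moser particle system with distinct positions: a finite unordered set of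
pairs (position, momentum), no two of them with the same position. -/
@[ext]
structure ParticleSystem where
  particles : Finset (ℂ × ℂ)
  distinct : Set.InjOn Prod.fst (particles : Set (ℂ × ℂ))

/-- The positions of the particles. -/
def ParticleSystem.positions (P : ParticleSystem) : Multiset ℂ := P.particles.val.map Prod.fst

/-- The particle system with the same positions, and the momentum `μ` of the particle at `ζ`
replaced by `μ + ∑ k t_k ζ ^ (k - 1)`. -/
def ParticleSystem.linearMotion (P : ParticleSystem) (t : Times) : ParticleSystem where
  particles := P.particles.image fun p => (p.1, p.2 + phaseDeriv t p.1)
  distinct := by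
    intro a ha b hb hab
    simp only [Finset.coe_image, Set.mem_image, Finset.mem_coe] at ha hb
    obtain ⟨p, hp, rfl⟩ := ha
    obtain ⟨r, hr, rfl⟩ := hb
    rw [P.distinct hp hr hab]

/-- `P` is the particle system of `W`: its positions are the roots of `τ (x, 0, 0, …)`, and
the momentum of each particle is half of the velocity of this root under the second time flow. -/
def RationalSolution.HasParticleSystem (W : RationalSolution) (P : ParticleSystem) : Prop :=
  W.HasPositions P.positions ∧
    ∀ p ∈ P.particles, ∃ X : ℂ → ℂ, X 0 = p.1 ∧ HasDerivAt X (2 * p.2) 0 ∧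
      ∀ᶠ s in 𝓝 (0 : ℂ), W.tau (times₂ (X s) s) = 0

/-- The KP flow for the times `t` takes the particle system `P` to `P'`. -/
def FlowsTo (t : Times) (P P' : ParticleSystem) : Prop :=
  ∃ W : RationalSolution, W.HasParticleSystem P ∧ (W.flow t).HasParticleSystem P'

/-- The bispectral involution as a map on particle systems: `β P = Q`. -/
def BetaEq (P Q : ParticleSystem) : Prop :=
  ∃ W V : RationalSolution, W.HasParticleSystem P ∧ W.IsBispectralImage V ∧
    V.HasParticleSystem Q

/-- The positions of the image `β P`, with multiplicities, are `M`. This also makes sense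
when some of the positions of the image coincide. -/
def BetaPositionsEq (P : ParticleSystem) (M : Multiset ℂ) : Prop :=
  ∃ W V : RationalSolution, W.HasParticleSystem P ∧ W.IsBispectralImage V ∧ V.HasPositions M

end CalogeroMoser

end

noncomputable section

namespace CalogeroMoser

open Polynomial

/-! ### Jets of entire functions -/

/-! A particle system P is encoded by M = diag(x_i) (`posMat`) and L (`laxMat`), which has diagonal
-y_i and off-diagonal entries -1/(x_i - x_j). They satisfy [M, L] = 1 - J with J the matrix of ones
(`IsCMPair`). If W has particle system P, then for almost all x and z its stationary wave function
is (1 - 1ᵀ(x - M)⁻¹(z - L)⁻¹1) exp(xz) (`HasParticleSystem.exists_hasCMForm`, `HasCMForm.hasWave`).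
The reason is that the numerator of the wave function is fixed by its residues at the simple roots
of τ, and the vector of residues solves a linear system with matrix z - L.

In this form the theorem becomes matrix algebra. Exchanging x and z and transposing turns (M, L)
into (Lᵀ, Mᵀ), so the positions of β(P) are the eigenvalues of L (`HasWave.isBispectralImage`,
`HasWave.hasPositions`). The KP flow fixes L and moves M to M - ξ'(L), where ξ' is the z-derivative
of the phase (`HasCMForm.flow`). Hence β(P(t)) belongs to the pair (Lᵀ, Mᵀ - ξ'(Lᵀ)): same
eigenvalues, and a second matrix that is linear in the times.

Particle data are recovered from a pair without diagonalizing it, by expanding the wave function at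
z = ∞. The coefficient of 1/z is a trace of resolvents and gives the positions (`CMEq.charpoly_eq`).
The coefficient of 1/z² gives the row sums of L; off-diagonal entries depend on positions only, so
with equal positions these sums determine the momenta (`CMEq.sum_sub_eq`, `mem_particles_of_cmEq`).
This also makes β independent of the choice of W and V. That an image V exists, even when the
eigenvalues of L collide, comes from `IsCMPair.exists_rationalSolution`, which builds the conditions
at each eigenvalue by a dimension count. -/

theorem iteratedDeriv_add_of_differentiable {f g : ℂ → ℂ} (hf : Differentiable ℂ f)
    (hg : Differentiable ℂ g) (l : ℕ) (a : ℂ) :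
    iteratedDeriv l (fun z => f z + g z) a = iteratedDeriv l f a + iteratedDeriv l g a :=
  iteratedDeriv_fun_add (hf.contDiff.contDiffAt) (hg.contDiff.contDiffAt)

theorem deriv_mul_exp {g h : ℂ → ℂ} (hg : Differentiable ℂ g) (hh : Differentiable ℂ h) (s : ℂ) :
    deriv (fun z => g z * Complex.exp (s * h z)) =
      fun z => deriv g z * Complex.exp (s * h z) +
        s * ((deriv h z * g z) * Complex.exp (s * h z)) := by
  funext z
  have := ((hg z).hasDerivAt.mul (((hh z).hasDerivAt.const_mul s).cexp)).deriv
  rw [show (fun z => g z * Complex.exp (s * h z)) = g * fun z => Complex.exp (s * h z) from rfl,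
    this]
  ring

theorem differentiable_deriv {f : ℂ → ℂ} (hf : Differentiable ℂ f) : Differentiable ℂ (deriv f) :=
  (hf.contDiff (n := 2)).differentiable_deriv_two

/-- Derivatives in z and in the parameter s commute. The induction on the order `l` needs `g`
arbitrary, since one z-derivative replaces it by `deriv g` and `deriv h * g`. -/
theorem hasDerivAt_iteratedDeriv_mul_exp {h : ℂ → ℂ} (hh : Differentiable ℂ h) (a : ℂ) (l : ℕ) :
    ∀ {g : ℂ → ℂ}, Differentiable ℂ g → ∀ s : ℂ,
      HasDerivAt (fun s => iteratedDeriv l (fun z => g z * Complex.exp (s * h z)) a)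
        (iteratedDeriv l (fun z => (h z * g z) * Complex.exp (s * h z)) a) s := by
  have hh' := differentiable_deriv hh
  induction l with
  | zero =>
    intro g hg s
    simp only [iteratedDeriv_zero]
    have := (((hasDerivAt_id s).mul_const (h a)).cexp).const_mul (g a)
    refine this.congr_deriv ?_
    simp only [id]; ring
  | succ l ih =>
    intro g hg s
    have hg' := differentiable_deriv hg
    have key : ∀ s, iteratedDeriv (l + 1) (fun z => g z * Complex.exp (s * h z)) a =
        iteratedDeriv l (fun z => deriv g z * Complex.exp (s * h z)) a +
          s * iteratedDeriv l (fun z => (deriv h z * g z) * Complex.exp (s * h z)) a := by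
      intro s
      rw [iteratedDeriv_succ', deriv_mul_exp hg hh,
        iteratedDeriv_add_of_differentiable (by fun_prop) (by fun_prop),
        iteratedDeriv_const_mul_field]
    simp only [key]
    have h1 := (ih hg' s).add ((hasDerivAt_id s).mul (ih (hh'.mul hg) s))
    refine h1.congr_deriv ?_
    rw [iteratedDeriv_succ', show (fun z => h z * g z * Complex.exp (s * h z)) =
      fun z => (h * g) z * Complex.exp (s * h z) from rfl, deriv_mul_exp (hh.mul hg) hh]
    have e : (fun z => deriv (h * g) z * Complex.exp (s * h z) +
        s * ((deriv h z * (h * g) z) * Complex.exp (s * h z))) = fun z =>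
        (h z * deriv g z) * Complex.exp (s * h z) + ((deriv h z * g z) * Complex.exp (s * h z) +
          s * ((h z * (deriv h z * g z)) * Complex.exp (s * h z))) := by
      funext z
      rw [deriv_mul (hh z) (hg z)]
      simp only [Pi.mul_apply]; ring
    have e0 : (fun z => h z * g z) = h * g := rfl
    simp only [← Pi.mul_apply] at *
    rw [e, iteratedDeriv_add_of_differentiable (by fun_prop) (by fun_prop),
      iteratedDeriv_add_of_differentiable (by fun_prop) (by fun_prop),
      iteratedDeriv_const_mul_field]
    simp only [Pi.mul_apply, id]; ring

/-- Joint regularity in the first two times, which the implicit function theorem and the chain rule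
for moving roots of τ require. -/
theorem contDiff_iteratedDeriv_mul_exp (a : ℂ) (l : ℕ) :
    ∀ {g : ℂ → ℂ}, Differentiable ℂ g →
      ContDiff ℂ 1 (fun p : ℂ × ℂ =>
        iteratedDeriv l (fun z => g z * Complex.exp (p.1 * z + p.2 * z ^ 2)) a) := by
  induction l with
  | zero =>
    intro g hg
    simp only [iteratedDeriv_zero]
    fun_prop
  | succ l ih =>
    intro g hg
    have hg' := differentiable_deriv hg
    have key : ∀ p : ℂ × ℂ,
        iteratedDeriv (l + 1) (fun z => g z * Complex.exp (p.1 * z + p.2 * z ^ 2)) a =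
        iteratedDeriv l (fun z => deriv g z * Complex.exp (p.1 * z + p.2 * z ^ 2)) a +
          (p.1 * iteratedDeriv l (fun z => g z * Complex.exp (p.1 * z + p.2 * z ^ 2)) a +
          p.2 * iteratedDeriv l (fun z => (2 * z * g z) *
            Complex.exp (p.1 * z + p.2 * z ^ 2)) a) := by
      intro p
      have e : deriv (fun z => g z * Complex.exp (p.1 * z + p.2 * z ^ 2)) = fun z =>
          deriv g z * Complex.exp (p.1 * z + p.2 * z ^ 2) +
          (p.1 * (g z * Complex.exp (p.1 * z + p.2 * z ^ 2)) +
            p.2 * ((2 * z * g z) * Complex.exp (p.1 * z + p.2 * z ^ 2))) := by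
        funext z
        have := ((hg z).hasDerivAt.mul ((((hasDerivAt_id z).const_mul p.1).add
          (((hasDerivAt_id z).pow 2).const_mul p.2)).cexp)).deriv
        refine Eq.trans ?_ (this.trans ?_)
        · rfl
        · simp; ring
      rw [iteratedDeriv_succ', e, iteratedDeriv_add_of_differentiable (by fun_prop) (by fun_prop),
        iteratedDeriv_add_of_differentiable (by fun_prop) (by fun_prop),
        iteratedDeriv_const_mul_field, iteratedDeriv_const_mul_field]
    simp only [key]
    have h1 := ih hg'
    have h2 := ih hg
    have h3 := ih (g := fun z => 2 * z * g z) (by fun_prop)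
    fun_prop

/-! ### Conditions applied to entire functions -/

namespace DiffCond

theorem eval_add (c : DiffCond) {f g : ℂ → ℂ} (hf : Differentiable ℂ f)
    (hg : Differentiable ℂ g) :
    c.eval (fun z => f z + g z) = c.eval f + c.eval g := by
  simp only [eval, Finsupp.sum, ← Finset.sum_add_distrib, ← mul_add]
  exact Finset.sum_congr rfl fun p _ => by rw [iteratedDeriv_add_of_differentiable hf hg]

theorem eval_const_mul (c : DiffCond) (k : ℂ) (f : ℂ → ℂ) :
    c.eval (fun z => k * f z) = k * c.eval f := by
  simp only [eval, Finsupp.sum, Finset.mul_sum]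
  exact Finset.sum_congr rfl fun p _ => by rw [iteratedDeriv_const_mul_field]; ring

/-- The value of a condition on a fixed function, as a linear form in the condition. -/
def evalLin (f : ℂ → ℂ) : DiffCond →ₗ[ℂ] ℂ :=
  Finsupp.linearCombination ℂ fun p : ℂ × ℕ => iteratedDeriv p.2 f p.1

theorem evalLin_apply (f : ℂ → ℂ) (c : DiffCond) : evalLin f c = c.eval f := by
  simp [evalLin, Finsupp.linearCombination_apply, eval]

theorem hasDerivAt_eval {g h : ℂ → ℂ} (c : DiffCond) (hg : Differentiable ℂ g)
    (hh : Differentiable ℂ h) (s : ℂ) :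
    HasDerivAt (fun s => c.eval fun z => g z * Complex.exp (s * h z))
      (c.eval fun z => (h z * g z) * Complex.exp (s * h z)) s := by
  simp only [eval, Finsupp.sum]
  exact HasDerivAt.fun_sum fun p _ =>
    (hasDerivAt_iteratedDeriv_mul_exp hh p.1 p.2 hg s).const_mul _

/-- The value of a condition on `g (z) exp (x z + y z ^ 2)`, linear in the polynomial `g`. -/
def mom (c : DiffCond) (x y : ℂ) : Polynomial ℂ →ₗ[ℂ] ℂ where
  toFun g := c.eval fun z => g.eval z * Complex.exp (x * z + y * z ^ 2)
  map_add' f g := by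
    simp only [Polynomial.eval_add, add_mul]
    exact c.eval_add (by fun_prop) (by fun_prop)
  map_smul' k g := by
    simp only [Polynomial.eval_smul, smul_eq_mul, mul_assoc, RingHom.id_apply]
    exact c.eval_const_mul _ _

theorem mom_apply (c : DiffCond) (x y : ℂ) (g : Polynomial ℂ) :
    c.mom x y g = c.eval fun z => g.eval z * Complex.exp (x * z + y * z ^ 2) := rfl

theorem mom_zero_apply (c : DiffCond) (x : ℂ) (g : Polynomial ℂ) :
    c.mom x 0 g = c.eval fun z => g.eval z * Complex.exp (x * z) := by
  simp [mom_apply]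

/-- Differentiation in the first time is multiplication by z under the condition; in the second
time, by z². -/
theorem hasDerivAt_mom_fst (c : DiffCond) (x y : ℂ) (g : Polynomial ℂ) :
    HasDerivAt (fun x => c.mom x y g) (c.mom x y (Polynomial.X * g)) x := by
  have := c.hasDerivAt_eval (g := fun z => g.eval z * Complex.exp (y * z ^ 2)) (h := fun z => z)
    (by fun_prop) (by fun_prop) x
  simp only [mom_apply, Complex.exp_add, Polynomial.eval_mul, Polynomial.eval_X]
  refine (this.congr_deriv ?_).congr_of_eventuallyEq (Eventually.of_forall fun s => ?_) <;>
  · beta_reduce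
    congr 1; funext z; ring

theorem hasDerivAt_mom_snd (c : DiffCond) (x y : ℂ) (g : Polynomial ℂ) :
    HasDerivAt (fun y => c.mom x y g) (c.mom x y (Polynomial.X ^ 2 * g)) y := by
  have := c.hasDerivAt_eval (g := fun z => g.eval z * Complex.exp (x * z)) (h := fun z => z ^ 2)
    (by fun_prop) (by fun_prop) y
  simp only [mom_apply, Complex.exp_add, Polynomial.eval_mul, Polynomial.eval_X,
    Polynomial.eval_pow]
  refine (this.congr_deriv ?_).congr_of_eventuallyEq (Eventually.of_forall fun s => ?_) <;>
  · beta_reduce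
    congr 1; funext z; ring

theorem contDiff_mom (c : DiffCond) (g : Polynomial ℂ) :
    ContDiff ℂ 1 fun p : ℂ × ℂ => c.mom p.1 p.2 g := by
  simp only [mom_apply, eval, Finsupp.sum]
  exact ContDiff.sum fun p _ =>
    contDiff_const.mul (contDiff_iteratedDeriv_mul_exp p.1 p.2 (by fun_prop))

/-- The value on a fixed `g (z) exp (x z + y z ^ 2)`, linear in the condition. -/
theorem mom_eq_evalLin (c : DiffCond) (x y : ℂ) (g : Polynomial ℂ) :
    c.mom x y g = evalLin (fun z => g.eval z * Complex.exp (x * z + y * z ^ 2)) c :=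
  (evalLin_apply _ _).symm

theorem mom_sum {ι : Type*} (s : Finset ι) (v : ι → ℂ) (c : ι → DiffCond) (x y : ℂ)
    (g : Polynomial ℂ) :
    DiffCond.mom (∑ i ∈ s, v i • c i) x y g = ∑ i ∈ s, v i * (c i).mom x y g := by
  simp [mom_eq_evalLin, map_sum]

end DiffCond

namespace DiffCond

/-! ### Conditions at one point as polynomials -/

/-- The condition `∑ p_l d (l, a)` at the point `a` with the coefficients of a polynomial. -/
def ofPoly (a : ℂ) : ℂ[X] →ₗ[ℂ] DiffCond :=
  (Finsupp.curryLinearEquiv ℂ).symm.toLinearMap ∘ₗ Finsupp.lsingle a ∘ₗ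
    (basisMonomials ℂ).repr.toLinearMap

theorem ofPoly_monomial (a : ℂ) (l : ℕ) (k : ℂ) :
    ofPoly a (monomial l k) = Finsupp.single (a, l) k := by
  have h : (basisMonomials ℂ).repr (monomial l k) = Finsupp.single l k := by
    rw [← mul_one k, ← smul_eq_mul, ← smul_monomial, map_smul,
      show monomial l (1 : ℂ) = basisMonomials ℂ l by rw [coe_basisMonomials],
      Module.Basis.repr_self, Finsupp.smul_single]
  rw [ofPoly, LinearMap.comp_apply, LinearMap.comp_apply, LinearEquiv.coe_coe, LinearEquiv.coe_coe,
    h, LinearEquiv.symm_apply_eq]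
  simp [Finsupp.curry_single]

theorem ofPoly_supportedAt (a : ℂ) (p : ℂ[X]) : (ofPoly a p).SupportedAt a := by
  intro r hr
  by_contra hne
  refine (Finsupp.mem_support_iff.mp hr) ?_
  change ((Finsupp.single a ((basisMonomials ℂ).repr p)) r.1) r.2 = 0
  rw [Finsupp.single_eq_of_ne hne]; rfl

theorem SupportedAt.exists_ofPoly {c : DiffCond} {a : ℂ} (h : c.SupportedAt a) :
    ∃ p : ℂ[X], c = ofPoly a p := by
  refine ⟨∑ r ∈ c.support, monomial r.2 (c r), ?_⟩
  rw [map_sum]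
  conv_lhs => rw [← Finsupp.sum_single c]
  refine Finset.sum_congr rfl fun r hr => ?_
  rw [ofPoly_monomial, ← h r hr]

/-- Conditions at different points lie in different summands, so independence may be checked one
point at a time. -/
theorem linearIndependent_ofPoly {κ : ℂ → Type*} (p : ∀ a, κ a → ℂ[X])
    (h : ∀ a, LinearIndependent ℂ (p a)) :
    LinearIndependent ℂ fun s : Σ a, κ a => ofPoly s.1 (p s.1 s.2) :=
  (Finsupp.linearIndependent_single (fun a k => (basisMonomials ℂ).repr (p a k)) fun a =>
    (h a).map' (basisMonomials ℂ).repr.toLinearMap (LinearEquiv.ker _)).map'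
      (Finsupp.curryLinearEquiv ℂ).symm.toLinearMap (LinearEquiv.ker _)

/-- Differentiation of a polynomial factor of `p (x) exp (a x)`. -/
def twist (a : ℂ) : Module.End ℂ ℂ[X] := algebraMap ℂ _ a + Polynomial.derivative

theorem twist_apply (a : ℂ) (p : ℂ[X]) : twist a p = C a * p + derivative p := by
  simp [twist, Module.algebraMap_end_apply, smul_eq_C_mul]

theorem hasDerivAt_exp_mul_eval (a : ℂ) (p : ℂ[X]) (x : ℂ) :
    HasDerivAt (fun x => Complex.exp (a * x) * p.eval x)
      (Complex.exp (a * x) * (twist a p).eval x) x := by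
  have := (((hasDerivAt_id x).const_mul a).cexp).mul (p.hasDerivAt x)
  refine this.congr_deriv ?_
  simp [twist_apply]; ring

theorem mom_ofPoly_one (a : ℂ) (p : ℂ[X]) (x : ℂ) :
    (ofPoly a p).mom x 0 1 = Complex.exp (a * x) * p.eval x := by
  induction p using Polynomial.induction_on' with
  | add p q hp hq =>
    rw [mom_eq_evalLin] at *
    rw [map_add, map_add, hp, hq, Polynomial.eval_add]; ring
  | monomial l k =>
    rw [ofPoly_monomial, mom_zero_apply, DiffCond.eval, Finsupp.sum_single_index (by simp)]
    simp only [eval_one, one_mul, iteratedDeriv_cexp_const_mul, eval_monomial]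
    rw [mul_comm x a]; ring

/-- Multiplication by z under the condition is d/dx outside it, and d/dx acts on exp(ax) p(x)
through `twist a`. -/
theorem mom_ofPoly (a : ℂ) (p g : ℂ[X]) (x : ℂ) :
    (ofPoly a p).mom x 0 g = Complex.exp (a * x) * (aeval (twist a) g p).eval x := by
  have key : ∀ n : ℕ, ∀ x : ℂ, (ofPoly a p).mom x 0 (X ^ n) =
      Complex.exp (a * x) * (((twist a) ^ n) p).eval x := by
    intro n
    induction n with
    | zero => intro x; simp [mom_ofPoly_one]
    | succ n ih =>
      intro x
      have h1 := (ofPoly a p).hasDerivAt_mom_fst x 0 (X ^ n)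
      rw [funext ih] at h1
      rw [pow_succ', h1.unique (hasDerivAt_exp_mul_eval a _ x), pow_succ', Module.End.mul_apply]
  induction g using Polynomial.induction_on' with
  | add g h hg hh => simp [hg, hh, mul_add]
  | monomial n k =>
    rw [← mul_one k, ← smul_eq_mul, ← smul_monomial, map_smul, ← X_pow_eq_monomial, key]
    simp; ring

/-! ### Separation of conditions by polynomials -/

/-- Take a term of highest order l, at a. A polynomial vanishing to order exactly l at a and to
order l + 1 at the other points of the support isolates its coefficient. -/
theorem eq_zero_of_eval_mul_eq_zero {c : DiffCond} {E : ℂ → ℂ} (hE : Differentiable ℂ E)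
    (h0 : ∀ z, E z ≠ 0) (h : ∀ g : ℂ[X], c.eval (fun z => g.eval z * E z) = 0) : c = 0 := by
  classical
  by_contra hne
  obtain ⟨⟨a, l⟩, hp, hmax⟩ :=
    Finset.exists_max_image c.support (fun p => p.2) (Finsupp.support_nonempty_iff.mpr hne)
  set S := (c.support.image Prod.fst).erase a with hS
  set r : ℂ[X] := ∏ b ∈ S, (X - C b) ^ (l + 1) with hr
  have h1 := h ((X - C a) ^ l * r)
  have hane : ∀ z, AnalyticAt ℂ (fun z => r.eval z * E z) z := fun z =>
    Differentiable.analyticAt (by fun_prop) z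
  rw [DiffCond.eval, Finsupp.sum, Finset.sum_eq_single (a, l)] at h1
  · obtain ⟨R, -, hR⟩ := iteratedDeriv_mul_pow_sub_of_analytic (k := l) (t := 0) (z₀ := a)
      (R := fun z => ((X - C a) ^ l * r).eval z * E z) hane
      (fun z => by simp; ring)
    rw [hR a] at h1
    have hra : r.eval a ≠ 0 := by
      rw [hr, eval_prod, Finset.prod_ne_zero_iff]
      intro b hb
      simp only [eval_pow, eval_sub, eval_X, eval_C]
      exact pow_ne_zero _ (sub_ne_zero.mpr (Finset.ne_of_mem_erase hb).symm)
    simp [Nat.factorial_ne_zero, hra, h0 a] at h1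
    exact (Finsupp.mem_support_iff.mp hp) h1
  · rintro ⟨b, k⟩ hq hqne
    have hkl : k ≤ l := hmax _ hq
    by_cases hba : b = a
    · subst hba
      have hk : k < l := lt_of_le_of_ne hkl fun h => hqne (by rw [h])
      obtain ⟨t, rfl⟩ := Nat.exists_eq_add_of_lt hk
      obtain ⟨R, -, hR⟩ := iteratedDeriv_mul_pow_sub_of_analytic (k := k) (t := t + 1) (z₀ := b)
        (R := fun z => ((X - C b) ^ (k + t + 1) * r).eval z * E z) hane
        (fun z => by simp; ring)
      simp only []
      rw [hR b]; simp
    · have hbS : b ∈ S := Finset.mem_erase.mpr ⟨hba, Finset.mem_image_of_mem Prod.fst hq⟩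
      obtain ⟨t, rfl⟩ := Nat.exists_eq_add_of_le hkl
      obtain ⟨R, -, hR⟩ := iteratedDeriv_mul_pow_sub_of_analytic (k := k) (t := t + 1) (z₀ := b)
        (R := fun z => ((X - C a) ^ (k + t) * r).eval z * E z)
        (R₁ := fun z => ((X - C a) ^ (k + t) *
          ∏ d ∈ S.erase b, (X - C d) ^ (k + t + 1)).eval z * E z)
        (fun z => Differentiable.analyticAt (by fun_prop) z)
        (fun z => by
          rw [hr, ← Finset.mul_prod_erase S _ hbS]; simp; ring)
      simp only []
      rw [hR b]; simp
  · intro h2; exact absurd hp h2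

theorem eq_zero_of_mom_eq_zero {c : DiffCond} {x : ℂ} (h : ∀ g : ℂ[X], c.mom x 0 g = 0) :
    c = 0 :=
  eq_zero_of_eval_mul_eq_zero (E := fun z => Complex.exp (x * z)) (by fun_prop)
    (fun _ => Complex.exp_ne_zero _) fun g => by rw [← mom_zero_apply, h]

end DiffCond

/-- Hermite interpolation of the jets of a function by a polynomial. -/
theorem exists_polynomial_iteratedDeriv_eq (S : Finset ℂ) (M : ℕ) (E : ℂ → ℂ) :
    ∃ g : ℂ[X], ∀ a ∈ S, ∀ k < M,
      iteratedDeriv k (fun z => g.eval z) a = iteratedDeriv k E a := by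
  classical
  let J : ℂ[X] →ₗ[ℂ] (S × Fin M → ℂ) :=
    LinearMap.pi fun s => (DiffCond.mom (Finsupp.single ((s.1 : ℂ), (s.2 : ℕ)) 1) 0 0)
  have hJ : ∀ g s, J g s = iteratedDeriv (s.2 : ℕ) (fun z => g.eval z) (s.1 : ℂ) := by
    intro g s
    simp [J, DiffCond.mom_zero_apply, DiffCond.eval, Finsupp.sum_single_index]
  have hsurj : LinearMap.range J = ⊤ := by
    by_contra hne
    obtain ⟨φ, hφ, hφJ⟩ :=
      Submodule.exists_dual_map_eq_bot_of_lt_top (lt_top_iff_ne_top.mpr hne) inferInstance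
    have hφ0 : ∀ g, φ (J g) = 0 := fun g => by
      have : φ (J g) ∈ (LinearMap.range J).map φ := Submodule.mem_map_of_mem ⟨g, rfl⟩
      rwa [hφJ, Submodule.mem_bot] at this
    have hφs : ∀ v, φ v = ∑ s, v s * φ (Pi.single s 1) := by
      intro v
      conv_lhs => rw [← Finset.univ_sum_single v]
      rw [map_sum]
      refine Finset.sum_congr rfl fun s _ => ?_
      rw [← smul_eq_mul, ← map_smul, ← Pi.single_smul, smul_eq_mul, mul_one]
    set c : DiffCond := ∑ s : S × Fin M,
      φ (Pi.single s 1) • Finsupp.single ((s.1 : ℂ), (s.2 : ℕ)) 1 with hc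
    have hc0 : c = 0 := by
      refine DiffCond.eq_zero_of_mom_eq_zero (x := 0) fun g => ?_
      rw [hc, DiffCond.mom_sum]
      refine Eq.trans ?_ (hφ0 g)
      rw [hφs (J g)]
      exact Finset.sum_congr rfl fun s _ => mul_comm _ _
    refine hφ (LinearMap.ext fun v => ?_)
    rw [hφs, LinearMap.zero_apply]
    refine Finset.sum_eq_zero fun s _ => ?_
    have h1 : c ((s.1 : ℂ), (s.2 : ℕ)) = φ (Pi.single s 1) := by
      rw [hc, Finsupp.finsetSum_apply, Finset.sum_eq_single s]
      · simp
      · intro r _ hr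
        rw [Finsupp.smul_apply, Finsupp.single_eq_of_ne, smul_zero]
        intro h
        apply hr
        rw [Prod.mk.injEq] at h
        exact Prod.ext (Subtype.ext h.1.symm) (Fin.ext h.2.symm)
      · simp
    rw [← h1, hc0]; simp
  have : (fun s : S × Fin M => iteratedDeriv (s.2 : ℕ) E (s.1 : ℂ)) ∈ LinearMap.range J := by
    rw [hsurj]; trivial
  obtain ⟨g, hg⟩ := this
  refine ⟨g, fun a ha k hk => ?_⟩
  rw [← hJ g (⟨a, ha⟩, ⟨k, hk⟩), hg]

/-! ### The KP flow on conditions -/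

/-- The KP phase as a polynomial. -/
def phasePoly (t : Times) : ℂ[X] := t.sum fun k a => monomial (k : ℕ) a

theorem eval_phasePoly (t : Times) (z : ℂ) : (phasePoly t).eval z = phase t z := by
  simp [phasePoly, phase, Finsupp.sum, eval_finsetSum, eval_monomial]

theorem eval_derivative_phasePoly (t : Times) (z : ℂ) :
    (derivative (phasePoly t)).eval z = phaseDeriv t z := by
  simp [phasePoly, phaseDeriv, Finsupp.sum, eval_finsetSum, eval_monomial, derivative_monomial,
    mul_comm]

theorem phase_eq_eval (t : Times) : phase t = fun z => (phasePoly t).eval z :=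
  funext fun z => (eval_phasePoly t z).symm

theorem differentiable_exp_phase (t : Times) :
    Differentiable ℂ fun z => Complex.exp (phase t z) := by
  rw [phase_eq_eval]; fun_prop

theorem phase_times₂ (x y z : ℂ) : phase (times₂ x y) z = x * z + y * z ^ 2 := by
  rw [phase, times₂, Finsupp.sum_add_index' (by simp) (by intros; ring),
    Finsupp.sum_single_index (by simp), Finsupp.sum_single_index (by simp)]
  simp

theorem iteratedDeriv_mul_of_differentiable {f g : ℂ → ℂ} (hf : Differentiable ℂ f)
    (hg : Differentiable ℂ g) (n : ℕ) (a : ℂ) :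
    iteratedDeriv n (fun z => f z * g z) a = ∑ i ∈ Finset.range (n + 1),
      n.choose i * iteratedDeriv i f a * iteratedDeriv (n - i) g a :=
  iteratedDeriv_fun_mul hf.contDiff.contDiffAt hg.contDiff.contDiffAt

theorem eval_flowCond (t : Times) (c : DiffCond) {f : ℂ → ℂ} (hf : Differentiable ℂ f) :
    (flowCond t c).eval f = c.eval fun z => f z * Complex.exp (phase t z) := by
  rw [← DiffCond.evalLin_apply, ← DiffCond.evalLin_apply, ← LinearMap.comp_apply]
  congr 1
  refine Finsupp.lhom_ext' fun p => LinearMap.ext_ring ?_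
  simp only [LinearMap.comp_apply, Finsupp.lsingle_apply, DiffCond.evalLin_apply, flowCond,
    Finsupp.linearCombination_single, one_smul]
  rw [← DiffCond.evalLin_apply, map_sum, DiffCond.eval, Finsupp.sum_single_index (by simp), one_mul,
    iteratedDeriv_mul_of_differentiable hf (differentiable_exp_phase t)]
  refine Finset.sum_congr rfl fun j _ => ?_
  rw [DiffCond.evalLin_apply, DiffCond.eval, Finsupp.sum_single_index (by simp)]
  ring

theorem iteratedDeriv_mul_congr {f g h : ℂ → ℂ} (hf : Differentiable ℂ f)
    (hg : Differentiable ℂ g) (hh : Differentiable ℂ h) {M : ℕ} {a : ℂ}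
    (H : ∀ k < M, iteratedDeriv k g a = iteratedDeriv k h a) {k : ℕ} (hk : k < M) :
    iteratedDeriv k (fun z => f z * g z) a = iteratedDeriv k (fun z => f z * h z) a := by
  rw [iteratedDeriv_mul_of_differentiable hf hg, iteratedDeriv_mul_of_differentiable hf hh]
  exact Finset.sum_congr rfl fun i _ => by rw [H _ (by omega)]

theorem iteratedDeriv_eval (k : ℕ) (p : ℂ[X]) :
    iteratedDeriv k (fun z => p.eval z) = fun z => (derivative^[k] p).eval z := by
  induction k generalizing p with
  | zero => simp
  | succ k ih =>
    rw [iteratedDeriv_succ', Function.iterate_succ_apply, ← ih]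
    congr 1
    funext z
    exact p.deriv

/-- The degree of χ bounds every root multiplicity, so this crude order of vanishing is enough. -/
theorem dvd_of_iteratedDeriv_eq_zero {χ u : ℂ[X]} (hχ : χ ≠ 0)
    (h : ∀ a ∈ χ.roots, ∀ k < χ.natDegree, iteratedDeriv k (fun z => u.eval z) a = 0) :
    χ ∣ u := by
  classical
  by_cases hu : u = 0
  · simp [hu]
  rw [IsAlgClosed.dvd_iff_roots_le_roots hχ hu, Multiset.le_iff_count]
  intro a
  by_cases ha : a ∈ χ.roots
  · obtain ⟨m, hm⟩ : ∃ m, χ.roots.count a = m + 1 :=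
      Nat.exists_eq_succ_of_ne_zero (Multiset.count_ne_zero.mpr ha)
    have hle : χ.roots.count a ≤ χ.natDegree :=
      (Multiset.count_le_card _ _).trans χ.card_roots'
    rw [hm, Nat.succ_le_iff, count_roots]
    refine lt_rootMultiplicity_of_isRoot_iterate_derivative hu fun k hk => ?_
    have := h a ha k (by omega)
    rwa [iteratedDeriv_eval] at this
  · simp [Multiset.count_eq_zero_of_notMem ha]

/-- On finitely many conditions and modulo a polynomial, the exponential of the phase acts as
a polynomial. -/
theorem exists_polynomial_flow {ι : Type*} [Fintype ι] (t : Times) (c : ι → DiffCond)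
    {χ : ℂ[X]} (hχ : χ ≠ 0) :
    ∃ G : ℂ[X], (∀ i x g, (flowCond t (c i)).mom x 0 g = (c i).mom x 0 (G * g)) ∧
      χ ∣ derivative G - derivative (phasePoly t) * G := by
  classical
  set E : ℂ → ℂ := fun z => Complex.exp (phase t z) with hE
  have hEd : Differentiable ℂ E := differentiable_exp_phase t
  have hE' : deriv E = fun z => (derivative (phasePoly t)).eval z * E z := by
    funext z
    rw [hE, phase_eq_eval]
    have := ((phasePoly t).hasDerivAt z).cexp.deriv
    simpa [mul_comm] using this
  set S : Finset ℂ := χ.roots.toFinset ∪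
    Finset.univ.biUnion fun i => (c i).support.image Prod.fst with hS
  -- The order covers every derivative occurring in the conditions, and one more than deg χ because
  -- the congruence modulo χ involves G'.
  set M : ℕ := χ.natDegree + 1 +
    ∑ i, ∑ p ∈ (c i).support, (p.2 + 1) with hM
  obtain ⟨G, hG⟩ := exists_polynomial_iteratedDeriv_eq S M E
  refine ⟨G, fun i x g => ?_, dvd_of_iteratedDeriv_eq_zero hχ fun a ha k hk => ?_⟩
  · rw [DiffCond.mom_zero_apply, DiffCond.mom_zero_apply, eval_flowCond t _ (by fun_prop)]
    simp only [DiffCond.eval, Finsupp.sum]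
    refine Finset.sum_congr rfl fun p hp => ?_
    congr 1
    have hpS : p.1 ∈ S := Finset.mem_union_right _ (Finset.mem_biUnion.mpr
      ⟨i, Finset.mem_univ _, Finset.mem_image_of_mem _ hp⟩)
    have h1 : p.2 + 1 ≤ ∑ p ∈ (c i).support, (p.2 + 1) :=
      Finset.single_le_sum (f := fun p : ℂ × ℕ => p.2 + 1) (fun _ _ => Nat.zero_le _) hp
    have h2 : ∑ p ∈ (c i).support, (p.2 + 1) ≤ ∑ i, ∑ p ∈ (c i).support, (p.2 + 1) :=
      Finset.single_le_sum (f := fun i => ∑ p ∈ (c i).support, (p.2 + 1))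
        (fun _ _ => Nat.zero_le _) (Finset.mem_univ i)
    have := iteratedDeriv_mul_congr (f := fun z => g.eval z * Complex.exp (x * z))
      (by fun_prop) hEd (by fun_prop) (fun k hk => (hG p.1 hpS k hk).symm)
      (k := p.2) (by omega)
    rw [this]
    congr 1
    funext z
    rw [eval_mul]; ring
  · have haS : a ∈ S := Finset.mem_union_left _ (Multiset.mem_toFinset.mpr ha)
    have h1 : iteratedDeriv k (fun z => (derivative G).eval z) a =
        iteratedDeriv k (deriv E) a := by
      have e : (fun z => (derivative G).eval z) = deriv fun z => G.eval z :=
        funext fun z => G.deriv.symm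
      rw [e, ← iteratedDeriv_succ', ← iteratedDeriv_succ', hG a haS _ (by omega)]
    have h2 := iteratedDeriv_mul_congr (f := fun z => (derivative (phasePoly t)).eval z)
      (by fun_prop) (g := fun z => G.eval z) (by fun_prop) hEd (fun k hk => hG a haS k hk)
      (k := k) (by omega)
    have h3 := iteratedDeriv_add_of_differentiable
      (f := fun z => (derivative G - derivative (phasePoly t) * G).eval z)
      (g := fun z => (derivative (phasePoly t)).eval z * G.eval z) (by fun_prop) (by fun_prop) k a
    simp only [eval_sub, eval_mul, sub_add_cancel] at h3 ⊢
    rw [h1, h2, hE'] at h3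
    exact right_eq_add.mp h3

/-! ### Polynomials in `x` with coefficients in `ℂ[z]`

A polynomial `B : ℂ[X][X]` has the outer variable `x` and the inner variable `z`. -/

/-- The operator `∂_x + z`, that is, differentiation in `x` of a factor of `exp (x z)`. -/
def shiftDeriv (B : ℂ[X][X]) : ℂ[X][X] := derivative B + C X * B

/-- As a polynomial in `z`, `B` has degree at most `n`, and its coefficient of `z ^ n` is `τ`. -/
def HasTopCoeff (B : ℂ[X][X]) (n : ℕ) (τ : ℂ[X]) : Prop :=
  ∀ k m, n ≤ m → (B.coeff k).coeff m = if m = n then τ.coeff k else 0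

/-- The factor z raises the degree in z by one and keeps the leading coefficient; ∂_x does not raise
the degree. -/
theorem HasTopCoeff.shiftDeriv {B : ℂ[X][X]} {n : ℕ} {τ : ℂ[X]} (h : HasTopCoeff B n τ) :
    HasTopCoeff (shiftDeriv B) (n + 1) τ := by
  intro k m hm
  obtain ⟨m, rfl⟩ : ∃ r, m = r + 1 := ⟨m - 1, by omega⟩
  have h1 := h (k + 1) (m + 1) (by omega)
  have h2 := h k m (by omega)
  rw [if_neg (by omega)] at h1
  have e : ((k : ℂ[X]) + 1) = C ((k : ℂ) + 1) := by simp
  rw [CalogeroMoser.shiftDeriv, coeff_add, coeff_derivative, coeff_C_mul, coeff_add, coeff_X_mul,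
    h2, e, coeff_mul_C, h1]
  simp

theorem HasTopCoeff.map_mul {B : ℂ[X][X]} {n : ℕ} {τ : ℂ[X]} (h : HasTopCoeff B n τ)
    (P : ℂ[X]) : HasTopCoeff (P.map C * B) n (P * τ) := by
  intro k m hm
  rw [coeff_mul, finsetSum_coeff, coeff_mul]
  simp only [coeff_map, coeff_C_mul]
  split_ifs with hmn
  · exact Finset.sum_congr rfl fun p _ => by rw [h _ _ hm, if_pos hmn]
  · exact Finset.sum_eq_zero fun p _ => by rw [h _ _ hm, if_neg hmn, mul_zero]

theorem HasTopCoeff.sub_lower {A B : ℂ[X][X]} {n : ℕ} {τ ρ : ℂ[X]} (hA : HasTopCoeff A (n + 1) τ)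
    (hB : HasTopCoeff B n ρ) : HasTopCoeff (A - B) (n + 1) τ := by
  intro k m hm
  rw [coeff_sub, coeff_sub, hA _ _ hm, hB _ _ (by omega), if_neg (show m ≠ n by omega), sub_zero]

theorem HasTopCoeff.coeff_eval {B : ℂ[X][X]} {n : ℕ} {τ : ℂ[X]} (h : HasTopCoeff B n τ) (x : ℂ)
    {m : ℕ} (hm : n ≤ m) : (B.eval (C x)).coeff m = if m = n then τ.eval x else 0 := by
  rw [eval_eq_sum_range' (n := B.natDegree + τ.natDegree + 1) (by omega), finsetSum_coeff,
    eval_eq_sum_range' (n := B.natDegree + τ.natDegree + 1) (by omega)]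
  simp only [← C_pow, coeff_mul_C]
  split_ifs with hmn
  · exact Finset.sum_congr rfl fun k _ => by rw [h _ _ hm, if_pos hmn]
  · exact Finset.sum_eq_zero fun k _ => by rw [h _ _ hm, if_neg hmn, zero_mul]

theorem HasTopCoeff.natDegree_eval_le {B : ℂ[X][X]} {n : ℕ} {τ : ℂ[X]} (h : HasTopCoeff B n τ)
    (x : ℂ) : (B.eval (C x)).natDegree ≤ n :=
  natDegree_le_iff_coeff_eq_zero.mpr fun m hm => by
    rw [h.coeff_eval x hm.le, if_neg (ne_of_gt hm)]

namespace DiffCond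

theorem hasDerivAt_mom_eval (c : DiffCond) (B : ℂ[X][X]) (x : ℂ) :
    HasDerivAt (fun x => c.mom x 0 (B.eval (C x))) (c.mom x 0 ((shiftDeriv B).eval (C x))) x := by
  induction B using Polynomial.induction_on' with
  | add A B hA hB =>
    simp only [Polynomial.eval_add, map_add]
    refine (hA.fun_add hB).congr_deriv ?_
    rw [← map_add, ← Polynomial.eval_add]
    simp only [shiftDeriv, derivative_add]
    congr 2; ring
  | monomial k b =>
    have h1 : ∀ x : ℂ, (monomial k b).eval (C x) = x ^ k • b := fun x => by
      rw [eval_monomial, ← C_pow, mul_comm, smul_eq_C_mul]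
    simp only [h1, map_smul, smul_eq_mul]
    refine ((hasDerivAt_pow k x).mul (c.hasDerivAt_mom_fst x 0 b)).congr_deriv ?_
    rw [shiftDeriv, Polynomial.eval_add, eval_mul, h1, eval_C, derivative_monomial,
      eval_monomial, map_add,
      mul_smul_comm, map_smul, smul_eq_mul,
      show b * (k : ℂ[X]) * C x ^ (k - 1) = ((k : ℂ) * x ^ (k - 1)) • b by
        rw [smul_eq_C_mul]; simp; ring, map_smul, smul_eq_mul]

theorem exists_mom_ofPoly_eval (a : ℂ) (p : ℂ[X]) (B : ℂ[X][X]) :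
    ∃ P : ℂ[X], ∀ x, (ofPoly a p).mom x 0 (B.eval (C x)) = Complex.exp (a * x) * P.eval x := by
  induction B using Polynomial.induction_on' with
  | add A B hA hB =>
    obtain ⟨P, hP⟩ := hA
    obtain ⟨Q, hQ⟩ := hB
    exact ⟨P + Q, fun x => by
      rw [Polynomial.eval_add, map_add, hP, hQ, Polynomial.eval_add, mul_add]⟩
  | monomial k b =>
    refine ⟨X ^ k * aeval (twist a) b p, fun x => ?_⟩
    rw [eval_monomial, ← C_pow, mul_comm, ← smul_eq_C_mul, map_smul, mom_ofPoly]
    simp; ring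

theorem mom_eq_sum (c : DiffCond) (x y : ℂ) {g : ℂ[X]} {n : ℕ} (h : g.natDegree < n) :
    c.mom x y g = ∑ j ∈ Finset.range n, g.coeff j * c.mom x y (X ^ j) := by
  conv_lhs => rw [g.as_sum_range' n h, map_sum]
  refine Finset.sum_congr rfl fun j _ => ?_
  rw [← smul_eq_mul, ← map_smul, smul_eq_C_mul, C_mul_X_pow_eq_monomial]

/-- Differentiating the identity in x yields kernel polynomials of every degree n + j, with leading
coefficient τ(x₀) ≠ 0. So all monomials at x₀ reduce to those of degree below n, which c kills as
well. This is the source of all nondegeneracy: P ≠ 0 in the Darboux step and T ≠ 0 for the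
Wronskian. -/
theorem eq_zero_of_mom_eval_eq_zero {c : DiffCond} {B : ℂ[X][X]} {n : ℕ} {τ : ℂ[X]}
    (hB : HasTopCoeff B n τ) {x₀ : ℂ} (hx : τ.eval x₀ ≠ 0)
    (h : ∀ x, c.mom x 0 (B.eval (C x)) = 0) (h0 : ∀ j < n, c.mom x₀ 0 (X ^ j) = 0) : c = 0 := by
  have htop : ∀ j, HasTopCoeff (shiftDeriv^[j] B) (n + j) τ := fun j => by
    induction j with
    | zero => exact hB
    | succ j ih => rw [Function.iterate_succ_apply']; exact ih.shiftDeriv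
  have hker : ∀ j x, c.mom x 0 ((shiftDeriv^[j] B).eval (C x)) = 0 := fun j => by
    induction j with
    | zero => exact h
    | succ j ih =>
      intro x
      rw [Function.iterate_succ_apply']
      have h1 := c.hasDerivAt_mom_eval (shiftDeriv^[j] B) x
      rw [funext ih] at h1
      exact h1.unique (hasDerivAt_const x 0)
  have hX : ∀ m, c.mom x₀ 0 (X ^ m) = 0 := by
    intro m
    induction m using Nat.strong_induction_on with
    | _ m ih =>
      by_cases hm : m < n
      · exact h0 m hm
      · obtain ⟨j, rfl⟩ := Nat.exists_eq_add_of_le (not_lt.mp hm)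
        have h1 := hker j x₀
        rw [c.mom_eq_sum x₀ 0 (Nat.lt_succ_of_le ((htop j).natDegree_eval_le x₀)),
          Finset.sum_range_succ, Finset.sum_eq_zero, zero_add, (htop j).coeff_eval x₀ le_rfl,
          if_pos rfl] at h1
        · exact (mul_eq_zero.mp h1).resolve_left hx
        · intro i hi
          rw [ih i (Finset.mem_range.mp hi), mul_zero]
  refine eq_zero_of_mom_eq_zero (x := x₀) fun g => ?_
  rw [c.mom_eq_sum x₀ 0 (Nat.lt_succ_self g.natDegree)]
  exact Finset.sum_eq_zero fun j _ => by rw [hX, mul_zero]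

end DiffCond

/-! ### Darboux construction of the kernel functions -/

theorem degree_derivative_lt_of_le {p τ : ℂ[X]} (hτ : τ ≠ 0) (h : p.degree ≤ τ.degree) :
    (derivative p).degree < τ.degree := by
  by_cases hp : p = 0
  · rw [hp, derivative_zero, degree_zero]
    exact bot_lt_iff_ne_bot.mpr (degree_ne_bot.mpr hτ)
  · exact (degree_derivative_lt hp).trans_le h

theorem degree_mul_lt_mul {p q r s : ℂ[X]} (hr : r ≠ 0) (hp : p.degree ≤ r.degree)
    (hq : q.degree < s.degree) : (p * q).degree < (r * s).degree := by
  rw [degree_mul, degree_mul]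
  exact (add_le_add_left hp _).trans_lt
    (WithBot.add_lt_add_left (degree_ne_bot.mpr hr) hq)

theorem exists_eval_ne_zero {p : ℂ[X]} (hp : p ≠ 0) : ∃ x, p.eval x ≠ 0 := by
  by_contra! h
  exact hp (Polynomial.funext fun x => by rw [h, eval_zero])

/-- The monic kernel functions of a family of conditions: up to the factor `τ (x)` they are
polynomial in `x`, and tend to `q (z)` for `x → ∞`. -/
theorem exists_kernel_family (n : ℕ) :
    ∀ (a : Fin n → ℂ) (c : Fin n → DiffCond), (∀ i, (c i).SupportedAt (a i)) →
      LinearIndependent ℂ c →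
      ∃ (B : ℂ[X][X]) (τ : ℂ[X]), τ ≠ 0 ∧ HasTopCoeff B n τ ∧
        (∀ i x, (c i).mom x 0 (B.eval (C x)) = 0) ∧
        ∀ z, (B.map (evalRingHom z) - C (∏ i, (z - a i)) * τ).degree < τ.degree := by
  induction n with
  | zero =>
    intro a c _ _
    refine ⟨1, 1, one_ne_zero, fun k m _ => ?_, fun i => i.elim0, fun z => by simp⟩
    simp only [coeff_one]
    split_ifs <;> simp_all [coeff_one]
  | succ n ih =>
    intro a c hs hli
    obtain ⟨B, τ, hτ, htop, hker, hdeg⟩ := ih (fun i => a i.castSucc) (fun i => c i.castSucc)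
      (fun i => hs _) (hli.comp _ (Fin.castSucc_injective n))
    obtain ⟨p, hp⟩ := (hs (Fin.last n)).exists_ofPoly
    obtain ⟨P, hP⟩ := DiffCond.exists_mom_ofPoly_eval (a (Fin.last n)) p B
    rw [← hp] at hP
    -- If P = 0, all n + 1 conditions annihilate B. Some nonzero combination of them also kills the
    -- n monomials of degree below n at x₀, so it is zero, against linear independence.
    have hP0 : P ≠ 0 := by
      rintro rfl
      obtain ⟨x₀, hx₀⟩ := exists_eval_ne_zero hτ
      have hall : ∀ i x, (c i).mom x 0 (B.eval (C x)) = 0 := by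
        intro i x
        refine Fin.lastCases ?_ (fun i => hker i x) i
        rw [hP]; simp
      let L : (Fin (n + 1) → ℂ) →ₗ[ℂ] (Fin n → ℂ) :=
        (Matrix.of fun (j : Fin n) i => (c i).mom x₀ 0 (X ^ (j : ℕ))).mulVecLin
      have hL := LinearMap.ker_ne_bot_of_finrank_lt (f := L) (by simp)
      obtain ⟨v, hv, hv0⟩ := Submodule.exists_mem_ne_zero_of_ne_bot hL
      refine hv0 (funext (Fintype.linearIndependent_iff.mp hli v ?_))
      refine DiffCond.eq_zero_of_mom_eval_eq_zero htop hx₀ (fun x => ?_) fun j hj => ?_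
      · rw [DiffCond.mom_sum]
        exact Finset.sum_eq_zero fun i _ => by rw [hall, mul_zero]
      · rw [DiffCond.mom_sum]
        have := congrFun (LinearMap.mem_ker.mp hv) ⟨j, hj⟩
        simp only [L, Matrix.mulVecLin_apply, Matrix.mulVec, dotProduct, Matrix.of_apply,
          Pi.zero_apply] at this
        refine Eq.trans ?_ this
        exact Finset.sum_congr rfl fun i _ => mul_comm _ _
    set b := a (Fin.last n) with hb
    -- Darboux step: with f = exp(bx) P the value of the last condition on B, the combination f (∂_x
    -- + z)B - f' B is killed by the last condition too. The common exponential is cancelled.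
    refine ⟨P.map C * shiftDeriv B - (DiffCond.twist b P).map C * B, P * τ, mul_ne_zero hP0 hτ,
      (htop.shiftDeriv.map_mul P).sub_lower (htop.map_mul _), fun i x => ?_, fun z => ?_⟩
    · have e : ∀ Q : ℂ[X], (Q.map C).eval (C x) = C (Q.eval x) := fun Q => by
        rw [eval_map, eval₂_hom]
      rw [eval_sub, eval_mul, eval_mul, e, e, map_sub, ← smul_eq_C_mul, ← smul_eq_C_mul, map_smul,
        map_smul, smul_eq_mul, smul_eq_mul]
      have h1 := (c i).hasDerivAt_mom_eval B x
      refine Fin.lastCases (fun h1 => ?_) (fun i h1 => ?_) i h1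
      · rw [funext hP] at h1
        rw [hP, h1.unique (DiffCond.hasDerivAt_exp_mul_eval b P x)]
        ring
      · rw [funext (hker i)] at h1
        rw [hker i x, h1.unique (hasDerivAt_const x 0)]
        ring
    · set D := B.map (evalRingHom z) - C (∏ i : Fin n, (z - a i.castSucc)) * τ with hD
      have hBD : B.map (evalRingHom z) = D + C (∏ i : Fin n, (z - a i.castSucc)) * τ := by
        rw [hD]; ring
      have hBdeg : (B.map (evalRingHom z)).degree ≤ τ.degree := by
        rw [hBD]
        refine (degree_add_le _ _).trans (max_le (hdeg z).le ?_)
        exact (degree_mul_le _ _).trans (by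
          simpa using! add_le_add_left (degree_C_le (a := ∏ i : Fin n, (z - a i.castSucc)))
            τ.degree)
      have e2 : ∀ Q : ℂ[X], (Q.map C).map (evalRingHom z) = Q := fun Q => by
        ext; simp
      -- For x → ∞ derivatives lower the degree, so the step amounts to multiplication by P (z - b),
      -- which extends q by one factor.
      have key : (P.map C * shiftDeriv B - (DiffCond.twist b P).map C * B).map (evalRingHom z) -
          C (∏ i, (z - a i)) * (P * τ) = (C (z - b) * P) * D +
            (P * derivative (B.map (evalRingHom z)) -
              derivative P * B.map (evalRingHom z)) := by
        rw [Polynomial.map_sub, Polynomial.map_mul, Polynomial.map_mul, e2, e2,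
          Fin.prod_univ_castSucc, shiftDeriv, Polynomial.map_add, Polynomial.map_mul, map_C,
          ← derivative_map, DiffCond.twist_apply]
        simp only [coe_evalRingHom, eval_X, ← hb, C_mul, C_sub]
        rw [hBD]
        simp only [derivative_add, derivative_mul, derivative_C]
        ring
      rw [key]
      have h1 : ((C (z - b) * P) * D).degree < (P * τ).degree :=
        degree_mul_lt_mul hP0 ((degree_mul_le _ _).trans (by
          simpa using! add_le_add_left (degree_C_le (a := z - b)) P.degree)) (hdeg z)
      have h2 : (P * derivative (B.map (evalRingHom z))).degree < (P * τ).degree :=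
        degree_mul_lt_mul hP0 le_rfl (degree_derivative_lt_of_le hτ hBdeg)
      have h3 : (derivative P * B.map (evalRingHom z)).degree < (P * τ).degree := by
        rw [mul_comm, mul_comm P]
        exact degree_mul_lt_mul hτ hBdeg (degree_derivative_lt hP0)
      exact (degree_add_le _ _).trans_lt (max_lt h1
        ((degree_sub_le _ _).trans_lt (max_lt h2 h3)))

/-! ### Determinants, the Wronskian and the numerator of the wave function -/

section

/-- Jacobi's formula for the derivative of a determinant. -/
theorem hasDerivAt_det {n : Type*} [Fintype n] [DecidableEq n] {M : ℂ → Matrix n n ℂ}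
    {M' : Matrix n n ℂ} {x : ℂ} (h : ∀ i j, HasDerivAt (fun s => M s i j) (M' i j) x) :
    HasDerivAt (fun s => (M s).det) (∑ j, ((M x).adjugate.mulVec fun i => M' i j) j) x := by
  simp only [← Matrix.cramer_eq_adjugate_mulVec, Matrix.cramer_apply]
  have h1 : HasDerivAt (fun s => (M s).det)
      (∑ σ : Equiv.Perm n, (Equiv.Perm.sign σ : ℂ) *
        ∑ j, (∏ i ∈ Finset.univ.erase j, M x (σ i) i) • M' (σ j) j) x := by
    simp only [Matrix.det_apply']
    exact HasDerivAt.fun_sum fun σ _ =>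
      (HasDerivAt.fun_finsetProd fun j _ => h (σ j) j).const_mul _
  refine h1.congr_deriv ?_
  simp only [Matrix.det_apply', Finset.mul_sum]
  rw [Finset.sum_comm]
  refine Finset.sum_congr rfl fun j _ => Finset.sum_congr rfl fun σ _ => ?_
  rw [← Finset.mul_prod_erase _ _ (Finset.mem_univ j), Matrix.updateCol_self, smul_eq_mul,
    mul_comm (∏ i ∈ _, _)]
  congr 2
  exact Finset.prod_congr rfl fun i hi => by
    rw [Matrix.updateCol_ne (Finset.ne_of_mem_erase hi)]

theorem exists_det_eq_exp_mul_eval {n : Type*} [Fintype n] [DecidableEq n]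
    {M : ℂ → Matrix n n ℂ} {a : n → ℂ}
    (h : ∀ i j, ∃ P : ℂ[X], ∀ x, M x i j = Complex.exp (a i * x) * P.eval x) :
    ∃ P : ℂ[X], ∀ x, (M x).det = Complex.exp ((∑ i, a i) * x) * P.eval x := by
  choose P hP using h
  refine ⟨(Matrix.of P).det, fun x => ?_⟩
  have h1 : M x = Matrix.of fun i j =>
      Complex.exp (a i * x) * ((evalRingHom x).mapMatrix (Matrix.of P)) i j := by
    ext i j; simp [hP]
  rw [h1, Matrix.det_mul_column, ← RingHom.map_det, Finset.sum_mul, Complex.exp_sum]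
  rfl

theorem DiffCond.SupportedAt.exists_mom_eval {c : DiffCond} {a : ℂ} (h : c.SupportedAt a)
    (g : ℂ[X]) : ∃ P : ℂ[X], ∀ x, c.mom x 0 g = Complex.exp (a * x) * P.eval x := by
  obtain ⟨p, rfl⟩ := h.exists_ofPoly
  exact ⟨_, DiffCond.mom_ofPoly a p g⟩

namespace RationalSolution

variable (W : RationalSolution)

/-- The matrix `c_i (z ^ j exp (x z + y z ^ 2))`. -/
def momMatrix (x y : ℂ) : Matrix (Fin W.N) (Fin W.N) ℂ :=
  Matrix.of fun i j => (W.cond i).mom x y (X ^ (j : ℕ))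

/-- The vector `c_i (z ^ k exp (x z + y z ^ 2))`. -/
def momCol (k : ℕ) (x y : ℂ) : Fin W.N → ℂ := fun i => (W.cond i).mom x y (X ^ k)

/-- The Wronskian of the functions `c_i (exp (x z + y z ^ 2))` of `x`. -/
def wr (x y : ℂ) : ℂ := (W.momMatrix x y).det

theorem tau_eq (x y : ℂ) : W.tau (times₂ x y) =
    W.wr x y * ∏ i, Complex.exp (-(x * W.pt i + y * W.pt i ^ 2)) := by
  simp only [tau, phase_times₂]
  congr 2
  ext i j
  simp [momMatrix, DiffCond.mom_apply]

theorem tau_eq_zero_iff (x y : ℂ) : W.tau (times₂ x y) = 0 ↔ W.wr x y = 0 := by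
  rw [tau_eq, mul_eq_zero, or_iff_left]
  exact Finset.prod_ne_zero_iff.mpr fun i _ => Complex.exp_ne_zero _

theorem mom_eq_mulVec (x y : ℂ) {g : ℂ[X]} (hg : g.degree < W.N) (i : Fin W.N) :
    (W.cond i).mom x y g = (W.momMatrix x y).mulVec (fun j => g.coeff j) i := by
  rcases eq_or_ne g 0 with rfl | h0
  · simp [Matrix.mulVec, dotProduct]
  rw [DiffCond.mom_eq_sum _ x y ((natDegree_lt_iff_degree_lt h0).mpr hg), Finset.sum_range]
  exact Finset.sum_congr rfl fun j _ => mul_comm _ _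

theorem eq_zero_of_mom_eq_zero {x y : ℂ} (h : W.wr x y ≠ 0) {g : ℂ[X]} (hg : g.degree < W.N)
    (h0 : ∀ i, (W.cond i).mom x y g = 0) : g = 0 := by
  have h1 : (W.momMatrix x y).mulVec (fun j => g.coeff j) = 0 :=
    funext fun i => by rw [← W.mom_eq_mulVec x y hg, h0]; rfl
  have h2 := Matrix.eq_zero_of_mulVec_eq_zero h h1
  ext k
  by_cases hk : k < W.N
  · exact congrFun h2 ⟨k, hk⟩
  · rw [coeff_zero]
    exact coeff_eq_zero_of_degree_lt (hg.trans_le (by exact_mod_cast not_lt.mp hk))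

/-- `R exp (x z)` is the numerator of the stationary wave function of `W` at `x`. -/
structure IsKernel (x : ℂ) (R : ℂ[X]) : Prop where
  monic : R.Monic
  natDegree_eq : R.natDegree = W.N
  mom_eq_zero : ∀ i, (W.cond i).mom x 0 R = 0

variable {W} in
theorem IsKernel.eq {x : ℂ} {R S : ℂ[X]} (hR : W.IsKernel x R) (hS : W.IsKernel x S)
    (h : W.wr x 0 ≠ 0) : R = S := by
  refine sub_eq_zero.mp (W.eq_zero_of_mom_eq_zero h ?_ fun i => ?_)
  · have h1 := degree_sub_lt_left (p := R) (q := S) (by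
      rw [degree_eq_natDegree hR.monic.ne_zero, degree_eq_natDegree hS.monic.ne_zero,
        hR.natDegree_eq, hS.natDegree_eq]) hR.monic.ne_zero (by
      rw [hR.monic.leadingCoeff, hS.monic.leadingCoeff])
    rwa [degree_eq_natDegree hR.monic.ne_zero, hR.natDegree_eq] at h1
  · rw [map_sub, hR.mom_eq_zero, hS.mom_eq_zero, sub_zero]

/-- The coefficients of the numerator of the wave function, up to the factor `wr` and signs. -/
def numerCoeff (x y : ℂ) : Fin W.N → ℂ :=
  (W.momMatrix x y).adjugate.mulVec (W.momCol W.N x y)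

theorem adjugate_mulVec_momCol (x y : ℂ) (m j : Fin W.N) :
    (W.momMatrix x y).adjugate.mulVec (W.momCol m x y) j = if j = m then W.wr x y else 0 := by
  have h := congrFun (congrFun (W.momMatrix x y).adjugate_mul j) m
  rw [Matrix.smul_apply, Matrix.one_apply, smul_eq_mul, mul_ite, mul_one, mul_zero] at h
  exact h

/-- Differentiating column j turns it into column j + 1, which repeats an existing column except
when j is the last one. -/
theorem hasDerivAt_wr_fst (x y : ℂ) : HasDerivAt (fun x => W.wr x y)
    (∑ j : Fin W.N, if (j : ℕ) + 1 = W.N then W.numerCoeff x y j else 0) x := by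
  have h := hasDerivAt_det (M := fun x => W.momMatrix x y)
    (M' := Matrix.of fun i j => W.momCol (j + 1) x y i) (x := x) fun i j => by
      have := (W.cond i).hasDerivAt_mom_fst x y (X ^ (j : ℕ))
      rwa [← pow_succ'] at this
  refine h.congr_deriv (Finset.sum_congr rfl fun j _ => ?_)
  change (W.momMatrix x y).adjugate.mulVec (W.momCol (j + 1) x y) j = _
  split_ifs with hj
  · rw [hj]; rfl
  · have := W.adjugate_mulVec_momCol x y ⟨j + 1, by omega⟩ j
    rwa [if_neg (by simp [Fin.ext_iff])] at this

theorem hasDerivAt_wr_snd (x y : ℂ) : HasDerivAt (fun y => W.wr x y)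
    (∑ j : Fin W.N, (W.momMatrix x y).adjugate.mulVec (W.momCol (j + 2) x y) j) y := by
  exact hasDerivAt_det (M := fun y => W.momMatrix x y)
    (M' := Matrix.of fun i j => W.momCol (j + 2) x y i) (x := y) fun i j => by
      have := (W.cond i).hasDerivAt_mom_snd x y (X ^ (j : ℕ))
      rwa [← pow_add, add_comm] at this

theorem contDiff_wr : ContDiff ℂ 1 fun p : ℂ × ℂ => W.wr p.1 p.2 := by
  simp only [wr, Matrix.det_apply']
  exact ContDiff.sum fun σ _ => contDiff_const.mul (contDiff_prod fun i _ =>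
    DiffCond.contDiff_mom _ _)

/-- The numerator of the stationary wave function as a polynomial in `x` and `z`. -/
theorem exists_numer : ∃ (B : ℂ[X][X]) (T : ℂ[X]), T ≠ 0 ∧ HasTopCoeff B W.N T ∧
    (∀ x, W.wr x 0 = Complex.exp ((∑ i, W.pt i) * x) * T.eval x) ∧
    (∀ x (k : Fin W.N), W.numerCoeff x 0 k =
      -(Complex.exp ((∑ i, W.pt i) * x) * (B.eval (C x)).coeff k)) ∧
    (∀ i x, (W.cond i).mom x 0 (B.eval (C x)) = 0) ∧
    ∀ z, (B.map (evalRingHom z) - C (W.q z) * T).degree < T.degree := by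
  obtain ⟨B₀, τ, hτ, htop₀, hker₀, hdeg₀⟩ :=
    exists_kernel_family W.N W.pt W.cond W.supported W.linInd
  obtain ⟨T, hT⟩ := exists_det_eq_exp_mul_eval (M := fun x => W.momMatrix x 0) (a := W.pt)
    fun i j => (W.supported i).exists_mom_eval _
  have hβ : ∀ k : Fin W.N, ∃ P : ℂ[X], ∀ x, W.numerCoeff x 0 k =
      Complex.exp ((∑ i, W.pt i) * x) * P.eval x := fun k => by
    have := exists_det_eq_exp_mul_eval (a := W.pt)
      (M := fun x => (W.momMatrix x 0).updateCol k (W.momCol W.N x 0)) fun i j => by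
        by_cases hj : j = k
        · subst hj
          simp only [Matrix.updateCol_self]
          exact (W.supported i).exists_mom_eval _
        · simp only [Matrix.updateCol_ne hj]
          exact (W.supported i).exists_mom_eval _
    simp only [← Matrix.cramer_apply, Matrix.cramer_eq_adjugate_mulVec] at this
    exact this
  choose β hβ using hβ
  have hwr : ∀ x, W.wr x 0 = Complex.exp ((∑ i, W.pt i) * x) * T.eval x := hT
  have hT0 : T ≠ 0 := by
    rintro rfl
    obtain ⟨x₀, hx₀⟩ := exists_eval_ne_zero hτ
    have h1 : (W.momMatrix x₀ 0).det = 0 := by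
      have := hT x₀
      simpa using this
    obtain ⟨v, hv0, hv⟩ := Matrix.exists_vecMul_eq_zero_iff.mpr h1
    refine hv0 (funext (Fintype.linearIndependent_iff.mp W.linInd v ?_))
    refine DiffCond.eq_zero_of_mom_eval_eq_zero htop₀ hx₀ (fun x => ?_) fun j hj => ?_
    · rw [DiffCond.mom_sum]
      exact Finset.sum_eq_zero fun i _ => by rw [hker₀, mul_zero]
    · rw [DiffCond.mom_sum]
      exact congrFun hv ⟨j, hj⟩
  -- Cramer's rule for the monic kernel polynomial, multiplied by the Wronskian and stripped of its
  -- exponential.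
  set B : ℂ[X][X] := T.map C * C (X ^ W.N) - ∑ k : Fin W.N, (β k).map C * C (X ^ (k : ℕ)) with hB
  have htop : HasTopCoeff B W.N T := by
    intro k m hm
    rw [hB, coeff_sub, coeff_mul_C, coeff_map, coeff_sub, coeff_C_mul, coeff_X_pow,
      finsetSum_coeff, finsetSum_coeff, Finset.sum_eq_zero]
    · split_ifs <;> simp
    · intro j _
      have := j.2
      rw [coeff_mul_C, coeff_map, coeff_C_mul, coeff_X_pow, if_neg (by omega), mul_zero]
  have hBe : ∀ x, B.eval (C x) = C (T.eval x) * X ^ W.N -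
      ∑ k : Fin W.N, C ((β k).eval x) * X ^ (k : ℕ) := fun x => by
    have e : ∀ Q : ℂ[X], (Q.map C).eval (C x) = C (Q.eval x) := fun Q => by
      rw [eval_map, eval₂_hom]
    simp only [hB, eval_sub, eval_mul, e, eval_C, eval_finsetSum]
  have hBc : ∀ x (k : Fin W.N), (B.eval (C x)).coeff k = -(β k).eval x := fun x k => by
    rw [hBe, coeff_sub, coeff_C_mul, coeff_X_pow, if_neg (by have := k.2; omega), mul_zero,
      zero_sub,
      finsetSum_coeff, Finset.sum_eq_single k]
    · simp
    · intro j _ hj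
      rw [coeff_C_mul, coeff_X_pow, if_neg (fun h => hj (Fin.ext h.symm)), mul_zero]
    · simp
  have hker : ∀ i x, (W.cond i).mom x 0 (B.eval (C x)) = 0 := by
    intro i x
    have h1 := congrFun ((W.momMatrix x 0).mulVec_cramer (W.momCol W.N x 0)) i
    rw [Matrix.cramer_eq_adjugate_mulVec] at h1
    have h2 : ∑ j, W.momMatrix x 0 i j * W.numerCoeff x 0 j =
      W.wr x 0 * (W.cond i).mom x 0 (X ^ W.N) := h1
    refine (mul_eq_zero.mp (?_ : Complex.exp ((∑ i, W.pt i) * x) * _ = 0)).resolve_left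
      (Complex.exp_ne_zero _)
    rw [hBe, map_sub, map_sum, ← smul_eq_C_mul, map_smul, smul_eq_mul, mul_sub, ← mul_assoc, ← hwr,
      ← h2, Finset.mul_sum, ← Finset.sum_sub_distrib]
    refine Finset.sum_eq_zero fun j _ => ?_
    rw [← smul_eq_C_mul, map_smul, smul_eq_mul, ← mul_assoc, ← hβ, momMatrix, Matrix.of_apply]
    ring
  refine ⟨B, T, hT0, htop, hwr, fun x k => by rw [hBc, hβ]; ring, hker, fun z => ?_⟩
  -- Kernel polynomials are unique up to a factor where the Wronskian does not vanish, so B inherits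
  -- the behaviour at x = ∞ of the Darboux kernel B₀.
  have hprop : τ * B.map (evalRingHom z) = T * B₀.map (evalRingHom z) := by
    refine mul_left_cancel₀ hT0 (Polynomial.funext fun x => ?_)
    by_cases hx : T.eval x = 0
    · simp [hx]
    have h1 : C (τ.eval x) * B.eval (C x) - C (T.eval x) * B₀.eval (C x) = 0 := by
      refine W.eq_zero_of_mom_eq_zero (x := x) (y := 0)
        (by rw [hwr]; exact mul_ne_zero (Complex.exp_ne_zero _) hx) ?_ fun i => ?_
      · rw [degree_lt_iff_coeff_zero]
        intro m hm
        rw [coeff_sub, coeff_C_mul, coeff_C_mul, htop.coeff_eval x hm, htop₀.coeff_eval x hm]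
        split_ifs <;> ring
      · rw [map_sub, ← smul_eq_C_mul, ← smul_eq_C_mul, map_smul, map_smul, hker, hker₀]; simp
    have h2 : ∀ A : ℂ[X][X], (A.map (evalRingHom z)).eval x = (A.eval (C x)).eval z := fun A => by
      have := eval₂_hom (p := A) (evalRingHom z) (C x)
      rw [eval_map]
      simpa using this
    have h3 := congrArg (eval z) h1
    rw [eval_sub, eval_mul, eval_mul, eval_C, eval_C, eval_zero, ← h2, ← h2] at h3
    rw [eval_mul, eval_mul, eval_mul, eval_mul, sub_eq_zero.mp h3]
  by_contra hcon
  have h1 : τ * (B.map (evalRingHom z) - C (W.q z) * T) =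
      T * (B₀.map (evalRingHom z) - C (W.q z) * τ) := by
    rw [mul_sub, hprop]; ring
  have h2 := degree_mul_lt_mul hT0 le_rfl (hdeg₀ z)
  have h3 : (T * (B₀.map (evalRingHom z) - C (W.q z) * τ)).degree < (T * τ).degree := h2
  rw [← h1, mul_comm T, degree_mul, degree_mul] at h3
  exact absurd h3 (not_lt.mpr (add_le_add_right (not_lt.mp hcon) _))

end RationalSolution

end

/-! ### The wave function near a simple root of τ -/

section

theorem HasTopCoeff.derivative {B : ℂ[X][X]} {n : ℕ} {τ : ℂ[X]} (h : HasTopCoeff B n τ) :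
    HasTopCoeff (Polynomial.derivative B) n (Polynomial.derivative τ) := by
  intro k m hm
  have e : ((k : ℂ[X]) + 1) = C ((k : ℂ) + 1) := by simp
  rw [coeff_derivative, e, coeff_mul_C, h _ _ hm, coeff_derivative]
  split_ifs <;> simp

namespace RationalSolution

/-- `B / T` is the numerator of the stationary wave function of `W`, and `T` is `τ`, as a function
of `x`. -/
structure IsNumer (W : RationalSolution) (B : ℂ[X][X]) (T : ℂ[X]) : Prop where
  ne_zero : T ≠ 0
  top : HasTopCoeff B W.N T
  wr_eq : ∀ x, W.wr x 0 = Complex.exp ((∑ i, W.pt i) * x) * T.eval x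
  numerCoeff_eq : ∀ x (k : Fin W.N), W.numerCoeff x 0 k =
    -(Complex.exp ((∑ i, W.pt i) * x) * (B.eval (C x)).coeff k)
  mom_eq_zero : ∀ i x, (W.cond i).mom x 0 (B.eval (C x)) = 0
  degree_lt : ∀ z, (B.map (evalRingHom z) - C (W.q z) * T).degree < T.degree

theorem exists_isNumer (W : RationalSolution) : ∃ B T, W.IsNumer B T := by
  obtain ⟨B, T, h1, h2, h3, h4, h5, h6⟩ := W.exists_numer
  exact ⟨B, T, h1, h2, h3, h4, h5, h6⟩

namespace IsNumer

variable {W : RationalSolution} {B : ℂ[X][X]} {T : ℂ[X]}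

theorem wr_ne_zero_iff (h : W.IsNumer B T) (x : ℂ) : W.wr x 0 ≠ 0 ↔ T.eval x ≠ 0 := by
  rw [h.wr_eq, mul_ne_zero_iff, and_iff_right (Complex.exp_ne_zero _)]

theorem tau_eq (h : W.IsNumer B T) (x : ℂ) : W.tau (times₂ x 0) = T.eval x := by
  rw [RationalSolution.tau_eq, h.wr_eq, ← Complex.exp_sum, mul_right_comm, ← Complex.exp_add,
    Finset.sum_mul, ← Finset.sum_add_distrib, Finset.sum_eq_zero, Complex.exp_zero, one_mul]
  intro i _
  ring

theorem hasDerivAt_wr (h : W.IsNumer B T) (x : ℂ) : HasDerivAt (fun x => W.wr x 0)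
    (Complex.exp ((∑ i, W.pt i) * x) * ((∑ i, W.pt i) * T.eval x + (derivative T).eval x)) x := by
  rw [funext h.wr_eq]
  refine (DiffCond.hasDerivAt_exp_mul_eval _ T x).congr_deriv ?_
  rw [DiffCond.twist_apply, eval_add, eval_mul, eval_C]

/-- The last Cramer coefficient is the x-derivative of the Wronskian, so the coefficient of B at
z^(N-1) is τ'/τ up to sign, normalization and the sum of the λ_i. -/
theorem derivative_eq (h : W.IsNumer B T) (x : ℂ) :
    (∑ i, W.pt i) * T.eval x + (derivative T).eval x =
      -∑ j : Fin W.N, if (j : ℕ) + 1 = W.N then (B.eval (C x)).coeff j else 0 := by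
  have h1 := (h.hasDerivAt_wr x).unique (W.hasDerivAt_wr_fst x 0)
  refine mul_left_cancel₀ (Complex.exp_ne_zero ((∑ i, W.pt i) * x)) (h1.trans ?_)
  rw [mul_neg, Finset.mul_sum, ← Finset.sum_neg_distrib]
  refine Finset.sum_congr rfl fun j _ => ?_
  rw [h.numerCoeff_eq]
  split_ifs <;> simp

theorem isKernel (h : W.IsNumer B T) {x : ℂ} (hx : T.eval x ≠ 0) :
    W.IsKernel x (C (T.eval x)⁻¹ * B.eval (C x)) := by
  have h1 : (B.eval (C x)).natDegree = W.N :=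
    natDegree_eq_of_le_of_coeff_ne_zero (h.top.natDegree_eval_le x)
      (by rw [h.top.coeff_eval x le_rfl, if_pos rfl]; exact hx)
  refine ⟨?_, ?_, fun i => ?_⟩
  · rw [Monic, leadingCoeff_mul, leadingCoeff_C, leadingCoeff, h1, h.top.coeff_eval x le_rfl,
      if_pos rfl, inv_mul_cancel₀ hx]
  · rw [natDegree_C_mul (inv_ne_zero hx), h1]
  · rw [← smul_eq_C_mul, map_smul, h.mom_eq_zero, smul_zero]

theorem nextCoeff (h : W.IsNumer B T) {x : ℂ} (hx : T.eval x ≠ 0) {R : ℂ[X]}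
    (hR : W.IsKernel x R) :
    T.eval x * R.nextCoeff = -((∑ i, W.pt i) * T.eval x + (derivative T).eval x) := by
  rw [hR.eq (h.isKernel hx) ((h.wr_ne_zero_iff x).mpr hx), h.derivative_eq, neg_neg]
  have h1 := (h.isKernel hx).natDegree_eq
  -- For N = 0 there is no coefficient at z^(N-1): `nextCoeff` is 0 by convention and the sum is
  -- empty.
  rcases Nat.eq_zero_or_pos W.N with h0 | h0
  · rw [Polynomial.nextCoeff, if_pos (by omega), mul_zero, Finset.sum_eq_zero]
    exact fun j _ => absurd j.2 (by omega)
  · rw [nextCoeff_of_natDegree_pos (by omega), h1, coeff_C_mul, mul_inv_cancel_left₀ hx,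
      Finset.sum_eq_single ⟨W.N - 1, by omega⟩, if_pos (by simp; omega)]
    · intro j _ hj
      rw [if_neg fun h => hj (Fin.ext (by simp; omega))]
    · simp

/-- At a simple root of `τ`, the second coefficient of the Laurent expansion of the wave function
is a multiple of the residue, and this multiple is related to the velocity of the root. -/
theorem exists_shiftDeriv_eq (h : W.IsNumer B T) {x : ℂ} (hx : T.eval x = 0)
    (hx' : (derivative T).eval x ≠ 0) :
    ∃ κ : ℂ, (shiftDeriv B).eval (C x) = C κ * B.eval (C x) ∧
      Complex.exp ((∑ i, W.pt i) * x) *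
        ((derivative (derivative T)).eval x - 2 * κ * (derivative T).eval x) +
      ∑ j : Fin W.N, (W.momMatrix x 0).adjugate.mulVec (W.momCol (j + 2) x 0) j = 0 := by
  set e := Complex.exp ((∑ i, W.pt i) * x) with he
  have he0 : e ≠ 0 := Complex.exp_ne_zero _
  set T' := (derivative T).eval x with hT'
  have hwr : W.wr x 0 = 0 := by rw [h.wr_eq, hx, mul_zero]
  have hd := h.derivative_eq x
  rw [hx, mul_zero, zero_add] at hd
  obtain ⟨l, hl⟩ : ∃ l : Fin W.N, (l : ℕ) + 1 = W.N := by
    by_contra! hne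
    rw [← hT', Finset.sum_eq_zero (fun j _ => if_neg (hne j)), neg_zero] at hd
    exact hx' hd
  have hlast : ∀ j : Fin W.N, (j : ℕ) + 1 = W.N ↔ j = l := fun j =>
    ⟨fun hj => Fin.ext (by omega), fun hj => by rw [hj, hl]⟩
  set B0 := B.eval (C x) with hB0
  have hB0l : B0.coeff l = -T' := by
    simp only [hlast, Finset.sum_ite_eq', Finset.mem_univ, if_true] at hd
    rw [hT', hd, neg_neg]
  have hB0deg : B0.degree < W.N := by
    rw [degree_lt_iff_coeff_zero]
    intro m hm
    rw [h.top.coeff_eval x hm, hx, ite_self]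
  set g : ℕ → ℂ := fun m => (W.momMatrix x 0).adjugate.mulVec (W.momCol m x 0) l with hg
  have hgN : g W.N = e * T' := by
    have := h.numerCoeff_eq x l
    rw [← hB0, hB0l] at this
    rw [hg]
    change W.numerCoeff x 0 l = _
    rw [this]; ring
  have hadj : ∀ (j : Fin W.N) (m : ℕ), m < W.N →
      (W.momMatrix x 0).adjugate.mulVec (W.momCol m x 0) j = 0 := fun j m hm => by
    have := W.adjugate_mulVec_momCol x 0 ⟨m, hm⟩ j
    rwa [hwr, ite_self] at this
  have hg0 : ∀ m < W.N, g m = 0 := fun m hm => hadj l m hm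
  have hgN0 : g W.N ≠ 0 := by rw [hgN]; exact mul_ne_zero he0 hx'
  have hBd : ∀ m, ((shiftDeriv B).eval (C x)).coeff m =
      ((derivative B).eval (C x)).coeff m + (X * B0).coeff m := fun m => by
    rw [shiftDeriv, eval_add, eval_mul, eval_C, coeff_add]
  have hB1deg : ((shiftDeriv B).eval (C x)).degree < W.N := by
    rw [degree_lt_iff_coeff_zero]
    intro m hm
    rcases hm.lt_or_eq with hm | rfl
    · rw [h.top.shiftDeriv.coeff_eval x hm, hx, ite_self]
    -- At z^N the contribution T'(x) of ∂_x B and the contribution -T'(x) of zB cancel.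
    · rw [hBd, h.top.derivative.coeff_eval x le_rfl, if_pos rfl, ← hl, coeff_X_mul, hB0l, ← hT']
      ring
  have hB1 : ∀ i, (W.cond i).mom x 0 ((shiftDeriv B).eval (C x)) = 0 := fun i => by
    have h1 := (W.cond i).hasDerivAt_mom_eval B x
    rw [funext (h.mom_eq_zero i)] at h1
    exact h1.unique (hasDerivAt_const x 0)
  obtain ⟨κ, hκ⟩ : ∃ κ : ℂ, ((shiftDeriv B).eval (C x)).coeff l = κ * B0.coeff l :=
    ⟨((shiftDeriv B).eval (C x)).coeff l / B0.coeff l, by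
      rw [div_mul_cancel₀]; rw [hB0l]; exact neg_ne_zero.mpr hx'⟩
  have hker : (shiftDeriv B).eval (C x) = C κ * B0 := by
    rw [← sub_eq_zero]
    set D := (shiftDeriv B).eval (C x) - C κ * B0 with hD
    have hDdeg : D.degree < W.N := by
      refine (degree_sub_le _ _).trans_lt (max_lt hB1deg ?_)
      rw [← smul_eq_C_mul]
      exact (degree_smul_le κ B0).trans_lt hB0deg
    have hDl : D.coeff l = 0 := by rw [hD, coeff_sub, coeff_C_mul, hκ, sub_self]
    have hD0 : (W.momMatrix x 0).mulVec (fun j => D.coeff j) = 0 := funext fun i => by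
      rw [← W.mom_eq_mulVec x 0 hDdeg, hD, map_sub, hB1, ← smul_eq_C_mul, map_smul,
        h.mom_eq_zero]
      simp
    -- Replacing the last column makes the matrix invertible. Hence a null vector of `momMatrix` is
    -- determined by its last entry, and κ was chosen to match that entry.
    have hdet : ((W.momMatrix x 0).updateCol l (W.momCol W.N x 0)).det ≠ 0 := by
      rw [← Matrix.cramer_apply, Matrix.cramer_eq_adjugate_mulVec]
      exact hgN0
    have hz := Matrix.eq_zero_of_mulVec_eq_zero hdet (v := fun j : Fin W.N => D.coeff j) (by
      rw [← hD0]
      funext i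
      simp only [Matrix.mulVec, dotProduct]
      refine Finset.sum_congr rfl fun j _ => ?_
      by_cases hj : j = l
      · rw [hj, hDl]; simp
      · rw [Matrix.updateCol_ne hj])
    ext k
    by_cases hk : k < W.N
    · exact congrFun hz ⟨k, hk⟩
    · rw [coeff_zero]
      exact coeff_eq_zero_of_degree_lt (hDdeg.trans_le (by exact_mod_cast not_lt.mp hk))
  refine ⟨κ, hker, ?_⟩
  -- A row of the adjugate of a singular matrix is a left null vector, so this condition kills z^m
  -- exp(xz) for all m < N. Applied to (∂_x + z)²B it leaves only top-degree terms.
  set c : DiffCond := ∑ i, (W.momMatrix x 0).adjugate l i • W.cond i with hc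
  have hcX : ∀ m, c.mom x 0 (X ^ m) = g m := fun m => by
    rw [hc, DiffCond.mom_sum]; rfl
  have hB2 : c.mom x 0 ((shiftDeriv (shiftDeriv B)).eval (C x)) = 0 := by
    rw [hc, DiffCond.mom_sum]
    refine Finset.sum_eq_zero fun i _ => ?_
    have h1 := (W.cond i).hasDerivAt_mom_eval (shiftDeriv B) x
    have h0 : ∀ x, (W.cond i).mom x 0 ((shiftDeriv B).eval (C x)) = 0 := fun x => by
      have h1 := (W.cond i).hasDerivAt_mom_eval B x
      rw [funext (h.mom_eq_zero i)] at h1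
      exact h1.unique (hasDerivAt_const x 0)
    rw [funext h0] at h1
    rw [h1.unique (hasDerivAt_const x 0), mul_zero]
  have hB2e : (shiftDeriv (shiftDeriv B)).eval (C x) =
      (derivative (derivative B)).eval (C x) + ((2 * κ) • (X * B0) - X ^ 2 * B0) := by
    have e1 : (derivative B).eval (C x) = C κ * B0 - X * B0 := by
      rw [← hker, shiftDeriv, eval_add, eval_mul, eval_C]; ring
    rw [shiftDeriv, eval_add, eval_mul, eval_C, hker, shiftDeriv, derivative_add, derivative_mul,
      derivative_C, zero_mul, zero_add, eval_add, eval_mul, eval_C, e1, smul_eq_C_mul, C_mul]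
    simp only [map_ofNat]
    ring
  have hd2 : c.mom x 0 ((derivative (derivative B)).eval (C x)) =
      (derivative (derivative T)).eval x * g W.N := by
    rw [c.mom_eq_sum x 0 (Nat.lt_succ_of_le (h.top.derivative.derivative.natDegree_eval_le x)),
      Finset.sum_range_succ, h.top.derivative.derivative.coeff_eval x le_rfl, if_pos rfl, hcX,
      Finset.sum_eq_zero, zero_add]
    intro m hm
    rw [hcX, hg0 m (Finset.mem_range.mp hm), mul_zero]
  have hmomX : ∀ r, c.mom x 0 (X ^ r * B0) = ∑ j : Fin W.N, B0.coeff j * g (j + r) := fun r => by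
    by_cases h0 : B0 = 0
    · simp [h0]
    · conv_lhs => rw [B0.as_sum_range' W.N ((natDegree_lt_iff_degree_lt h0).mpr hB0deg)]
      rw [Finset.mul_sum, map_sum, Finset.sum_range]
      refine Finset.sum_congr rfl fun j _ => ?_
      rw [← hcX, ← C_mul_X_pow_eq_monomial, mul_left_comm, ← smul_eq_C_mul, map_smul, smul_eq_mul,
        ← pow_add, add_comm]
  have hm1 : c.mom x 0 (X * B0) = -T' * g W.N := by
    have := hmomX 1
    rw [pow_one] at this
    rw [this, Finset.sum_eq_single l, hB0l, hl]
    · intro j _ hj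
      rw [hg0 _ (lt_of_le_of_ne j.2 fun h => hj ((hlast j).mp h)), mul_zero]
    · simp
  -- The sum on the right is ∂wr/∂t₂. Only the last two indices contribute, and there the two
  -- products agree up to order of factors.
  have hm2 : e * c.mom x 0 (X ^ 2 * B0) =
      -(g W.N * ∑ j : Fin W.N, (W.momMatrix x 0).adjugate.mulVec (W.momCol (j + 2) x 0) j) := by
    rw [hmomX, Finset.mul_sum, Finset.mul_sum, ← Finset.sum_neg_distrib]
    refine Finset.sum_congr rfl fun j _ => ?_
    have hnc : e * B0.coeff j = -W.numerCoeff x 0 j := by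
      rw [h.numerCoeff_eq, neg_neg]
    rw [← mul_assoc, hnc]
    have hj := j.2
    by_cases hj1 : (j : ℕ) + 1 = W.N
    · rw [(hlast j).mp hj1]
      change -g W.N * g (l + 2) = -(g W.N * g (l + 2))
      ring
    by_cases hj2 : (j : ℕ) + 2 = W.N
    · rw [hj2]
      change -W.numerCoeff x 0 j * g W.N = -(g W.N * W.numerCoeff x 0 j)
      ring
    · rw [hadj j _ (by omega), hg0 _ (by omega)]; ring
  rw [hB2e, map_add, map_sub, map_smul, hd2, hm1, smul_eq_mul] at hB2
  refine mul_left_cancel₀ hgN0 ?_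
  linear_combination e * hB2 + hm2

end IsNumer
end RationalSolution

end

/-! ### Calogero–Moser matrices and the wave function -/

/-- The resolvent `(x - M)⁻¹`. -/
def resolvent {ι : Type*} [Fintype ι] [DecidableEq ι] (M : Matrix ι ι ℂ) (x : ℂ) : Matrix ι ι ℂ :=
  (Matrix.scalar ι x - M)⁻¹

/-- The diagonal matrix of the positions. -/
def ParticleSystem.posMat (P : ParticleSystem) : Matrix P.particles P.particles ℂ :=
  Matrix.diagonal fun p => p.1.1

/-- The negative of the Moser matrix of a particle system. -/
def ParticleSystem.laxMat (P : ParticleSystem) : Matrix P.particles P.particles ℂ :=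
  Matrix.of fun i j => if i = j then -i.1.2 else -(i.1.1 - j.1.1)⁻¹

theorem ParticleSystem.sub_ne_zero (P : ParticleSystem) {i j : P.particles} (h : i ≠ j) :
    i.1.1 - j.1.1 ≠ 0 :=
  _root_.sub_ne_zero.mpr fun h1 => h (Subtype.ext (P.distinct i.2 j.2 h1))

theorem ParticleSystem.prod_map_positions (P : ParticleSystem) (x : ℂ) :
    (P.positions.map fun r => x - r).prod = ∏ p : P.particles, (x - p.1.1) := by
  rw [ParticleSystem.positions, Multiset.map_map]
  exact (Finset.prod_coe_sort P.particles (fun p => x - p.1)).symm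

theorem ParticleSystem.laxMat_self (P : ParticleSystem) (i : P.particles) :
    P.laxMat i i = -i.1.2 := if_pos rfl

theorem ParticleSystem.laxMat_of_ne (P : ParticleSystem) {i j : P.particles} (h : i ≠ j) :
    P.laxMat i j = -(i.1.1 - j.1.1)⁻¹ := if_neg h

/-- Implicit differentiation along a curve of zeros; it relates the velocity of a root to the
derivatives of the Wronskian. -/
theorem hasDerivAt_zero_of_eventually_zero {F : ℂ × ℂ → ℂ} {Y : ℂ → ℂ} {x y v u : ℂ}
    (hF : DifferentiableAt ℂ F (x, 0)) (hu : HasDerivAt (fun x => F (x, 0)) u x)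
    (hv : HasDerivAt (fun y => F (x, y)) v 0) (h0 : Y 0 = x) (hY : HasDerivAt Y y 0)
    (hz : ∀ᶠ s in 𝓝 (0 : ℂ), F (Y s, s) = 0) : u * y + v = 0 := by
  have hL := hF.hasFDerivAt
  set L := fderiv ℂ F (x, 0)
  have h1 : L (1, 0) = u := by
    have : HasDerivAt (fun x : ℂ => (x, (0 : ℂ))) (1, 0) x :=
      (hasDerivAt_id x).prodMk (hasDerivAt_const x 0)
    exact (hL.comp_hasDerivAt x this).unique hu
  have h2 : L (0, 1) = v := by
    have : HasDerivAt (fun y : ℂ => (x, y)) (0, 1) 0 :=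
      (hasDerivAt_const 0 x).prodMk (hasDerivAt_id 0)
    exact (hL.comp_hasDerivAt (0 : ℂ) this).unique hv
  have h3 : HasDerivAt (fun s => F (Y s, s)) (L (y, 1)) 0 := by
    have : HasDerivAt (fun s : ℂ => (Y s, s)) (y, 1) 0 := hY.prodMk (hasDerivAt_id 0)
    exact hL.comp_hasDerivAt_of_eq (f := fun s : ℂ => (Y s, s)) (0 : ℂ) this (by rw [h0])
  have h4 : HasDerivAt (fun s => F (Y s, s)) 0 0 :=
    (hasDerivAt_const (0 : ℂ) (0 : ℂ)).congr_of_eventuallyEq hz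
  have h5 : L (y, 1) = y * L (1, 0) + L (0, 1) := by
    rw [← smul_eq_mul, ← map_smul, ← map_add]; simp
  rw [← h3.unique h4, h5, h1, h2]; ring

theorem eval_map_evalRingHom (B : ℂ[X][X]) (x z : ℂ) :
    (B.map (evalRingHom z)).eval x = (B.eval (C x)).eval z := by
  have := eval₂_hom (p := B) (evalRingHom z) (C x)
  rw [eval_map]
  simpa using this

namespace RationalSolution

/-- The polynomial `q (z) = ∏ (z - λ_i)`. -/
def qPoly (W : RationalSolution) : ℂ[X] := ∏ i, (X - C (W.pt i))

theorem eval_qPoly (W : RationalSolution) (z : ℂ) : W.qPoly.eval z = W.q z := by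
  simp [qPoly, q, eval_prod]

/-- The polynomial `q - ∑ s_k (x) w_k`, where `s (x)` is the vector of the column sums of
`(x - M)⁻¹`. -/
def cmKernel (W : RationalSolution) {ι : Type*} [Fintype ι] [DecidableEq ι] (M : Matrix ι ι ℂ)
    (w : ι → ℂ[X]) (x : ℂ) : ℂ[X] :=
  W.qPoly - ∑ k, C (Matrix.vecMul 1 (resolvent M x) k) * w k

/-- The stationary wave function of `W` is given by the pair of matrices `M`, `L`:
it is `(1 - ∑_{ij} ((x - M)⁻¹ (z - L)⁻¹)_{ij}) exp (x z)`, with `w = q (z) (z - L)⁻¹ (1, …, 1)`. -/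
structure HasCMForm (W : RationalSolution) {ι : Type*} [Fintype ι] [DecidableEq ι]
    (M L : Matrix ι ι ℂ) (w : ι → ℂ[X]) : Prop where
  lax : ∀ k, X * w k - ∑ j, C (L k j) * w j = W.qPoly
  isKernel : ∀ᶠ x in cofinite, W.IsKernel x (W.cmKernel M w x)

theorem HasPositions.eq_of_isNumer {W : RationalSolution} {M : Multiset ℂ} (hM : W.HasPositions M)
    {B : ℂ[X][X]} {T : ℂ[X]} (h : W.IsNumer B T) :
    ∃ a : ℂ, a ≠ 0 ∧ T = C a * (M.map fun r => X - C r).prod := by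
  obtain ⟨a, ha, hT⟩ := hM
  refine ⟨a, ha, Polynomial.funext fun x => ?_⟩
  rw [← h.tau_eq, hT, eval_mul, eval_C, eval_multiset_prod, Multiset.map_map]
  simp

end RationalSolution

theorem resolvent_diagonal {ι : Type*} [Fintype ι] [DecidableEq ι] (d : ι → ℂ) (x : ℂ)
    (h : ∀ i, x ≠ d i) :
    resolvent (Matrix.diagonal d) x = Matrix.diagonal fun i => (x - d i)⁻¹ := by
  refine Matrix.inv_eq_right_inv ?_
  rw [Matrix.scalar_apply, Matrix.diagonal_sub, Matrix.diagonal_mul_diagonal, ← Matrix.diagonal_one]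
  congr 1
  funext i
  exact mul_inv_cancel₀ (_root_.sub_ne_zero.mpr (h i))

theorem vecMul_resolvent_diagonal {ι : Type*} [Fintype ι] [DecidableEq ι] (d : ι → ℂ) (x : ℂ)
    (h : ∀ i, x ≠ d i) (k : ι) :
    Matrix.vecMul 1 (resolvent (Matrix.diagonal d) x) k = (x - d k)⁻¹ := by
  rw [resolvent_diagonal d x h, Matrix.vecMul_diagonal, Pi.one_apply, one_mul]

namespace RationalSolution

/-- The relation between the velocity of a particle and the wave function. -/
theorem HasParticleSystem.velocity {W : RationalSolution} {P : ParticleSystem}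
    (hP : W.HasParticleSystem P) (p : P.particles) {u : ℂ}
    (hu : HasDerivAt (fun x => W.wr x 0) u p.1.1) :
    u * (2 * p.1.2) + ∑ j : Fin W.N,
      (W.momMatrix p.1.1 0).adjugate.mulVec (W.momCol (j + 2) p.1.1 0) j = 0 := by
  obtain ⟨Y, h0, hY, hz⟩ := hP.2 p.1 p.2
  refine hasDerivAt_zero_of_eventually_zero (F := fun r => W.wr r.1 r.2)
    ((W.contDiff_wr.differentiable one_ne_zero) _) hu (W.hasDerivAt_wr_snd _ 0) h0 hY ?_
  filter_upwards [hz] with s hs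
  exact (W.tau_eq_zero_iff _ _).mp hs

/-- In x, the function B/T tends to q(z) and has simple poles at the positions. At each pole (∂_x +
z)B = κB, with κ expressed by the velocity; inserting the partial fractions turns these relations
into (z - L)w = q·1 for the negatives w of the residues. -/
theorem HasParticleSystem.exists_hasCMForm {W : RationalSolution} {P : ParticleSystem}
    (hP : W.HasParticleSystem P) : ∃ w, W.HasCMForm P.posMat P.laxMat w := by
  obtain ⟨B, T, h⟩ := W.exists_isNumer
  obtain ⟨a, ha, hTm⟩ := hP.1.eq_of_isNumer h
  have hT : T = C a * ∏ p : P.particles, (X - C p.1.1) := by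
    refine Polynomial.funext fun x => ?_
    rw [hTm, eval_mul, eval_mul, eval_multiset_prod, Multiset.map_map, eval_prod]
    simpa [Function.comp_def] using Or.inl (P.prod_map_positions x)
  obtain ⟨S, hS⟩ : ∃ S : P.particles → ℂ[X], ∀ i, S i =
    C a * ∏ p ∈ Finset.univ.erase i, (X - C p.1.1) := ⟨_, fun _ => rfl⟩
  have hTS : ∀ i, T = (X - C i.1.1) * S i := fun i => by
    rw [hT, hS, ← Finset.mul_prod_erase _ _ (Finset.mem_univ i)]; ring
  have hT0 : ∀ i : P.particles, T.eval i.1.1 = 0 := fun i => by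
    rw [hTS i]; simp
  have hT' : ∀ i : P.particles, (derivative T).eval i.1.1 = (S i).eval i.1.1 := fun i => by
    rw [hTS i]; simp
  have hSne : ∀ i : P.particles, (S i).eval i.1.1 ≠ 0 := fun i => by
    rw [hS, eval_mul, eval_C, eval_prod]
    refine mul_ne_zero ha (Finset.prod_ne_zero_iff.mpr fun j hj => ?_)
    rw [eval_sub, eval_X, eval_C]
    exact P.sub_ne_zero (Finset.ne_of_mem_erase hj).symm
  have hS0 : ∀ i j : P.particles, j ≠ i → (S j).eval i.1.1 = 0 := fun i j hij => by
    have := hT0 i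
    rw [hTS j, eval_mul, eval_sub, eval_X, eval_C] at this
    exact (mul_eq_zero.mp this).resolve_left (P.sub_ne_zero hij.symm)
  have hSd : ∀ i j : P.particles, j ≠ i → (derivative (S j)).eval i.1.1 =
      (derivative T).eval i.1.1 * (i.1.1 - j.1.1)⁻¹ := fun i j hij => by
    rw [hTS j]
    simp only [derivative_mul, derivative_sub, derivative_X, derivative_C, sub_zero, one_mul,
      eval_add, eval_mul, eval_sub, eval_X, eval_C, hS0 i j hij]
    rw [zero_add, mul_right_comm, mul_inv_cancel₀ (P.sub_ne_zero hij.symm), one_mul]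
  have hSdd : ∀ i : P.particles, (derivative (derivative T)).eval i.1.1 =
      2 * (derivative (S i)).eval i.1.1 := fun i => by
    rw [hTS i]; simp; ring
  have hTne : ∀ x, (∀ i : P.particles, x ≠ i.1.1) → T.eval x ≠ 0 := fun x hx => by
    rw [hT, eval_mul, eval_C, eval_prod]
    refine mul_ne_zero ha (Finset.prod_ne_zero_iff.mpr fun j _ => ?_)
    rw [eval_sub, eval_X, eval_C]
    exact _root_.sub_ne_zero.mpr (hx j)
  have hTdeg : T.degree = (Finset.univ : Finset P.particles).card := by
    rw [hT, degree_C_mul ha, degree_prod, Finset.sum_congr rfl fun i _ => degree_X_sub_C _]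
    simp
  -- The residue of B/T at x_i, since S_i(x_i) = T'(x_i).
  obtain ⟨A, hA⟩ : ∃ A : P.particles → ℂ[X], ∀ i, A i =
    C ((S i).eval i.1.1)⁻¹ * B.eval (C i.1.1) := ⟨_, fun _ => rfl⟩
  have hAe : ∀ i z, (B.map (evalRingHom z)).eval i.1.1 = (S i).eval i.1.1 * (A i).eval z := by
    intro i z
    rw [eval_map_evalRingHom, hA, eval_mul, eval_C, mul_inv_cancel_left₀ (hSne i)]
  -- Lagrange interpolation: B - qT has smaller degree in x than T, so its values at the distinct
  -- roots of T determine it.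
  have hB : ∀ z, B.map (evalRingHom z) = C (W.q z) * T + ∑ i, C ((A i).eval z) * S i := by
    intro z
    rw [← sub_eq_iff_eq_add']
    refine eq_of_degrees_lt_of_eval_index_eq (s := Finset.univ)
      (v := fun i : P.particles => i.1.1) ?_ ?_ ?_ fun i _ => ?_
    · exact fun i _ j _ hij => Subtype.ext (P.distinct i.2 j.2 hij)
    · exact hTdeg ▸ h.degree_lt z
    · refine (degree_sum_le _ _).trans_lt ?_
      rw [Finset.sup_lt_iff (by exact_mod_cast WithBot.bot_lt_coe _)]
      intro i _
      rw [← hTdeg, ← smul_eq_C_mul]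
      refine (degree_smul_le _ _).trans_lt ?_
      rw [hTS i, degree_mul, degree_X_sub_C, degree_eq_natDegree (p := S i)]
      · norm_cast; omega
      · intro h0; exact hSne i (by rw [h0, eval_zero])
    · rw [eval_sub, eval_mul, hT0, mul_zero, sub_zero, hAe, eval_finsetSum, Finset.sum_eq_single i]
      · rw [eval_mul, eval_C, mul_comm]
      · intro j _ hj
        rw [eval_mul, hS0 i j hj, mul_zero]
      · simp
  refine ⟨fun i => -A i, fun i => Polynomial.funext fun z => ?_, ?_⟩
  · obtain ⟨κ, h1, h2⟩ := h.exists_shiftDeriv_eq (hT0 i) (by rw [hT']; exact hSne i)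
    have h3 := hP.velocity i (h.hasDerivAt_wr i.1.1)
    rw [hT0, mul_zero, zero_add] at h3
    -- Eliminating ∂wr/∂t₂ gives κ = T''/(2T') - y_i. The T'' term cancels against the derivative of
    -- S_i, and y_i becomes the diagonal entry of L.
    have hκ : (derivative (derivative T)).eval i.1.1 - 2 * κ * (derivative T).eval i.1.1 -
        2 * i.1.2 * (derivative T).eval i.1.1 = 0 := by
      refine mul_left_cancel₀ (Complex.exp_ne_zero ((∑ i, W.pt i) * i.1.1)) ?_
      linear_combination h2 - h3
    rw [hSdd, hT'] at hκ
    have h4 : (derivative (B.map (evalRingHom z))).eval i.1.1 +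
        z * (B.map (evalRingHom z)).eval i.1.1 = κ * (B.map (evalRingHom z)).eval i.1.1 := by
      have := congrArg (eval z) h1
      rw [shiftDeriv, eval_add, eval_mul, eval_C, eval_add, eval_mul, eval_mul, eval_X, eval_C,
        ← eval_map_evalRingHom, ← eval_map_evalRingHom, ← derivative_map] at this
      exact this
    have h5 : (derivative (B.map (evalRingHom z))).eval i.1.1 = W.q z * (S i).eval i.1.1 +
        ((A i).eval z * (derivative (S i)).eval i.1.1 + ∑ j ∈ Finset.univ.erase i,
          (A j).eval z * ((S i).eval i.1.1 * (i.1.1 - j.1.1)⁻¹)) := by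
      rw [hB z, derivative_add, derivative_C_mul, eval_add, eval_mul, eval_C, hT', derivative_sum,
        eval_finsetSum, ← Finset.add_sum_erase _ _ (Finset.mem_univ i)]
      congr 2
      · rw [derivative_C_mul, eval_mul, eval_C]
      · refine Finset.sum_congr rfl fun j hj => ?_
        rw [derivative_C_mul, eval_mul, eval_C, hSd i j (Finset.ne_of_mem_erase hj), hT']
    rw [h5, hAe] at h4
    rw [eval_qPoly, eval_sub, eval_mul, eval_X, eval_neg, eval_finsetSum,
      ← Finset.add_sum_erase _ _ (Finset.mem_univ i)]
    have h6 : ∑ j ∈ Finset.univ.erase i, eval z (C (P.laxMat i j) * -A j) =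
        ∑ j ∈ Finset.univ.erase i, (A j).eval z * (i.1.1 - j.1.1)⁻¹ := by
      refine Finset.sum_congr rfl fun j hj => ?_
      rw [eval_mul, eval_C, eval_neg, P.laxMat_of_ne (Finset.ne_of_mem_erase hj).symm]
      ring
    have h7 : ∑ j ∈ Finset.univ.erase i, (A j).eval z * ((S i).eval i.1.1 * (i.1.1 - j.1.1)⁻¹) =
        (S i).eval i.1.1 * ∑ j ∈ Finset.univ.erase i, (A j).eval z * (i.1.1 - j.1.1)⁻¹ := by
      rw [Finset.mul_sum]
      exact Finset.sum_congr rfl fun j _ => by ring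
    rw [h7] at h4
    rw [h6, eval_mul, eval_C, eval_neg, P.laxMat_self]
    refine mul_left_cancel₀ (hSne i) ?_
    linear_combination -h4 + (A i).eval z / 2 * hκ
  · have hcof : ∀ᶠ x in cofinite, ∀ i : P.particles, x ≠ i.1.1 :=
      eventually_all.mpr fun i => by simp [eventually_cofinite]
    filter_upwards [hcof] with x hx
    convert h.isKernel (hTne x hx) using 1
    refine Polynomial.funext fun z => ?_
    rw [eval_mul, eval_C, ← eval_map_evalRingHom, hB z, eval_add, eval_mul, eval_C, cmKernel,
      eval_sub, eval_qPoly, eval_finsetSum, eval_finsetSum, mul_add, mul_left_comm,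
      inv_mul_cancel₀ (hTne x hx), mul_one, sub_eq_add_neg, ← Finset.sum_neg_distrib,
      Finset.mul_sum]
    congr 1
    refine Finset.sum_congr rfl fun i _ => ?_
    rw [ParticleSystem.posMat, vecMul_resolvent_diagonal _ _ hx, eval_mul, eval_C, eval_neg,
      eval_mul, eval_C, hTS i, eval_mul, eval_sub, eval_X, eval_C]
    have h1 : (S i).eval x ≠ 0 := fun h0 => hTne x hx (by rw [hTS i, eval_mul, h0, mul_zero])
    have h2 : x - i.1.1 ≠ 0 := _root_.sub_ne_zero.mpr (hx i)
    field_simp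

end RationalSolution

/-! ### Calogero–Moser pairs under the KP flow -/

section

variable {ι : Type*} [Fintype ι] [DecidableEq ι]

/-- The relation `[M, L] = 1 - (matrix of ones)`. -/
def IsCMPair (M L : Matrix ι ι ℂ) : Prop := M * L - L * M = 1 - Matrix.of fun _ _ => 1

theorem eventually_det_ne_zero (M : Matrix ι ι ℂ) :
    ∀ᶠ x in cofinite, (Matrix.scalar ι x - M).det ≠ 0 := by
  have h : {x | ¬ (Matrix.scalar ι x - M).det ≠ 0} = {x | M.charpoly.IsRoot x} := by
    ext x
    simp [Polynomial.IsRoot, Matrix.eval_charpoly]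
  rw [eventually_cofinite, h]
  exact finite_setOfPred_isRoot M.charpoly_monic.ne_zero

theorem resolvent_mul {M : Matrix ι ι ℂ} {x : ℂ} (h : (Matrix.scalar ι x - M).det ≠ 0) :
    resolvent M x * (Matrix.scalar ι x - M) = 1 :=
  Matrix.nonsing_inv_mul _ (isUnit_iff_ne_zero.mpr h)

theorem mul_resolvent {M : Matrix ι ι ℂ} {x : ℂ} (h : (Matrix.scalar ι x - M).det ≠ 0) :
    (Matrix.scalar ι x - M) * resolvent M x = 1 :=
  Matrix.mul_nonsing_inv _ (isUnit_iff_ne_zero.mpr h)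

namespace RationalSolution

theorem qPoly_monic (W : RationalSolution) : W.qPoly.Monic := monic_prod_X_sub_C _ _

theorem natDegree_qPoly (W : RationalSolution) : W.qPoly.natDegree = W.N := by
  rw [qPoly, natDegree_prod_of_monic _ _ fun i _ => monic_X_sub_C _]
  simp

/-- In an equation whose w_k has maximal degree, z w_k dominates the sum, so deg w_k + 1 = deg q. -/
theorem degree_lt_of_lax {κ : Type*} [Fintype κ] {W : RationalSolution} {L : Matrix κ κ ℂ}
    {w : κ → ℂ[X]}
    (h : ∀ k, X * w k - ∑ j, C (L k j) * w j = W.qPoly) (k : κ) : (w k).degree < W.N := by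
  obtain ⟨m, -, hm⟩ := Finset.exists_max_image Finset.univ (fun k => (w k).degree)
    ⟨k, Finset.mem_univ k⟩
  refine (hm k (Finset.mem_univ k)).trans_lt ?_
  by_contra hN
  rw [not_lt] at hN
  have h0 : w m ≠ 0 := by
    intro h0
    rw [h0, degree_zero, le_bot_iff] at hN
    exact absurd hN (WithBot.coe_ne_bot)
  have h1 : (∑ j, C (L m j) * w j).degree < (X * w m).degree := by
    rw [degree_mul, degree_X]
    refine (degree_sum_le _ _).trans_lt ((Finset.sup_lt_iff ?_).mpr fun j _ => ?_)
    · rw [degree_eq_natDegree h0, bot_lt_iff_ne_bot]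
      exact WithBot.coe_ne_bot
    · rw [← smul_eq_C_mul]
      refine ((degree_smul_le _ _).trans (hm j (Finset.mem_univ j))).trans_lt ?_
      rw [degree_eq_natDegree h0]
      norm_cast
      omega
  have h2 := degree_sub_eq_left_of_degree_lt h1
  rw [h m, degree_eq_natDegree W.qPoly_monic.ne_zero, natDegree_qPoly, degree_mul, degree_X,
    degree_eq_natDegree h0] at h2
  rw [degree_eq_natDegree h0] at hN
  norm_cast at h2 hN
  omega

theorem cmKernel_monic {W : RationalSolution} {L : Matrix ι ι ℂ} {w : ι → ℂ[X]}
    (h : ∀ k, X * w k - ∑ j, C (L k j) * w j = W.qPoly) (M : Matrix ι ι ℂ) (x : ℂ) :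
    (W.cmKernel M w x).Monic ∧ (W.cmKernel M w x).natDegree = W.N := by
  have h1 : (∑ k, C (Matrix.vecMul 1 (resolvent M x) k) * w k).degree < W.qPoly.degree := by
    rw [degree_eq_natDegree W.qPoly_monic.ne_zero, natDegree_qPoly]
    refine (degree_sum_le _ _).trans_lt ((Finset.sup_lt_iff ?_).mpr fun j _ => ?_)
    · rw [bot_lt_iff_ne_bot]
      exact WithBot.coe_ne_bot
    · rw [← smul_eq_C_mul]
      exact (degree_smul_le _ _).trans_lt (degree_lt_of_lax h j)
  refine ⟨W.qPoly_monic.sub_of_left h1, ?_⟩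
  exact (natDegree_eq_of_degree_eq (degree_sub_eq_left_of_degree_lt h1)).trans W.natDegree_qPoly

/-- With c the condition, the vector h_k(x) = c(w_k exp(xz))/(x - d_k) satisfies h' = Lh, and c(q
exp(xz)) is the sum of its entries. A polynomial factor g therefore acts through g(L), and moving it
past x - M produces the correction g'(L). -/
theorem mom_flow {W : RationalSolution} {d : ι → ℂ} {L : Matrix ι ι ℂ} {w : ι → ℂ[X]}
    (hcm : IsCMPair (Matrix.diagonal d) L)
    (hW : W.HasCMForm (Matrix.diagonal d) L w) (i : Fin W.N) :
    ∀ᶠ x in cofinite, ∃ h : ι → ℂ, ∀ g : ℂ[X],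
      (∀ k, (W.cond i).mom x 0 (g * w k) = (x - d k) * (aeval L g).mulVec h k +
        (aeval L (derivative g)).mulVec h k) ∧
      (W.cond i).mom x 0 (g * W.qPoly) = ∑ k, (aeval L g).mulVec h k := by
  set c := W.cond i with hc
  have hcof : ∀ᶠ x in cofinite, ∀ k, x ≠ d k :=
    eventually_all.mpr fun i => by simp [eventually_cofinite]
  set U : Set ℂ := {x | W.IsKernel x (W.cmKernel (Matrix.diagonal d) w x) ∧ ∀ k, x ≠ d k} with hU
  have hUc : U ∈ cofinite := hW.isKernel.and hcof
  -- Cofinite sets are open, so identities that hold on U may be differentiated there.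
  have hUo : ∀ x ∈ U, ∀ᶠ y in 𝓝 x, y ∈ U := fun x hx => by
    have : IsOpen U := by
      rw [← isClosed_compl_iff]
      exact (mem_cofinite.mp hUc).isClosed
    exact this.mem_nhds hx
  have hcomm : ∀ k j, (d k - d j) * L k j = (if k = j then 1 else 0) - 1 := fun k j => by
    have := congrFun (congrFun hcm k) j
    rw [Matrix.sub_apply, Matrix.diagonal_mul, Matrix.mul_diagonal, Matrix.sub_apply,
      Matrix.one_apply, Matrix.of_apply] at this
    rw [← this]; ring
  set h : ℂ → ι → ℂ := fun x k => (x - d k)⁻¹ * c.mom x 0 (w k) with hh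
  have hw : ∀ x ∈ U, ∀ k, c.mom x 0 (w k) = (x - d k) * h x k := fun x hx k => by
    rw [hh, mul_inv_cancel_left₀ (sub_ne_zero.mpr (hx.2 k))]
  have hq : ∀ x ∈ U, c.mom x 0 W.qPoly = ∑ k, h x k := fun x hx => by
    have := hx.1.mom_eq_zero i
    rw [cmKernel, map_sub, map_sum, sub_eq_zero] at this
    rw [hc, this]
    refine Finset.sum_congr rfl fun k _ => ?_
    rw [vecMul_resolvent_diagonal d x hx.2, ← smul_eq_C_mul, map_smul, smul_eq_mul]
  have hlax : ∀ (g : ℂ[X]) x k, c.mom x 0 (X * g * w k) =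
      ∑ j, L k j * c.mom x 0 (g * w j) + c.mom x 0 (g * W.qPoly) := fun g x k => by
    have e : X * g * w k = g * W.qPoly + ∑ j, L k j • (g * w j) := by
      rw [← hW.lax k, mul_sub, Finset.mul_sum]
      have : ∑ j, g * (C (L k j) * w j) = ∑ j, L k j • (g * w j) :=
        Finset.sum_congr rfl fun j _ => by rw [smul_eq_C_mul]; ring
      rw [this]; ring
    rw [e, map_add, map_sum, add_comm]
    simp only [map_smul, smul_eq_mul]
  -- The commutation relation in the form L(x - M) + J = (x - M)L + 1, with J the matrix of ones.
  have hstep : ∀ (x : ℂ) (u v : ι → ℂ) (k : ι),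
      ∑ j, L k j * ((x - d j) * u j + v j) + ∑ j, u j =
        (x - d k) * L.mulVec u k + u k + L.mulVec v k := fun x u v k => by
    have e : ∀ j, L k j * ((x - d j) * u j + v j) + u j =
        (x - d k) * (L k j * u j) + (if k = j then u j else 0) + L k j * v j := fun j => by
      have := hcomm k j
      split_ifs at this ⊢
      · linear_combination u j * this
      · linear_combination u j * this
    rw [← Finset.sum_add_distrib, Finset.sum_congr rfl fun j _ => e j, Finset.sum_add_distrib,
      Finset.sum_add_distrib, ← Finset.mul_sum, Finset.sum_ite_eq, if_pos (Finset.mem_univ k)]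
    rfl
  have hder : ∀ x ∈ U, ∀ k, HasDerivAt (fun x => h x k) (L.mulVec (h x) k) x := fun x hx k => by
    have hne := sub_ne_zero.mpr (hx.2 k)
    have h1 := (((hasDerivAt_id x).sub_const (d k)).inv hne).mul (c.hasDerivAt_mom_fst x 0 (w k))
    refine h1.congr_deriv ?_
    have h2 := hlax 1 x k
    simp only [one_mul, mul_one] at h2
    rw [hq x hx, Finset.sum_congr rfl fun j _ => by rw [hw x hx j]] at h2
    have h3 := hstep x (h x) 0 k
    simp only [Pi.zero_apply, add_zero, Matrix.mulVec_zero] at h3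
    rw [h2, h3, hw x hx]
    simp only [id]
    change -1 / (x - d k) ^ 2 * _ + (x - d k)⁻¹ * _ = _
    field_simp
    ring
  have hderv : ∀ x ∈ U, ∀ (N : Matrix ι ι ℂ) k,
      HasDerivAt (fun x => N.mulVec (h x) k) ((N * L).mulVec (h x) k) x := fun x hx N k => by
    rw [← Matrix.mulVec_mulVec]
    exact HasDerivAt.fun_sum fun j _ => (hder x hx j).const_mul (N k j)
  have hqn : ∀ n : ℕ, ∀ x ∈ U, c.mom x 0 (X ^ n * W.qPoly) = ∑ k, (L ^ n).mulVec (h x) k := by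
    intro n
    induction n with
    | zero => intro x hx; simpa using hq x hx
    | succ n ih =>
      intro x hx
      have h1 := c.hasDerivAt_mom_fst x 0 (X ^ n * W.qPoly)
      have h2 : HasDerivAt (fun x => ∑ k, (L ^ n).mulVec (h x) k)
          (∑ k, (L ^ n * L).mulVec (h x) k) x := HasDerivAt.fun_sum fun k _ => hderv x hx _ k
      have h3 := h2.congr_of_eventuallyEq ((hUo x hx).mono fun y hy => ih y hy)
      rw [pow_succ', mul_assoc, h1.unique h3, pow_succ]
  have hqg : ∀ (g : ℂ[X]), ∀ x ∈ U, c.mom x 0 (g * W.qPoly) = ∑ k, (aeval L g).mulVec (h x) k := by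
    intro g x hx
    induction g using Polynomial.induction_on' with
    | add f g hf hg =>
      rw [add_mul, map_add, hf, hg, map_add, ← Finset.sum_add_distrib]
      simp only [Matrix.add_mulVec, Pi.add_apply]
    | monomial n a =>
      rw [← C_mul_X_pow_eq_monomial, ← smul_eq_C_mul, smul_mul_assoc, map_smul, hqn n x hx,
        map_smul,
        map_pow, aeval_X, smul_eq_mul, Finset.mul_sum]
      simp only [Matrix.smul_mulVec, Pi.smul_apply, smul_eq_mul]
  have hwn : ∀ n : ℕ, ∀ x ∈ U, ∀ k, c.mom x 0 (X ^ n * w k) =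
      (x - d k) * (aeval L (X ^ n : ℂ[X])).mulVec (h x) k +
        (aeval L (derivative (X ^ n : ℂ[X]))).mulVec (h x) k := by
    intro n x hx
    induction n with
    | zero => intro k; simpa using hw x hx k
    | succ n ih =>
      intro k
      rw [pow_succ', hlax, Finset.sum_congr rfl fun j _ => by rw [ih j], hqg _ x hx, hstep,
        derivative_mul, derivative_X, one_mul, map_add, map_mul, map_mul, aeval_X,
        Matrix.add_mulVec, Pi.add_apply, Matrix.mulVec_mulVec, Matrix.mulVec_mulVec, add_assoc]
  filter_upwards [hUc] with x hx
  refine ⟨h x, fun g => ⟨fun k => ?_, hqg g x hx⟩⟩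
  induction g using Polynomial.induction_on' with
  | add f g hf hg =>
    rw [add_mul, map_add, hf, hg, map_add, map_add, map_add]
    simp only [Matrix.add_mulVec, Pi.add_apply]
    ring
  | monomial n a =>
    rw [← C_mul_X_pow_eq_monomial, ← smul_eq_C_mul, smul_mul_assoc, map_smul, hwn n x hx,
      derivative_smul, map_smul, map_smul]
    simp only [Matrix.smul_mulVec, Pi.smul_apply, smul_eq_mul]
    ring

/-- Under the KP flow `M` moves linearly in the times, while `L` is fixed. -/
theorem HasCMForm.flow {W : RationalSolution} {d : ι → ℂ} {L : Matrix ι ι ℂ} {w : ι → ℂ[X]}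
    (hcm : IsCMPair (Matrix.diagonal d) L)
    (hW : W.HasCMForm (Matrix.diagonal d) L w) (t : Times) :
    (W.flow t).HasCMForm (Matrix.diagonal d - aeval L (derivative (phasePoly t))) L w := by
  obtain ⟨G, hG, hdvd⟩ := exists_polynomial_flow t W.cond L.charpoly_monic.ne_zero
  -- By Cayley–Hamilton, the congruence modulo the characteristic polynomial of L becomes an
  -- equality: G(L) plays the part of exp ξ(L).
  have hGL : aeval L (derivative G) = aeval L (derivative (phasePoly t)) * aeval L G := by
    obtain ⟨r, hr⟩ := hdvd
    have := congrArg (aeval L) hr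
    rw [map_sub, map_mul, map_mul, Matrix.aeval_self_charpoly, zero_mul, sub_eq_zero] at this
    exact this
  refine ⟨hW.lax, ?_⟩
  set M' := Matrix.diagonal d - aeval L (derivative (phasePoly t)) with hM'
  have hmom := eventually_all.mpr fun i => mom_flow hcm hW i
  filter_upwards [hmom, eventually_det_ne_zero M'] with x hx hdet
  obtain ⟨hmon, hdeg⟩ := cmKernel_monic (W := W.flow t) hW.lax M' x
  refine ⟨hmon, hdeg, fun i => ?_⟩
  obtain ⟨h, hh⟩ := hx i
  obtain ⟨h1, h2⟩ := hh G
  set v := (aeval L G).mulVec h with hv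
  change (flowCond t (W.cond i)).mom x 0 _ = 0
  -- The correction G'(L)h = ξ'(L)v is absorbed into M' = M - ξ'(L).
  have h3 : ∀ k, (W.cond i).mom x 0 (G * w k) = (Matrix.scalar ι x - M').mulVec v k := fun k => by
    rw [h1 k, hGL, ← Matrix.mulVec_mulVec, ← hv, hM', Matrix.sub_mulVec, Matrix.sub_mulVec,
      Matrix.scalar_apply, Pi.sub_apply, Pi.sub_apply, Matrix.mulVec_diagonal,
      Matrix.mulVec_diagonal]
    ring
  refine (hG (i : Fin W.N) x _).trans ?_
  change (W.cond i).mom x 0 (G * W.cmKernel M' w x) = 0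
  rw [cmKernel, mul_sub, map_sub, Finset.mul_sum, map_sum]
  have h4 : ∑ k, (W.cond i).mom x 0 (G * (C (Matrix.vecMul 1 (resolvent M' x) k) * w k)) =
      dotProduct (Matrix.vecMul 1 (resolvent M' x)) ((Matrix.scalar ι x - M').mulVec v) := by
    refine Finset.sum_congr rfl fun k _ => ?_
    rw [← h3, mul_left_comm, ← smul_eq_C_mul, map_smul, smul_eq_mul]
  rw [h4, h2, Matrix.dotProduct_mulVec, Matrix.vecMul_vecMul, resolvent_mul hdet, Matrix.vecMul_one,
    sub_eq_zero]
  simp [dotProduct]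

end RationalSolution

end

/-! ### Resolvents and expansions at infinity -/

section

section matrices

variable {ι : Type*} [Fintype ι] [DecidableEq ι] {M L : Matrix ι ι ℂ}

theorem eval_charpoly (M : Matrix ι ι ℂ) (x : ℂ) :
    M.charpoly.eval x = (Matrix.scalar ι x - M).det := Matrix.eval_charpoly M x

theorem IsCMPair.transpose (h : IsCMPair M L) : IsCMPair L.transpose M.transpose := by
  have := congrArg Matrix.transpose h
  rw [Matrix.transpose_sub, Matrix.transpose_mul, Matrix.transpose_mul, Matrix.transpose_sub,
    Matrix.transpose_one] at this
  exact this

theorem trace_mul_ones {κ : Type*} [Fintype κ] (G : Matrix κ κ ℂ) :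
    (G * Matrix.of fun _ _ => 1).trace = dotProduct 1 (G.mulVec 1) := by
  simp [Matrix.trace, Matrix.mul_apply, dotProduct, Matrix.mulVec]

/-- The sum of the entries of a matrix that commutes with `M` is its trace. -/
theorem IsCMPair.dotProduct_mulVec_of_commute (h : IsCMPair M L) {G : Matrix ι ι ℂ}
    (hG : Commute G M) : dotProduct 1 (G.mulVec 1) = G.trace := by
  have h1 : (G * (M * L - L * M)).trace = 0 := by
    rw [mul_sub, Matrix.trace_sub, ← mul_assoc, ← mul_assoc, hG.eq, mul_assoc,
      Matrix.trace_mul_comm M, sub_self]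
  rw [h, mul_sub, mul_one, Matrix.trace_sub, trace_mul_ones, sub_eq_zero] at h1
  exact h1.symm

theorem commute_resolvent {x : ℂ} (h : (Matrix.scalar ι x - M).det ≠ 0) :
    Commute (resolvent M x) M := by
  have h1 : Commute (resolvent M x) (Matrix.scalar ι x - M) :=
    (resolvent_mul h).trans (mul_resolvent h).symm
  have h2 : Commute (resolvent M x) (Matrix.scalar ι x) :=
    (Matrix.scalar_commute x (fun _ => Commute.all _ _) _).symm
  have := h2.sub_right h1
  rwa [sub_sub_cancel] at this

theorem trace_adjugate (M : Matrix ι ι ℂ) (x : ℂ) :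
    (Matrix.scalar ι x - M).adjugate.trace = (derivative M.charpoly).eval x := by
  have h1 : HasDerivAt (fun s => (Matrix.scalar ι s - M).det)
      (∑ j, ((Matrix.scalar ι x - M).adjugate.mulVec fun i => (1 : Matrix ι ι ℂ) i j) j) x := by
    refine hasDerivAt_det fun i j => ?_
    simp only [Matrix.sub_apply, Matrix.scalar_apply, Matrix.diagonal_apply, Matrix.one_apply]
    split_ifs
    · exact (hasDerivAt_id x).sub_const _
    · exact hasDerivAt_const x _
  have h2 := M.charpoly.hasDerivAt x
  rw [show (fun s => M.charpoly.eval s) = fun s => (Matrix.scalar ι s - M).det from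
    funext fun s => eval_charpoly M s] at h2
  rw [← h1.unique h2, Matrix.trace]
  refine Finset.sum_congr rfl fun j _ => ?_
  simp [Matrix.mulVec, dotProduct, Matrix.one_apply]

theorem charpoly_mul_resolvent {x : ℂ} (h : (Matrix.scalar ι x - M).det ≠ 0) :
    M.charpoly.eval x • resolvent M x = (Matrix.scalar ι x - M).adjugate := by
  rw [eval_charpoly, resolvent, Matrix.inv_def, Ring.inverse_eq_inv', smul_smul,
    mul_inv_cancel₀ h, one_smul]

theorem trace_resolvent {x : ℂ} (h : (Matrix.scalar ι x - M).det ≠ 0) :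
    M.charpoly.eval x * (resolvent M x).trace = (derivative M.charpoly).eval x := by
  rw [← trace_adjugate, ← charpoly_mul_resolvent h, Matrix.trace_smul, smul_eq_mul]

theorem resolvent_transpose (M : Matrix ι ι ℂ) (x : ℂ) :
    resolvent M.transpose x = (resolvent M x).transpose := by
  rw [resolvent, resolvent, Matrix.transpose_nonsing_inv, Matrix.transpose_sub,
    Matrix.scalar_apply, Matrix.diagonal_transpose]

/-- The function `∑_{ij} ((x - M)⁻¹ (z - L)⁻¹)_{ij}`. -/
def cmFun (M L : Matrix ι ι ℂ) (x z : ℂ) : ℂ :=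
  dotProduct 1 ((resolvent M x * resolvent L z).mulVec 1)

theorem dotProduct_one_transpose {κ : Type*} [Fintype κ] (G : Matrix κ κ ℂ) :
    dotProduct 1 (G.transpose.mulVec 1) = dotProduct 1 (G.mulVec 1) := by
  rw [Matrix.mulVec_transpose, dotProduct_comm, Matrix.dotProduct_mulVec]

theorem cmFun_transpose (M L : Matrix ι ι ℂ) (x z : ℂ) :
    cmFun L.transpose M.transpose z x = cmFun M L x z := by
  rw [cmFun, cmFun, resolvent_transpose, resolvent_transpose, ← Matrix.transpose_mul,
    dotProduct_one_transpose]

/-- With s = 1/z this is continuity of (1 - sM)⁻¹ at s = 0. -/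
theorem tendsto_smul_resolvent (M : Matrix ι ι ℂ) :
    Tendsto (fun z => z • resolvent M z) (Bornology.cobounded ℂ) (𝓝 1) := by
  have h1 : ContinuousAt (fun s : ℂ => (1 - s • M)⁻¹) 0 := by
    refine ContinuousAt.comp (f := fun s : ℂ => 1 - s • M) (g := fun A => A⁻¹) ?_ (by fun_prop)
    refine continuousAt_matrix_inv _ ?_
    simp only [zero_smul, sub_zero, Matrix.det_one]
    simp
  have h2 : Tendsto (fun s : ℂ => (1 - s • M)⁻¹) (𝓝 0) (𝓝 1) := by
    have := h1.tendsto
    simpa using this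
  refine (h2.comp tendsto_inv₀_cobounded).congr' ?_
  filter_upwards [Bornology.le_cofinite ℂ (eventually_det_ne_zero M),
    Bornology.eventually_ne_cobounded (0 : ℂ)] with z hz h0
  refine Matrix.inv_eq_left_inv ?_
  rw [smul_mul_assoc, ← mul_smul_comm, smul_sub, smul_inv_smul₀ h0]
  rw [Matrix.smul_one_eq_diagonal]
  exact resolvent_mul hz

theorem tendsto_smul_smul_resolvent_sub_one (M : Matrix ι ι ℂ) :
    Tendsto (fun z => z • (z • resolvent M z - 1)) (Bornology.cobounded ℂ) (𝓝 M) := by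
  have h1 := (tendsto_smul_resolvent M).const_mul M
  rw [mul_one] at h1
  refine h1.congr' ?_
  filter_upwards [Bornology.le_cofinite ℂ (eventually_det_ne_zero M)] with z hz
  rw [mul_smul_comm]
  congr 1
  have := mul_resolvent hz
  rw [sub_mul, Matrix.scalar_apply, ← Matrix.smul_eq_diagonal_mul] at this
  rw [← this, sub_sub_cancel]

theorem tendsto_mul_cmFun (M L : Matrix ι ι ℂ) (x : ℂ) :
    Tendsto (fun z => z * cmFun M L x z) (Bornology.cobounded ℂ)
      (𝓝 (dotProduct 1 ((resolvent M x).mulVec 1))) := by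
  have h : Continuous fun G : Matrix ι ι ℂ => dotProduct 1 ((resolvent M x * G).mulVec 1) := by
    fun_prop
  have h1 := (h.tendsto 1).comp (tendsto_smul_resolvent L)
  rw [mul_one] at h1
  refine h1.congr fun z => ?_
  simp only [Function.comp, mul_smul_comm, Matrix.smul_mulVec, dotProduct_smul, smul_eq_mul]
  rfl

/-- The coefficient at 1/z²; it carries the momenta, as the coefficient at 1/z carries the
positions. -/
theorem tendsto_mul_mul_cmFun_sub (M L : Matrix ι ι ℂ) (x : ℂ) :
    Tendsto (fun z => z * (z * cmFun M L x z - dotProduct 1 ((resolvent M x).mulVec 1)))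
      (Bornology.cobounded ℂ) (𝓝 (dotProduct 1 ((resolvent M x * L).mulVec 1))) := by
  have h : Continuous fun G : Matrix ι ι ℂ => dotProduct 1 ((resolvent M x * G).mulVec 1) := by
    fun_prop
  have h1 := (h.tendsto L).comp (tendsto_smul_smul_resolvent_sub_one L)
  refine h1.congr fun z => ?_
  simp only [Function.comp, mul_smul_comm, mul_sub, Matrix.sub_mulVec, Matrix.smul_mulVec,
    dotProduct_smul, dotProduct_sub, smul_eq_mul, mul_one, cmFun]

end matrices

theorem ParticleSystem.isCMPair (P : ParticleSystem) : IsCMPair P.posMat P.laxMat := by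
  ext i j
  rw [Matrix.sub_apply, ParticleSystem.posMat, Matrix.diagonal_mul, Matrix.mul_diagonal,
    Matrix.sub_apply, Matrix.one_apply, Matrix.of_apply]
  split_ifs with h
  · rw [h]; ring
  · rw [P.laxMat_of_ne h]
    have := P.sub_ne_zero h
    field_simp
    ring

theorem ParticleSystem.charpoly_posMat (P : ParticleSystem) :
    P.posMat.charpoly = (P.positions.map fun r => X - C r).prod := by
  rw [posMat, Matrix.charpoly_diagonal, positions, Multiset.map_map]
  exact Finset.prod_coe_sort P.particles (fun p => X - C p.1)

/-- A polynomial divided by `z ^ n` tends to its coefficient at `z ^ n`. -/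
theorem tendsto_eval_mul_inv_pow {p : ℂ[X]} {n : ℕ} (hp : p.natDegree ≤ n) :
    Tendsto (fun z => p.eval z * z⁻¹ ^ n) (Bornology.cobounded ℂ) (𝓝 (p.coeff n)) := by
  have h1 := ((reflect n p).continuous.tendsto 0).comp
    (tendsto_inv₀_cobounded : Tendsto (fun z : ℂ => z⁻¹) _ _)
  rw [← coeff_zero_eq_eval_zero, coeff_reflect, revAt_le (Nat.zero_le n), Nat.sub_zero] at h1
  refine h1.congr' ?_
  filter_upwards [Bornology.eventually_ne_cobounded (0 : ℂ)] with z h0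
  let := invertibleOfNonzero h0
  have := eval₂_reflect_mul_pow (RingHom.id ℂ) z n p hp
  rw [invOf_eq_inv] at this
  change (reflect n p).eval z⁻¹ * z ^ n = p.eval z at this
  rw [Function.comp, ← this, mul_assoc, ← mul_pow, mul_inv_cancel₀ h0, one_pow, mul_one]

/-- The coefficient at `1 / z` of the expansion of `R / q` at infinity. -/
theorem tendsto_mul_div_sub_one {R q : ℂ[X]} (hR : R.Monic) (hq : q.Monic)
    (h : R.natDegree = q.natDegree) :
    Tendsto (fun z => z * (R.eval z / q.eval z - 1)) (Bornology.cobounded ℂ)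
      (𝓝 (R.nextCoeff - q.nextCoeff)) := by
  rcases hN : q.natDegree with _ | n
  · rw [hN] at h
    rw [hR.natDegree_eq_zero.mp h, hq.natDegree_eq_zero.mp hN]
    simp
  · rw [hN] at h
    have hd : (R - q).natDegree ≤ n := by
      have h1 : (R - q).degree < R.degree := degree_sub_lt_left
        (by rw [degree_eq_natDegree hR.ne_zero, degree_eq_natDegree hq.ne_zero, h, hN])
        hR.ne_zero (by rw [hR.leadingCoeff, hq.leadingCoeff])
      rw [degree_eq_natDegree hR.ne_zero, h] at h1
      rcases eq_or_ne (R - q) 0 with h0 | h0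
      · simp [h0]
      · rw [degree_eq_natDegree h0] at h1
        norm_cast at h1
        omega
    have h1 := tendsto_eval_mul_inv_pow hd
    have h2 := tendsto_eval_mul_inv_pow hN.le
    rw [← hN, hq.coeff_natDegree, hN] at h2
    have h3 := h1.div h2 one_ne_zero
    rw [div_one, coeff_sub] at h3
    have e1 : R.nextCoeff = R.coeff n := by rw [nextCoeff_of_natDegree_pos (by omega), h]; rfl
    have e2 : q.nextCoeff = q.coeff n := by rw [nextCoeff_of_natDegree_pos (by omega), hN]; rfl
    rw [e1, e2]
    have hq0 : ∀ᶠ z in Bornology.cobounded ℂ, q.eval z ≠ 0 := by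
      refine Bornology.le_cofinite ℂ ?_
      change ∀ᶠ z in cofinite, q.eval z ≠ 0
      rw [eventually_cofinite]
      simpa using! finite_setOfPred_isRoot hq.ne_zero
    refine h3.congr' ?_
    filter_upwards [hq0, Bornology.eventually_ne_cobounded (0 : ℂ)] with z hz h0
    simp only [Pi.div_apply, eval_sub]
    rw [pow_succ]
    have := pow_ne_zero n (inv_ne_zero h0)
    field_simp

theorem coeff_X_mul_derivative (p : ℂ[X]) (n : ℕ) :
    (X * derivative p).coeff n = n * p.coeff n := by
  cases n with
  | zero => simp
  | succ n => rw [coeff_X_mul, coeff_derivative]; push_cast; ring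

theorem natDegree_X_mul_derivative_le (p : ℂ[X]) : (X * derivative p).natDegree ≤ p.natDegree := by
  refine natDegree_le_iff_coeff_eq_zero.mpr fun n hn => ?_
  rw [coeff_X_mul_derivative, coeff_eq_zero_of_natDegree_lt hn, mul_zero]

/-- Polynomials with the same logarithmic derivative are proportional. -/
theorem eq_C_mul_of_derivative_mul_eq {p q : ℂ[X]} (hq : q ≠ 0)
    (h : derivative p * q = p * derivative q) : ∃ a : ℂ, p = C a * q := by
  -- Multiplying by x makes top coefficients comparable, and in characteristic zero they force equal
  -- degrees. A nonzero p - aq would satisfy the same relation in smaller degree.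
  have hdeg : ∀ p : ℂ[X], derivative p * q = p * derivative q → p ≠ 0 →
      p.natDegree = q.natDegree := by
    intro p h hp
    have h2 : (X * derivative p * q).coeff (p.natDegree + q.natDegree) =
        (p * (X * derivative q)).coeff (p.natDegree + q.natDegree) := by
      rw [mul_assoc, h, mul_left_comm]
    rw [coeff_mul_add_eq_of_natDegree_le (natDegree_X_mul_derivative_le p) le_rfl,
      coeff_mul_add_eq_of_natDegree_le le_rfl (natDegree_X_mul_derivative_le q),
      coeff_X_mul_derivative, coeff_X_mul_derivative] at h2
    have h3 : (p.natDegree : ℂ) = q.natDegree := by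
      refine mul_left_cancel₀ (mul_ne_zero (leadingCoeff_ne_zero.mpr hp)
        (leadingCoeff_ne_zero.mpr hq)) ?_
      simp only [leadingCoeff]
      linear_combination h2
    exact_mod_cast h3
  rcases eq_or_ne p 0 with hp | hp
  · exact ⟨0, by simp [hp]⟩
  set a := p.leadingCoeff / q.leadingCoeff with ha
  have hq0 := leadingCoeff_ne_zero.mpr hq
  have ha0 : a ≠ 0 := div_ne_zero (leadingCoeff_ne_zero.mpr hp) hq0
  refine ⟨a, ?_⟩
  by_contra hne
  have h1 : p - C a * q ≠ 0 := _root_.sub_ne_zero.mpr hne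
  have hlc : p.leadingCoeff = (C a * q).leadingCoeff := by
    rw [leadingCoeff_mul, leadingCoeff_C, ha, div_mul_cancel₀ _ hq0]
  have hpq := hdeg p h hp
  have h2 : (p - C a * q).degree < p.degree := by
    refine degree_sub_lt_left ?_ hp hlc
    rw [degree_C_mul ha0, degree_eq_natDegree hp, degree_eq_natDegree hq, hpq]
  have h3 := hdeg (p - C a * q) (by
    rw [derivative_sub, derivative_C_mul]
    linear_combination h) h1
  have h4 := natDegree_lt_natDegree h1 h2
  omega

end

section

/-! ### Existence of a solution with given Calogero–Moser matrices -/

theorem finrank_degreeLT (n : ℕ) : Module.finrank ℂ (degreeLT ℂ n) = n := by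
  rw [(degreeLTEquiv ℂ n).finrank_eq, Module.finrank_fin_fun]

instance finite_degreeLT (n : ℕ) : FiniteDimensional ℂ (degreeLT ℂ n) :=
  Module.Finite.equiv (degreeLTEquiv ℂ n).symm

/-- Independent solutions of a system of linear equations `F v = 0`, `Φ v = 0`. -/
theorem exists_linearIndependent_of_finrank_le {V U U' U'' : Type*} [AddCommGroup V] [Module ℂ V]
    [FiniteDimensional ℂ V] [AddCommGroup U] [Module ℂ U] [AddCommGroup U'] [Module ℂ U']
    [AddCommGroup U''] [Module ℂ U''] (F : V →ₗ[ℂ] U) (Φ : V →ₗ[ℂ] U') (π : V →ₗ[ℂ] U'')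
    {A : Submodule ℂ U} {B : Submodule ℂ U'} [FiniteDimensional ℂ A] [FiniteDimensional ℂ B] {m : ℕ}
    (hF : ∀ v, F v ∈ A) (hΦ : ∀ v, F v = 0 → Φ v ∈ B)
    (hπ : ∀ v, F v = 0 → Φ v = 0 → π v = 0 → v = 0)
    (hm : m + Module.finrank ℂ A + Module.finrank ℂ B ≤ Module.finrank ℂ V) :
    ∃ f : Fin m → V, LinearIndependent ℂ (fun i => π (f i)) ∧ ∀ i, F (f i) = 0 ∧ Φ (f i) = 0 := by
  have h1 := LinearMap.finrank_range_add_finrank_ker F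
  have h2 : Module.finrank ℂ (LinearMap.range F) ≤ Module.finrank ℂ A := by
    refine Submodule.finrank_mono ?_
    rintro _ ⟨v, rfl⟩
    exact hF v
  have h3 := LinearMap.finrank_range_add_finrank_ker (Φ.domRestrict (LinearMap.ker F))
  have h4 : Module.finrank ℂ (LinearMap.range (Φ.domRestrict (LinearMap.ker F))) ≤
      Module.finrank ℂ B := by
    refine Submodule.finrank_mono ?_
    rintro _ ⟨v, rfl⟩
    exact hΦ v.1 (LinearMap.mem_ker.mp v.2)
  obtain ⟨f, hf⟩ := exists_linearIndependent_of_le_finrank (R := ℂ)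
    (M := LinearMap.ker (Φ.domRestrict (LinearMap.ker F))) (n := m) (by omega)
  have hF0 : ∀ u : LinearMap.ker (Φ.domRestrict (LinearMap.ker F)), F u.1.1 = 0 :=
    fun u => LinearMap.mem_ker.mp u.1.2
  have hΦ0 : ∀ u : LinearMap.ker (Φ.domRestrict (LinearMap.ker F)), Φ u.1.1 = 0 :=
    fun u => LinearMap.mem_ker.mp u.2
  refine ⟨fun i => (f i).1.1, ?_, fun i => ⟨hF0 _, hΦ0 _⟩⟩
  refine hf.map' (π.comp ((Submodule.subtype _).comp (Submodule.subtype _)))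
    (LinearMap.ker_eq_bot'.mpr fun u hu => ?_)
  exact Subtype.ext (Subtype.ext (hπ _ (hF0 u) (hΦ0 u) hu))

namespace DiffCond

theorem degree_twist_le (a : ℂ) (p : ℂ[X]) : (twist a p).degree ≤ p.degree := by
  rw [twist_apply, ← smul_eq_C_mul]
  exact (degree_add_le _ _).trans (max_le (degree_smul_le _ _) (degree_derivative_le))

theorem degree_aeval_twist_le (a : ℂ) (r p : ℂ[X]) : (aeval (twist a) r p).degree ≤ p.degree := by
  induction r using Polynomial.induction_on' with
  | add f g hf hg =>
    rw [map_add, LinearMap.add_apply]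
    exact (degree_add_le _ _).trans (max_le hf hg)
  | monomial n c =>
    rw [← C_mul_X_pow_eq_monomial, ← smul_eq_C_mul, map_smul, map_pow, aeval_X,
      LinearMap.smul_apply]
    refine (degree_smul_le _ _).trans ?_
    induction n with
    | zero => simp
    | succ n ih =>
      rw [pow_succ', Module.End.mul_apply]
      exact (degree_twist_le a _).trans ih

theorem aeval_twist_X_sub_C_pow (a : ℂ) (m : ℕ) (p : ℂ[X]) :
    aeval (twist a) ((X - C a) ^ m) p = derivative^[m] p := by
  rw [map_pow, map_sub, aeval_X, aeval_C, twist, add_sub_cancel_left, Module.End.pow_apply]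

/-- X - a acts as d/dx, so m such factors lower the degree by m, and the remaining factor does not
raise it. -/
theorem aeval_twist_mem_degreeLT {a : ℂ} {χ : ℂ[X]} {m : ℕ} (h : (X - C a) ^ m ∣ χ) {K : ℕ}
    {p : ℂ[X]} (hp : p ∈ degreeLT ℂ (K + m)) : aeval (twist a) χ p ∈ degreeLT ℂ K := by
  obtain ⟨r, rfl⟩ := h
  rw [map_mul, Module.End.mul_apply, aeval_twist_X_sub_C_pow]
  rw [mem_degreeLT] at hp ⊢
  refine degree_lt_iff_coeff_zero _ _ |>.mpr fun n hn => ?_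
  have h1 := (degree_aeval_twist_le a r p).trans_lt hp
  rw [coeff_iterate_derivative, (degree_lt_iff_coeff_zero _ _).mp h1 _ (by omega), smul_zero]

theorem twist_X_mul (a : ℂ) (p : ℂ[X]) : twist a (X * p) = p + X * twist a p := by
  rw [twist_apply, twist_apply, derivative_mul, derivative_X]; ring

variable {ι : Type*} [Fintype ι]

/-- The space of polynomial vectors `h` with `h' = (L - a) h`. -/
def twistSpace (a : ℂ) (L : Matrix ι ι ℂ) : Submodule ℂ (ι → ℂ[X]) where
  carrier := {h | ∀ k, twist a (h k) = ∑ j, L k j • h j}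
  add_mem' := fun hf hg k => by
    simp only [Pi.add_apply, map_add, smul_add, Finset.sum_add_distrib]
    rw [hf k, hg k]
  zero_mem' := fun k => by simp
  smul_mem' := fun c f hf k => by
    simp only [Pi.smul_apply, map_smul]
    rw [hf k, Finset.smul_sum]
    exact Finset.sum_congr rfl fun j _ => smul_comm _ _ _

/-- Uniqueness for the linear system h' = (L - a)h: the initial value determines h, so the solution
space is finite dimensional. -/
theorem coeff_eq_zero_of_mem_twistSpace {a : ℂ} {L : Matrix ι ι ℂ} (n : ℕ) :
    ∀ h ∈ twistSpace a L, (∀ k, (h k).coeff 0 = 0) → ∀ k, (h k).coeff n = 0 := by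
  induction n with
  | zero => exact fun h _ h0 => h0
  | succ n ih =>
    intro h hh h0 k
    have hd : ∀ k, derivative (h k) = ∑ j, L k j • h j - a • h k := fun k => by
      rw [← hh k, twist_apply, smul_eq_C_mul, add_sub_cancel_left]
    have h1 := ih (fun k => derivative (h k)) (fun k => ?_) (fun k => ?_) k
    · rw [coeff_derivative] at h1
      exact (mul_eq_zero.mp h1).resolve_right (Nat.cast_add_one_ne_zero n)
    · have := congrArg derivative (hh k)
      rw [twist_apply, derivative_add, derivative_C_mul, derivative_sum] at this
      rw [twist_apply, this]
      exact Finset.sum_congr rfl fun j _ => derivative_smul _ _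
    · rw [hd, coeff_sub, finsetSum_coeff, coeff_smul, h0]
      simp [h0]

instance finiteDimensional_twistSpace (a : ℂ) (L : Matrix ι ι ℂ) :
    FiniteDimensional ℂ (twistSpace a L) := by
  let f : twistSpace a L →ₗ[ℂ] ι → ℂ :=
    (LinearMap.pi fun k => (lcoeff ℂ 0).comp (LinearMap.proj k)).comp (Submodule.subtype _)
  refine FiniteDimensional.of_injective f ((injective_iff_map_eq_zero f).mpr fun h hf => ?_)
  refine Subtype.ext (funext fun k => Polynomial.ext fun n => ?_)
  exact coeff_eq_zero_of_mem_twistSpace n h.1 h.2 (fun k => congrFun hf k) k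

theorem exists_twistSpace_le_degreeLT (a : ℂ) (L : Matrix ι ι ℂ) :
    ∃ K, ∀ h ∈ twistSpace a L, ∀ k, h k ∈ degreeLT ℂ K := by
  obtain ⟨S, hS⟩ := (Submodule.fg_iff_finiteDimensional _).mpr (finiteDimensional_twistSpace a L)
  refine ⟨S.sup fun s => Finset.univ.sup fun k => (s k).natDegree + 1, fun h hh k => ?_⟩
  rw [← hS] at hh
  have : Submodule.span ℂ (S : Set (ι → ℂ[X])) ≤ (degreeLT ℂ
      (S.sup fun s => Finset.univ.sup fun k => (s k).natDegree + 1)).comap (LinearMap.proj k) := by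
    refine Submodule.span_le.mpr fun s hs => ?_
    rw [SetLike.mem_coe, Submodule.mem_comap, LinearMap.proj_apply, mem_degreeLT]
    refine degree_le_natDegree.trans_lt ?_
    have h1 : (s k).natDegree + 1 ≤ Finset.univ.sup fun k => (s k).natDegree + 1 :=
      Finset.le_sup (f := fun k => (s k).natDegree + 1) (Finset.mem_univ k)
    have h2 := Finset.le_sup (f := fun s : ι → ℂ[X] =>
      Finset.univ.sup fun k => (s k).natDegree + 1) (Finset.mem_coe.mp hs)
    have h3 := h1.trans h2
    norm_cast
  exact this hh

end DiffCond

/-! ### The solution attached to a Calogero–Moser pair -/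

section

variable {ι : Type*} [Fintype ι] [DecidableEq ι]

theorem charmatrix_mulVec (M : Matrix ι ι ℂ) (h : ι → ℂ[X]) (k : ι) :
    M.charmatrix.mulVec h k = X * h k - ∑ j, C (M k j) * h j := by
  simp only [Matrix.mulVec, dotProduct, Matrix.charmatrix_apply, Matrix.diagonal_apply, sub_mul,
    Finset.sum_sub_distrib, ite_mul, zero_mul, Finset.sum_ite_eq, Finset.mem_univ, if_true]

/-- The row sums of the adjugate of `z - L`. -/
def adjSum (L : Matrix ι ι ℂ) : ι → ℂ[X] := L.charmatrix.adjugate.mulVec 1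

theorem adjSum_lax (L : Matrix ι ι ℂ) (k : ι) :
    X * adjSum L k - ∑ j, C (L k j) * adjSum L j = L.charpoly := by
  rw [← charmatrix_mulVec, adjSum, Matrix.mulVec_mulVec, Matrix.mul_adjugate, Matrix.smul_mulVec,
    Matrix.one_mulVec, Pi.smul_apply, Pi.one_apply, smul_eq_mul, mul_one, Matrix.charpoly]

open DiffCond in
-- The defect in the equation for p and h solves the same differential system as h, because the
-- commutator [M, L] = 1 - J matches the terms from differentiating xh and from the Lax relation. It
-- therefore imposes only finitely many linear equations.
theorem IsCMPair.mem_twistSpace {M L : Matrix ι ι ℂ} (hcm : IsCMPair M L) {a : ℂ} {p : ℂ[X]}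
    {h : ι → ℂ[X]} (hh : h ∈ twistSpace a L) (hp : aeval (twist a) L.charpoly p = ∑ k, h k) :
    (fun k => aeval (twist a) (adjSum L k) p - X * h k + ∑ j, M k j • h j) ∈ twistSpace a L := by
  intro k
  have h1 : twist a (aeval (twist a) (adjSum L k) p) =
      ∑ j, L k j • aeval (twist a) (adjSum L j) p + ∑ k, h k := by
    have := congrArg (fun r => aeval (twist a) r p) (adjSum_lax L k)
    simp only [map_sub, map_mul, aeval_X, map_sum, aeval_C, LinearMap.sub_apply,
      Module.End.mul_apply, LinearMap.sum_apply, Module.algebraMap_end_apply, hp] at this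
    rw [← this]; abel
  have h2 : ∑ j, M k j • twist a (h j) = ∑ j, (M * L) k j • h j := by
    simp only [hh _, Finset.smul_sum, Matrix.mul_apply, Finset.sum_smul, smul_smul]
    exact Finset.sum_comm
  have h3 : ∑ j, L k j • ∑ l, M j l • h l = ∑ j, (L * M) k j • h j := by
    simp only [Finset.smul_sum, Matrix.mul_apply, Finset.sum_smul, smul_smul]
    exact Finset.sum_comm
  have h4 : ∑ j, (M * L) k j • h j - ∑ j, (L * M) k j • h j = h k - ∑ j, h j := by
    rw [← Finset.sum_sub_distrib]
    have e : ∀ j, (M * L) k j • h j - (L * M) k j • h j = (if k = j then h j else 0) - h j := by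
      intro j
      have := congrFun (congrFun hcm k) j
      rw [Matrix.sub_apply, Matrix.sub_apply, Matrix.one_apply, Matrix.of_apply] at this
      rw [← sub_smul, this, sub_smul, one_smul, ite_smul, one_smul, zero_smul]
    rw [Finset.sum_congr rfl fun j _ => e j, Finset.sum_sub_distrib, Finset.sum_ite_eq,
      if_pos (Finset.mem_univ k)]
  have h5 : ∑ j, L k j • (X * h j) = X * ∑ j, L k j • h j := by
    rw [Finset.mul_sum]
    exact Finset.sum_congr rfl fun j _ => (mul_smul_comm _ _ _).symm
  simp only [map_add, map_sub, map_sum, map_smul, smul_add, smul_sub, Finset.sum_add_distrib,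
    Finset.sum_sub_distrib]
  rw [h1, h2, h3, h5, twist_X_mul, hh k]
  linear_combination h4

open DiffCond in
/-- The polynomials whose conditions at `a` define the solution with matrices `M` and `L`. -/
theorem IsCMPair.exists_linearIndependent {M L : Matrix ι ι ℂ} (hcm : IsCMPair M L) {a : ℂ} {m : ℕ}
    (hm : (X - C a) ^ m ∣ L.charpoly) :
    ∃ p : Fin m → ℂ[X], LinearIndependent ℂ p ∧ ∀ i, ∃ h : ι → ℂ[X],
      (∀ k, aeval (twist a) (adjSum L k) (p i) = X * h k - ∑ j, C (M k j) * h j) ∧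
      aeval (twist a) L.charpoly (p i) = ∑ k, h k := by
  obtain ⟨K, hK⟩ := exists_twistSpace_le_degreeLT a L
  let F : degreeLT ℂ (K + m) × twistSpace a L →ₗ[ℂ] ℂ[X] :=
    LinearMap.coprod ((aeval (twist a) L.charpoly).comp (Submodule.subtype _))
      (-(∑ k, LinearMap.proj k).comp (Submodule.subtype _))
  have hF : ∀ u, F u = aeval (twist a) L.charpoly u.1.1 - ∑ k, u.2.1 k := fun u => by
    simp [F, sub_eq_add_neg]
  let π : ι → (ι → ℂ[X]) →ₗ[ℂ] ℂ[X] := LinearMap.proj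
  let Φ : degreeLT ℂ (K + m) × twistSpace a L →ₗ[ℂ] (ι → ℂ[X]) :=
    LinearMap.pi fun k => LinearMap.coprod
      ((aeval (twist a) (adjSum L k)).comp (Submodule.subtype _))
      ((∑ j, M k j • π j - (LinearMap.mulLeft ℂ X).comp (π k)).comp (Submodule.subtype _))
  have hΦ : ∀ u k, Φ u k =
      aeval (twist a) (adjSum L k) u.1.1 - X * u.2.1 k + ∑ j, M k j • u.2.1 j := fun u k => by
    simp [Φ, π]; ring
  have hrel : ∀ u, Φ u = 0 → ∀ k, aeval (twist a) (adjSum L k) u.1.1 =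
      X * u.2.1 k - ∑ j, C (M k j) * u.2.1 j := fun u hu k => by
    have h1 : Φ u k = 0 := congrFun hu k
    rw [hΦ] at h1
    simp only [← smul_eq_C_mul]
    linear_combination h1
  have hA : ∀ u, F u ∈ degreeLT ℂ K := fun u => by
    rw [hF]
    exact Submodule.sub_mem _ (aeval_twist_mem_degreeLT hm u.1.2)
      (Submodule.sum_mem _ fun k _ => hK _ u.2.2 k)
  have hB : ∀ u, F u = 0 → Φ u ∈ twistSpace a L := fun u hu => by
    rw [hF, sub_eq_zero] at hu
    have h4 := hcm.mem_twistSpace u.2.2 hu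
    rwa [← funext (hΦ u)] at h4
  -- The condition determines its vector h, since x - M is invertible over rational functions.
  have h0 : ∀ u, F u = 0 → Φ u = 0 → u.1.1 = 0 → u = 0 := fun u _ hu h0 => by
    have h1 : M.charmatrix.mulVec u.2.1 = 0 := by
      funext k
      rw [charmatrix_mulVec, ← hrel u hu, h0, map_zero, Pi.zero_apply]
    have h2 := Matrix.eq_zero_of_mulVec_eq_zero M.charpoly_monic.ne_zero h1
    exact Prod.ext (Subtype.ext h0) (Subtype.ext h2)
  -- F imposes at most K equations on p and h, and Φ then at most dim `twistSpace`. The dimension of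
  -- `twistSpace` cancels, leaving m solutions.
  have hd : m + Module.finrank ℂ (degreeLT ℂ K) + Module.finrank ℂ (twistSpace a L) ≤
      Module.finrank ℂ (degreeLT ℂ (K + m) × twistSpace a L) := by
    rw [Module.finrank_prod, finrank_degreeLT, finrank_degreeLT]
    omega
  obtain ⟨f, hf, hf0⟩ := exists_linearIndependent_of_finrank_le F Φ
    ((Submodule.subtype _).comp (LinearMap.fst ℂ _ _)) hA hB h0 hd
  refine ⟨_, hf, fun i => ⟨(f i).2.1, hrel (f i) (hf0 i).2, ?_⟩⟩
  have h1 := (hf0 i).1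
  rw [hF, sub_eq_zero] at h1
  exact h1

/-- The rational solution with given Calogero–Moser matrices. -/
theorem IsCMPair.exists_rationalSolution {M L : Matrix ι ι ℂ} (hcm : IsCMPair M L) :
    ∃ W : RationalSolution, W.qPoly = L.charpoly ∧
      ∀ x, (Matrix.scalar ι x - M).det ≠ 0 → W.IsKernel x (W.cmKernel M (adjSum L) x) := by
  have hroots : L.charpoly = (L.charpoly.roots.map fun a => X - C a).prod :=
    (IsAlgClosed.splits L.charpoly).eq_prod_roots_of_monic L.charpoly_monic
  choose p hp hh using fun a : ℂ => hcm.exists_linearIndependent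
    (show (X - C a) ^ (L.charpoly.roots.count a) ∣ L.charpoly by
      rw [count_roots]; exact pow_rootMultiplicity_dvd _ _)
  let e := (Fintype.equivFin L.charpoly.roots.ToType).symm
  let W : RationalSolution :=
    { N := Fintype.card L.charpoly.roots.ToType
      pt := fun i => (e i).1
      cond := fun i => DiffCond.ofPoly (e i).1 (p (e i).1 (e i).2)
      supported := fun i => DiffCond.ofPoly_supportedAt _ _
      linInd := (DiffCond.linearIndependent_ofPoly p hp).comp e e.injective }
  have hq : W.qPoly = L.charpoly := by
    rw [hroots, ← Multiset.map_univ L.charpoly.roots fun a => X - C a]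
    exact Equiv.prod_comp e fun s : L.charpoly.roots.ToType => X - C s.1
  refine ⟨W, hq, fun x hx => ?_⟩
  obtain ⟨h1, h2⟩ := RationalSolution.cmKernel_monic (W := W)
    (fun k => (adjSum_lax L k).trans hq.symm) M x
  refine ⟨h1, h2, fun i => ?_⟩
  obtain ⟨h, h3, h4⟩ := hh (e i).1 (e i).2
  change (DiffCond.ofPoly (e i).1 (p (e i).1 (e i).2)).mom x 0 _ = 0
  rw [DiffCond.mom_ofPoly, RationalSolution.cmKernel, hq, map_sub, LinearMap.sub_apply, h4,
    map_sum, LinearMap.sum_apply]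
  have h5 : ∀ k, (aeval (DiffCond.twist (e i).1)
      (C (Matrix.vecMul 1 (resolvent M x) k) * adjSum L k) (p (e i).1 (e i).2)).eval x =
      Matrix.vecMul 1 (resolvent M x) k *
        (Matrix.scalar ι x - M).mulVec (fun j => (h j).eval x) k := fun k => by
    rw [← smul_eq_C_mul, map_smul, LinearMap.smul_apply, h3, Polynomial.eval_smul, smul_eq_mul,
      Matrix.sub_mulVec, Pi.sub_apply, Matrix.scalar_apply, Matrix.mulVec_diagonal, eval_sub,
      eval_mul, eval_X, eval_finsetSum]
    simp only [eval_mul, eval_C]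
    rfl
  rw [eval_sub, eval_finsetSum, eval_finsetSum, Finset.sum_congr rfl fun k _ => h5 k]
  change _ * (_ - dotProduct (Matrix.vecMul 1 (resolvent M x)) _) = 0
  rw [Matrix.dotProduct_mulVec, Matrix.vecMul_vecMul, resolvent_mul hx, Matrix.vecMul_one]
  simp [dotProduct]

end

end

section

/-! ### Wave functions and positions -/

namespace RationalSolution

theorem eventually_q_ne_zero (W : RationalSolution) : ∀ᶠ z in cofinite, W.q z ≠ 0 := by
  rw [eventually_cofinite]
  simpa [← eval_qPoly] using! finite_setOfPred_isRoot W.qPoly_monic.ne_zero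

theorem eventually_wr_ne_zero (W : RationalSolution) : ∀ᶠ x in cofinite, W.wr x 0 ≠ 0 := by
  obtain ⟨B, T, h⟩ := W.exists_isNumer
  simp only [h.wr_ne_zero_iff]
  rw [eventually_cofinite]
  simpa using! finite_setOfPred_isRoot h.ne_zero

theorem exists_isKernel {W : RationalSolution} {x : ℂ} (hx : W.wr x 0 ≠ 0) :
    ∃ R, W.IsKernel x R := by
  obtain ⟨B, T, h⟩ := W.exists_isNumer
  exact ⟨_, h.isKernel ((h.wr_ne_zero_iff x).mp hx)⟩

theorem mom_flow_zero (W : RationalSolution) (t : Times) (i : Fin W.N) (g : ℂ[X]) :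
    ((W.flow t).cond i).mom 0 0 g =
      (W.cond i).eval fun z => g.eval z * Complex.exp (phase t z) := by
  rw [DiffCond.mom_zero_apply]
  refine (eval_flowCond t (W.cond i) (by fun_prop)).trans ?_
  simp

theorem exists_monic_of_tau_ne_zero (W : RationalSolution) {t : Times} (h : W.tau t ≠ 0) :
    ∃ R : ℂ[X], R.Monic ∧ R.natDegree = W.N ∧
      ∀ i, (W.cond i).eval (fun z => R.eval z * Complex.exp (phase t z)) = 0 := by
  have h1 : (W.flow t).wr 0 0 ≠ 0 := by
    have h2 := left_ne_zero_of_mul h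
    have h3 : (W.flow t).momMatrix 0 0 = Matrix.of fun i j : Fin W.N =>
        (W.cond i).eval fun z => z ^ (j : ℕ) * Complex.exp (phase t z) := by
      ext i j
      refine (W.mom_flow_zero t i _).trans ?_
      simp only [eval_pow, eval_X]
      rfl
    rw [wr, h3]
    exact h2
  obtain ⟨R, hR⟩ := exists_isKernel h1
  exact ⟨R, hR.monic, hR.natDegree_eq, fun i => by
    rw [← W.mom_flow_zero t i]; exact hR.mom_eq_zero i⟩

theorem exists_isWaveFunction (W : RationalSolution) : ∃ ψ, W.IsWaveFunction ψ := by
  classical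
  choose R h1 h2 h3 using fun t (h : W.tau t ≠ 0) => W.exists_monic_of_tau_ne_zero h
  refine ⟨fun t z => if h : W.tau t ≠ 0 then
    (R t h).eval z / W.q z * Complex.exp (phase t z) else 0, fun t h => ?_⟩
  exact ⟨R t h, h1 t h, h2 t h, h3 t h, fun z _ => dif_pos h⟩

theorem IsWaveFunction.exists_isKernel {W : RationalSolution} {ψ : Times → ℂ → ℂ}
    (h : W.IsWaveFunction ψ) {x : ℂ} (hx : W.tau (times₂ x 0) ≠ 0) :
    ∃ R, W.IsKernel x R ∧ ∀ z, W.q z ≠ 0 →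
      ψ (times₂ x 0) z = R.eval z / W.q z * Complex.exp (x * z) := by
  obtain ⟨R, h1, h2, h3, h4⟩ := h _ hx
  refine ⟨R, ⟨h1, h2, fun i => ?_⟩, fun z hz => ?_⟩
  · rw [DiffCond.mom_zero_apply]
    simpa [phase_times₂] using h3 i
  · simpa [phase_times₂] using h4 z hz

theorem HasPositions.unique {W : RationalSolution} {M M' : Multiset ℂ} (h : W.HasPositions M)
    (h' : W.HasPositions M') : M = M' := by
  obtain ⟨B, T, hT⟩ := W.exists_isNumer
  obtain ⟨a, ha, h1⟩ := h.eq_of_isNumer hT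
  obtain ⟨b, hb, h2⟩ := h'.eq_of_isNumer hT
  have h3 := congrArg roots h1
  have h4 := congrArg roots h2
  rw [roots_C_mul _ ha, roots_multiset_prod_X_sub_C] at h3
  rw [roots_C_mul _ hb, roots_multiset_prod_X_sub_C] at h4
  exact h3.symm.trans h4

/-- Simple roots of `τ` move differentiably with the second time. -/
theorem exists_velocity {W : RationalSolution} {r u : ℂ}
    (hr : W.wr r 0 = 0) (hu : HasDerivAt (fun x => W.wr x 0) u r) (hu0 : u ≠ 0) :
    ∃ y : ℂ, ∃ Y : ℂ → ℂ, Y 0 = r ∧ HasDerivAt Y (2 * y) 0 ∧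
      ∀ᶠ s in 𝓝 (0 : ℂ), W.tau (times₂ (Y s) s) = 0 := by
  have hF : ContDiff ℂ 1 fun p : ℂ × ℂ => W.wr p.2 p.1 :=
    ContDiff.comp (g := fun p : ℂ × ℂ => W.wr p.1 p.2) (f := fun p : ℂ × ℂ => (p.2, p.1))
      W.contDiff_wr (contDiff_snd.prodMk contDiff_fst)
  have hs := hF.contDiffAt.hasStrictFDerivAt (x := ((0 : ℂ), r)) one_ne_zero
  set F' := fderiv ℂ (fun p : ℂ × ℂ => W.wr p.2 p.1) (0, r)
  have h1 : F' (0, 1) = u := by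
    have : HasDerivAt (fun x : ℂ => ((0 : ℂ), x)) (0, 1) r :=
      (hasDerivAt_const r 0).prodMk (hasDerivAt_id r)
    exact (hs.hasFDerivAt.comp_hasDerivAt r this).unique hu
  have hinv : (F'.comp (.inr ℂ ℂ ℂ)).IsInvertible := by
    refine ⟨ContinuousLinearEquiv.unitsEquivAut ℂ (Units.mk0 u hu0), ?_⟩
    ext
    simp [h1]
  have hd := (hs.hasStrictFDerivAt_implicitFunctionOfProdDomain
    hinv).hasFDerivAt.differentiableAt.hasDerivAt
  have he := hs.eventually_apply_implicitFunctionOfProdDomain hinv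
  have h0 := (hs.eventually_apply_eq_iff_implicitFunctionOfProdDomain hinv).self_of_nhds.mp rfl
  generalize hs.implicitFunctionOfProdDomain hinv = Y at hd he h0
  refine ⟨deriv Y 0 / 2, Y, h0, by rw [mul_div_cancel₀ _ two_ne_zero]; exact hd, ?_⟩
  refine he.mono fun s h => (W.tau_eq_zero_iff (Y s) s).mpr ?_
  have h' : W.wr (Y s) s = W.wr r 0 := h
  exact h'.trans hr

/-- Distinct positions are simple roots, which the implicit function theorem continues in the second
time. -/
theorem HasPositions.exists_hasParticleSystem {W : RationalSolution} {Z : Multiset ℂ}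
    (h : W.HasPositions Z) (hZ : Z.Nodup) :
    ∃ P : ParticleSystem, P.positions = Z ∧ W.HasParticleSystem P := by
  obtain ⟨B, T, hT⟩ := W.exists_isNumer
  obtain ⟨a, ha, hTZ⟩ := h.eq_of_isNumer hT
  have key : ∀ r, ∃ y : ℂ, r ∈ Z → ∃ Y : ℂ → ℂ, Y 0 = r ∧ HasDerivAt Y (2 * y) 0 ∧
      ∀ᶠ s in 𝓝 (0 : ℂ), W.tau (times₂ (Y s) s) = 0 := by
    intro r
    by_cases hr : r ∈ Z
    · obtain ⟨M, hM⟩ := Multiset.exists_cons_of_mem hr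
      have h1 : T = C a * ((X - C r) * (M.map fun r => X - C r).prod) := by
        rw [hTZ, hM, Multiset.map_cons, Multiset.prod_cons]
      have h2 : T.eval r = 0 := by simp [h1]
      have h3 : (derivative T).eval r ≠ 0 := by
        have : (derivative T).eval r = a * (M.map fun s => r - s).prod := by
          rw [h1, derivative_C_mul, derivative_mul, eval_mul, eval_add, eval_mul, eval_mul,
            eval_multiset_prod, Multiset.map_map]
          simp
        rw [this]
        refine mul_ne_zero ha (Multiset.prod_ne_zero fun h0 => ?_)
        obtain ⟨s, hs, hrs⟩ := Multiset.mem_map.mp h0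
        rw [hM, Multiset.nodup_cons] at hZ
        exact hZ.1 (sub_eq_zero.mp hrs ▸ hs)
      have h4 := hT.hasDerivAt_wr r
      rw [h2, mul_zero, zero_add] at h4
      obtain ⟨y, hy⟩ := exists_velocity (by rw [hT.wr_eq, h2, mul_zero]) h4
        (mul_ne_zero (Complex.exp_ne_zero _) h3)
      exact ⟨y, fun _ => hy⟩
    · exact ⟨0, fun h => absurd h hr⟩
  choose y hy using key
  have hinj : Function.Injective fun r => (r, y r) := fun r s hrs => (Prod.ext_iff.mp hrs).1
  let P : ParticleSystem :=
    { particles := (⟨Z, hZ⟩ : Finset ℂ).map ⟨fun r => (r, y r), hinj⟩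
      distinct := by
        intro p hp q hq hpq
        simp only [Finset.coe_map, Set.mem_image, Function.Embedding.coeFn_mk] at hp hq
        obtain ⟨r, -, rfl⟩ := hp
        obtain ⟨s, -, rfl⟩ := hq
        simp only at hpq
        rw [hpq] }
  have hP : P.positions = Z := by
    simp [ParticleSystem.positions, P, Multiset.map_map]
  refine ⟨P, hP, hP ▸ h, fun p hp => ?_⟩
  obtain ⟨r, hr, rfl⟩ := Finset.mem_map.mp hp
  exact hy r hr

variable {ι : Type*} [Fintype ι] [DecidableEq ι] {M L : Matrix ι ι ℂ}

/-- For almost all `x` and `z`, the stationary wave function of `W` is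
`(1 - ∑_{ij} ((x - M)⁻¹ (z - L)⁻¹)_{ij}) exp (x z)`. -/
def HasWave (W : RationalSolution) (M L : Matrix ι ι ℂ) : Prop :=
  ∃ S ∈ (cofinite : Filter ℂ), ∀ x ∈ S, ∃ R, W.IsKernel x R ∧
    ∀ z ∈ S, R.eval z = W.q z * (1 - cmFun M L x z)

theorem eval_cmKernel {W : RationalSolution} {w : ι → ℂ[X]}
    (h : ∀ k, X * w k - ∑ j, C (L k j) * w j = W.qPoly) {z : ℂ}
    (hz : (Matrix.scalar ι z - L).det ≠ 0) (M : Matrix ι ι ℂ) (x : ℂ) :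
    (W.cmKernel M w x).eval z = W.q z * (1 - cmFun M L x z) := by
  have h1 : (Matrix.scalar ι z - L).mulVec (fun k => (w k).eval z) = W.q z • 1 := by
    funext k
    have := congrArg (eval z) (h k)
    simp only [eval_sub, eval_mul, eval_X, eval_finsetSum, eval_C, eval_qPoly] at this
    rw [Matrix.sub_mulVec, Pi.sub_apply, Matrix.scalar_apply, Matrix.mulVec_diagonal, Pi.smul_apply,
      Pi.one_apply, smul_eq_mul, mul_one, ← this]
    rfl
  have h2 : (fun k => (w k).eval z) = W.q z • (resolvent L z).mulVec 1 := by
    rw [← Matrix.mulVec_smul, ← h1, Matrix.mulVec_mulVec, resolvent_mul hz, Matrix.one_mulVec]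
  have h3 : ∑ k, Matrix.vecMul 1 (resolvent M x) k * (w k).eval z =
      dotProduct (Matrix.vecMul 1 (resolvent M x)) fun k => (w k).eval z := rfl
  simp only [cmKernel, eval_sub, eval_qPoly, eval_finsetSum, eval_mul, eval_C]
  rw [h3, h2, dotProduct_smul, ← Matrix.dotProduct_mulVec, Matrix.mulVec_mulVec, cmFun, smul_eq_mul]
  ring

theorem HasCMForm.hasWave {W : RationalSolution} {w : ι → ℂ[X]} (h : W.HasCMForm M L w) :
    W.HasWave M L :=
  ⟨_, h.isKernel.and (eventually_det_ne_zero L), fun _ hx => ⟨_, hx.1, fun _ hz =>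
    eval_cmKernel h.lax hz.2 _ _⟩⟩

theorem HasParticleSystem.hasWave {W : RationalSolution} {P : ParticleSystem}
    (h : W.HasParticleSystem P) : W.HasWave P.posMat P.laxMat := by
  obtain ⟨w, hw⟩ := h.exists_hasCMForm
  exact hw.hasWave

/-- Exchanging x and z reverses the product of resolvents. The sum of entries is invariant under
transposition, which restores the order. -/
theorem HasWave.isBispectralImage {W V : RationalSolution} (hW : W.HasWave M L)
    (h : W.IsBispectralImage V) : V.HasWave L.transpose M.transpose := by
  obtain ⟨S, hS, hR⟩ := hW
  obtain ⟨ψW, ψV, h1, h2, h3⟩ := h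
  refine ⟨_, (inter_mem hS (W.eventually_wr_ne_zero.and (V.eventually_wr_ne_zero.and
    (W.eventually_q_ne_zero.and V.eventually_q_ne_zero)))), ?_⟩
  rintro x ⟨hxS, hxW, hxV, hxqW, hxqV⟩
  have hx : V.tau (times₂ x 0) ≠ 0 := (V.tau_eq_zero_iff x 0).not.mpr hxV
  obtain ⟨R, hRx, hRz⟩ := h2.exists_isKernel hx
  refine ⟨R, hRx, ?_⟩
  rintro z ⟨hzS, hzW, hzV, hzqW, hzqV⟩
  have hz : W.tau (times₂ z 0) ≠ 0 := (W.tau_eq_zero_iff z 0).not.mpr hzW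
  obtain ⟨R', hR', hRz'⟩ := h1.exists_isKernel hz
  obtain ⟨R'', hR'', hRz''⟩ := hR z hzS
  have h4 := h3 x z hx hzqV hz hxqW
  rw [hRz z hzqV, hRz' x hxqW, mul_comm z x, hR'.eq hR'' hzW, hRz'' x hxS,
    mul_div_cancel_left₀ _ hxqW] at h4
  have h5 := mul_right_cancel₀ (Complex.exp_ne_zero _) h4
  rw [div_eq_iff hzqV] at h5
  rw [h5, cmFun_transpose, mul_comm]

theorem HasWave.cmFun_eq {κ : Type*} [Fintype κ] [DecidableEq κ] {M' L' : Matrix κ κ ℂ}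
    {W : RationalSolution} (h : W.HasWave M L) (h' : W.HasWave M' L') :
    ∃ S ∈ (cofinite : Filter ℂ), ∀ x ∈ S, ∀ z ∈ S, cmFun M L x z = cmFun M' L' x z := by
  obtain ⟨S, hS, hR⟩ := h
  obtain ⟨S', hS', hR'⟩ := h'
  refine ⟨_, inter_mem (inter_mem hS hS') (W.eventually_wr_ne_zero.and W.eventually_q_ne_zero), ?_⟩
  rintro x ⟨⟨hx, hx'⟩, hxW, -⟩ z ⟨⟨hz, hz'⟩, -, hzq⟩
  obtain ⟨R, h1, h2⟩ := hR x hx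
  obtain ⟨R', h1', h2'⟩ := hR' x hx'
  have h3 := (h2 z hz).symm.trans (h1.eq h1' hxW ▸ h2' z hz')
  exact sub_right_injective (mul_left_cancel₀ hzq h3)

/-- The positions are the eigenvalues of `M`. -/
theorem HasWave.hasPositions {W : RationalSolution} (h : W.HasWave M L) (hcm : IsCMPair M L) :
    W.HasPositions M.charpoly.roots := by
  obtain ⟨B, T, hT⟩ := W.exists_isNumer
  obtain ⟨S, hS, hR⟩ := h
  have h1 : ∀ᶠ x in cofinite, (derivative T * M.charpoly).eval x =
      (T * derivative M.charpoly).eval x := by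
    filter_upwards [hS, W.eventually_wr_ne_zero, eventually_det_ne_zero M] with x hx hw hdet
    have hTx := (hT.wr_ne_zero_iff x).mp hw
    obtain ⟨R, hRx, hRz⟩ := hR x hx
    have h2 := tendsto_mul_div_sub_one hRx.monic W.qPoly_monic
      (hRx.natDegree_eq.trans W.natDegree_qPoly.symm)
    have h3 := (tendsto_mul_cmFun M L x).neg
    have h4 : Tendsto (fun z => z * (R.eval z / W.qPoly.eval z - 1)) (Bornology.cobounded ℂ)
        (𝓝 (-dotProduct 1 ((resolvent M x).mulVec 1))) := by
      refine h3.congr' ?_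
      filter_upwards [Bornology.le_cofinite ℂ hS,
        Bornology.le_cofinite ℂ W.eventually_q_ne_zero] with z hz hq
      rw [hRz z hz, eval_qPoly, mul_div_cancel_left₀ _ hq]
      ring
    have h5 := tendsto_nhds_unique h2 h4
    have h6 := hT.nextCoeff hTx hRx
    have h7 : W.qPoly.nextCoeff = -∑ i, W.pt i := prod_X_sub_C_nextCoeff _
    rw [h7, hcm.dotProduct_mulVec_of_commute (commute_resolvent hdet)] at h5
    have h8 := trace_resolvent hdet
    rw [eval_mul, eval_mul]
    linear_combination M.charpoly.eval x * h6 - M.charpoly.eval x * T.eval x * h5 +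
      T.eval x * h8
  -- The 1/z coefficient of the wave function is -τ'/τ on one side and minus the trace of (x - M)⁻¹
  -- on the other.
  have h2 : derivative T * M.charpoly = T * derivative M.charpoly :=
    eq_of_infinite_eval_eq _ _ (frequently_cofinite_iff_infinite.mp h1.frequently)
  obtain ⟨a, ha⟩ := eq_C_mul_of_derivative_mul_eq M.charpoly_monic.ne_zero h2
  refine ⟨a, fun h0 => hT.ne_zero (by rw [ha, h0, C_0, zero_mul]), fun x => ?_⟩
  have h3 := (IsAlgClosed.splits M.charpoly).eq_prod_roots_of_monic M.charpoly_monic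
  rw [hT.tau_eq, ha, eval_mul, eval_C]
  conv_lhs => rw [h3]
  rw [eval_multiset_prod, Multiset.map_map]
  simp

end RationalSolution

end

section

/-! ### Comparison of Calogero–Moser matrices -/

section

variable {ι κ ν : Type*} [Fintype ι] [DecidableEq ι] [Fintype κ] [DecidableEq κ] [Fintype ν]
  [DecidableEq ν] {M L : Matrix ι ι ℂ} {A B : Matrix κ κ ℂ} {E F : Matrix ν ν ℂ}

/-- Two pairs of matrices give the same stationary wave function. -/
def CMEq (M L : Matrix ι ι ℂ) (A B : Matrix κ κ ℂ) : Prop :=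
  ∃ S ∈ (cofinite : Filter ℂ), ∀ x ∈ S, ∀ z ∈ S, cmFun M L x z = cmFun A B x z

theorem CMEq.trans (h : CMEq M L A B) (h' : CMEq A B E F) : CMEq M L E F :=
  let ⟨S, hS, h⟩ := h
  let ⟨S', hS', h'⟩ := h'
  ⟨S ∩ S', inter_mem hS hS', fun x hx z hz => (h x hx.1 z hz.1).trans (h' x hx.2 z hz.2)⟩

theorem CMEq.transpose (h : CMEq M L A B) :
    CMEq L.transpose M.transpose B.transpose A.transpose :=
  let ⟨S, hS, h⟩ := h
  ⟨S, hS, fun x hx z hz => by rw [cmFun_transpose, cmFun_transpose, h z hz x hx]⟩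

theorem RationalSolution.HasWave.cmEq {W : RationalSolution} (h : W.HasWave M L)
    (h' : W.HasWave A B) : CMEq M L A B := h.cmFun_eq h'

theorem CMEq.eventually_dotProduct_resolvent (h : CMEq M L A B) : ∀ᶠ x in cofinite,
    dotProduct 1 ((resolvent M x).mulVec 1) = dotProduct 1 ((resolvent A x).mulVec 1) := by
  obtain ⟨S, hS, h⟩ := h
  filter_upwards [hS] with x hx
  refine tendsto_nhds_unique_of_eventuallyEq (tendsto_mul_cmFun M L x) (tendsto_mul_cmFun A B x) ?_
  filter_upwards [Bornology.le_cofinite ℂ hS] with z hz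
  rw [h x hx z hz]

theorem CMEq.eventually_dotProduct_resolvent_mul (h : CMEq M L A B) : ∀ᶠ x in cofinite,
    dotProduct 1 ((resolvent M x * L).mulVec 1) = dotProduct 1 ((resolvent A x * B).mulVec 1) := by
  have h0 := h.eventually_dotProduct_resolvent
  obtain ⟨S, hS, h⟩ := h
  filter_upwards [hS, h0] with x hx h0
  refine tendsto_nhds_unique_of_eventuallyEq (tendsto_mul_mul_cmFun_sub M L x)
    (tendsto_mul_mul_cmFun_sub A B x) ?_
  filter_upwards [Bornology.le_cofinite ℂ hS] with z hz
  rw [h x hx z hz, h0]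

theorem CMEq.charpoly_eq (h : CMEq M L A B) (hM : IsCMPair M L) (hA : IsCMPair A B) :
    M.charpoly = A.charpoly := by
  have h1 : ∀ᶠ x in cofinite, (derivative M.charpoly * A.charpoly).eval x =
      (M.charpoly * derivative A.charpoly).eval x := by
    filter_upwards [h.eventually_dotProduct_resolvent, eventually_det_ne_zero M,
      eventually_det_ne_zero A] with x hx hdM hdA
    rw [hM.dotProduct_mulVec_of_commute (commute_resolvent hdM),
      hA.dotProduct_mulVec_of_commute (commute_resolvent hdA)] at hx
    rw [eval_mul, eval_mul, ← trace_resolvent hdM, ← trace_resolvent hdA, hx]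
    ring
  obtain ⟨a, ha⟩ := eq_C_mul_of_derivative_mul_eq A.charpoly_monic.ne_zero
    (eq_of_infinite_eval_eq _ _ (frequently_cofinite_iff_infinite.mp h1.frequently))
  have h2 := congrArg leadingCoeff ha
  rw [M.charpoly_monic.leadingCoeff, leadingCoeff_mul, leadingCoeff_C,
    A.charpoly_monic.leadingCoeff, mul_one] at h2
  rw [ha, ← h2, C_1, one_mul]

theorem IsCMPair.sub_aeval (h : IsCMPair M L) (g : ℂ[X]) : IsCMPair (M - aeval L g) L := by
  have : aeval L g * L = L * aeval L g := by
    have h1 := (Commute.all X g).map (aeval L)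
    rw [aeval_X] at h1
    exact h1.eq.symm
  unfold IsCMPair at h ⊢
  rw [sub_mul, mul_sub, this, ← h]
  abel

theorem transpose_aeval (L : Matrix ι ι ℂ) (g : ℂ[X]) :
    (aeval L g).transpose = aeval L.transpose g := by
  induction g using Polynomial.induction_on' with
  | add f g hf hg => rw [map_add, Matrix.transpose_add, hf, hg, map_add]
  | monomial n a =>
    rw [← C_mul_X_pow_eq_monomial, ← smul_eq_C_mul, map_smul, map_smul, map_pow, map_pow, aeval_X,
      aeval_X, Matrix.transpose_smul, Matrix.transpose_pow]

/-- Each row of adj(a - A) is annihilated by a - A from the right, so g(A) acts on it as g(a). -/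
theorem adjugate_mul_aeval {A : Matrix κ κ ℂ} {a : ℂ} (ha : A.charpoly.eval a = 0) (g : ℂ[X]) :
    (Matrix.scalar κ a - A).adjugate * aeval A g = g.eval a • (Matrix.scalar κ a - A).adjugate := by
  have h1 : (Matrix.scalar κ a - A).adjugate * aeval A (X - C a) = 0 := by
    have h0 : A - algebraMap ℂ (Matrix κ κ ℂ) a = -(Matrix.scalar κ a - A) := (neg_sub _ _).symm
    rw [map_sub, aeval_X, aeval_C, h0, mul_neg, Matrix.adjugate_mul, ← eval_charpoly, ha,
      zero_smul, neg_zero]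
  obtain ⟨r, hr⟩ := X_sub_C_dvd_sub_C_eval (a := a) (p := g)
  have h2 := congrArg (aeval A) hr
  rw [map_sub, map_mul, aeval_C, sub_eq_iff_eq_add] at h2
  rw [h2, mul_add, ← mul_assoc, h1, zero_mul, zero_add, Algebra.algebraMap_eq_smul_one,
    mul_smul_comm, mul_one]

/-- The effect of replacing `B` by `B - g (A)`, when `A` has the simple eigenvalues `d`. -/
theorem CMEq.sum_sub_eq {d : ι → ℂ} (hd : Function.Injective d) {L L' : Matrix ι ι ℂ} {g : ℂ[X]}
    (hcm : IsCMPair A B) (hA : A.charpoly = ∏ i, (X - C (d i)))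
    (h : CMEq (Matrix.diagonal d) L A B)
    (h' : CMEq (Matrix.diagonal d) L' A (B - aeval A g)) (i : ι) :
    ∑ j, (L i j - L' i j) = g.eval (d i) := by
  set r : ι → ℂ := fun i => ∑ j, (L i j - L' i j) with hr
  have hcof : ∀ᶠ x in cofinite, ∀ k, x ≠ d k :=
    eventually_all.mpr fun i => by simp [eventually_cofinite]
  have hcomm : Commute (aeval A g) A := by
    have h1 := (Commute.all g X).map (aeval A)
    rwa [aeval_X] at h1
  have h1 : ∀ᶠ x in cofinite, ((Matrix.scalar κ x - A).adjugate * aeval A g).trace =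
      ∑ i, r i * ∏ j ∈ Finset.univ.erase i, (x - d j) := by
    filter_upwards [hcof, eventually_det_ne_zero A, h.eventually_dotProduct_resolvent_mul,
      h'.eventually_dotProduct_resolvent_mul] with x hx hdet h2 h3
    have h4 : dotProduct 1 ((resolvent (Matrix.diagonal d) x * (L - L')).mulVec 1) =
        (resolvent A x * aeval A g).trace := by
      rw [mul_sub, Matrix.sub_mulVec, dotProduct_sub, h2, h3, mul_sub, Matrix.sub_mulVec,
        dotProduct_sub, sub_sub_cancel]
      exact hcm.dotProduct_mulVec_of_commute ((commute_resolvent hdet).mul_left hcomm)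
    rw [← charpoly_mul_resolvent hdet, smul_mul_assoc, Matrix.trace_smul, ← h4,
      ← Matrix.mulVec_mulVec, Matrix.dotProduct_mulVec, hA, eval_prod, smul_eq_mul, dotProduct,
      Finset.mul_sum]
    refine Finset.sum_congr rfl fun k _ => ?_
    rw [vecMul_resolvent_diagonal d x hx, ← Finset.mul_prod_erase _ _ (Finset.mem_univ k)]
    have h5 : (L - L').mulVec 1 k = r k := by
      simp [hr, Matrix.mulVec, dotProduct]
    rw [h5, eval_sub, eval_X, eval_C]
    have h6 : x - d k ≠ 0 := _root_.sub_ne_zero.mpr (hx k)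
    simp only [eval_sub, eval_X, eval_C]
    field_simp
  -- The adjugate is defined also at eigenvalues, where the resolvent is not. Continuity carries the
  -- identity there, and evaluation at d_i extracts the residue.
  have h2 : (fun x => ((Matrix.scalar κ x - A).adjugate * aeval A g).trace) =
      fun x => ∑ i, r i * ∏ j ∈ Finset.univ.erase i, (x - d j) := by
    refine Continuous.ext_on (s := {x | ((Matrix.scalar κ x - A).adjugate * aeval A g).trace =
      ∑ i, r i * ∏ j ∈ Finset.univ.erase i, (x - d j)}) ?_ ?_ (by fun_prop) fun x hx => hx
    · have := (Set.Finite.countable (mem_cofinite.mp h1)).dense_compl ℂ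
      rwa [compl_compl] at this
    · have h3 : Continuous fun x : ℂ => Matrix.scalar κ x - A :=
        (Continuous.matrix_diagonal (continuous_pi fun _ => continuous_id)).sub continuous_const
      exact (h3.matrix_adjugate.matrix_mul continuous_const).matrix_trace
  have h3 : ((Matrix.scalar κ (d i) - A).adjugate * aeval A g).trace =
    ∑ k, r k * ∏ j ∈ Finset.univ.erase k, (d i - d j) := congrFun h2 (d i)
  have h4 : A.charpoly = (X - C (d i)) * ∏ j ∈ Finset.univ.erase i, (X - C (d j)) := by
    rw [hA, Finset.mul_prod_erase _ (fun j => X - C (d j)) (Finset.mem_univ i)]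
  have h5 : A.charpoly.eval (d i) = 0 := by rw [h4]; simp
  have h6 : (derivative A.charpoly).eval (d i) = ∏ j ∈ Finset.univ.erase i, (d i - d j) := by
    rw [h4]; simp [eval_prod]
  rw [adjugate_mul_aeval h5, Matrix.trace_smul, trace_adjugate, h6, smul_eq_mul,
    Finset.sum_eq_single i (fun j _ hj => by
      rw [Finset.prod_eq_zero (Finset.mem_erase.mpr ⟨hj.symm, Finset.mem_univ i⟩) (sub_self _),
        mul_zero]) (by simp)] at h3
  refine (mul_right_cancel₀ (Finset.prod_ne_zero_iff.mpr fun j hj => ?_) h3).symm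
  exact _root_.sub_ne_zero.mpr fun h => Finset.ne_of_mem_erase hj (hd h).symm

theorem resolvent_submatrix (e : κ ≃ ι) (M : Matrix ι ι ℂ) (x : ℂ) :
    resolvent (M.submatrix e e) x = (resolvent M x).submatrix e e := by
  rw [resolvent, resolvent, ← Matrix.inv_submatrix_equiv]
  congr 1
  ext i j
  simp [Matrix.diagonal_apply]

theorem cmFun_submatrix (e : κ ≃ ι) (M L : Matrix ι ι ℂ) (x z : ℂ) :
    cmFun (M.submatrix e e) (L.submatrix e e) x z = cmFun M L x z := by
  rw [cmFun, cmFun, resolvent_submatrix, resolvent_submatrix, Matrix.submatrix_mul_equiv]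
  simp only [dotProduct, Matrix.mulVec, Matrix.submatrix_apply, Pi.one_apply, mul_one, one_mul]
  rw [← Equiv.sum_comp e]
  exact Finset.sum_congr rfl fun i _ =>
    Equiv.sum_comp e fun j => (resolvent M x * resolvent L z) (e i) j

theorem CMEq.of_submatrix (e : κ ≃ ι) (M L : Matrix ι ι ℂ) :
    CMEq (M.submatrix e e) (L.submatrix e e) M L :=
  ⟨Set.univ, univ_mem, fun x _ z _ => cmFun_submatrix e M L x z⟩

end

namespace ParticleSystem

theorem card_positions (P : ParticleSystem) :
    Multiset.card P.positions = P.particles.card := by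
  rw [positions, Multiset.card_map]; rfl

theorem nodup_positions (P : ParticleSystem) : P.positions.Nodup :=
  Multiset.Nodup.map_on (fun _ hx _ hy h => P.distinct hx hy h) P.particles.nodup

theorem roots_charpoly_posMat (P : ParticleSystem) : P.posMat.charpoly.roots = P.positions := by
  rw [P.charpoly_posMat, roots_multiset_prod_X_sub_C]

theorem exists_equiv {Q R : ParticleSystem} (h : R.positions = Q.positions) :
    ∃ e : Q.particles ≃ R.particles, ∀ p, (e p).1.1 = p.1.1 := by
  have h1 : ∀ p : Q.particles, ∃ r : R.particles, r.1.1 = p.1.1 := fun p => by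
    have : p.1.1 ∈ R.positions := h ▸ Multiset.mem_map_of_mem Prod.fst p.2
    obtain ⟨r, hr, hrp⟩ := Multiset.mem_map.mp this
    exact ⟨⟨r, hr⟩, hrp⟩
  choose f hf using h1
  refine ⟨Equiv.ofBijective f ((Fintype.bijective_iff_injective_and_card f).mpr ⟨?_, ?_⟩), hf⟩
  · intro p q hpq
    refine Subtype.ext (Q.distinct p.2 q.2 ?_)
    rw [← hf, hpq, hf]
  · rw [Fintype.card_coe, Fintype.card_coe, ← card_positions, ← card_positions, h]

variable {κ : Type*} [Fintype κ] [DecidableEq κ] {A B : Matrix κ κ ℂ}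

/-- Once particles at equal positions are matched, the off-diagonal entries of the two Lax matrices
agree. The difference of row sums is then a difference of momenta. -/
theorem mem_particles_of_cmEq {Q R : ParticleSystem} (h : R.positions = Q.positions)
    (hcm : IsCMPair A B) (g : ℂ[X]) (hQ : CMEq Q.posMat Q.laxMat A B)
    (hR : CMEq R.posMat R.laxMat A (B - aeval A g)) {p : ℂ × ℂ} (hp : p ∈ Q.particles) :
    (p.1, p.2 + g.eval p.1) ∈ R.particles := by
  obtain ⟨e, he⟩ := exists_equiv h
  have h1 := (CMEq.of_submatrix e R.posMat R.laxMat).trans hR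
  have h2 : R.posMat.submatrix e e = Q.posMat := by
    rw [posMat, Matrix.submatrix_diagonal_equiv, posMat]
    exact congrArg Matrix.diagonal (funext he)
  rw [h2] at h1
  have h3 := CMEq.sum_sub_eq (fun a b hab => Subtype.ext (Q.distinct a.2 b.2 hab)) hcm
    ((hQ.charpoly_eq Q.isCMPair hcm).symm.trans (Matrix.charpoly_diagonal _)) hQ h1 ⟨p, hp⟩
  rw [Finset.sum_eq_single ⟨p, hp⟩ (fun j _ hj => by
    rw [Matrix.submatrix_apply, Q.laxMat_of_ne hj.symm, R.laxMat_of_ne (e.injective.ne hj.symm),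
      he, he, sub_self]) (by simp), Matrix.submatrix_apply, Q.laxMat_self, R.laxMat_self] at h3
  have h4 : (p.1, p.2 + g.eval p.1) = (e ⟨p, hp⟩).1 := by
    refine Prod.ext (he ⟨p, hp⟩).symm ?_
    simp only at h3 ⊢
    linear_combination -h3
  rw [h4]
  exact (e ⟨p, hp⟩).2

theorem eq_of_cmEq {Q R : ParticleSystem} (h : R.positions = Q.positions) (hcm : IsCMPair A B)
    (hQ : CMEq Q.posMat Q.laxMat A B) (hR : CMEq R.posMat R.laxMat A B) : R = Q := by
  refine ParticleSystem.ext (Finset.eq_of_subset_of_card_le (fun p hp => ?_) ?_).symm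
  · have := mem_particles_of_cmEq h hcm 0 hQ (by simpa using hR) hp
    simpa using this
  · rw [← card_positions, ← card_positions, h]

theorem eq_linearMotion_of_cmEq {Q R : ParticleSystem} (h : R.positions = Q.positions)
    (hcm : IsCMPair A B) (t : Times) (hQ : CMEq Q.posMat Q.laxMat A B)
    (hR : CMEq R.posMat R.laxMat A (B - aeval A (derivative (phasePoly t)))) :
    R = Q.linearMotion t := by
  refine ParticleSystem.ext (Finset.eq_of_subset_of_card_le (fun p hp => ?_) ?_).symm
  · obtain ⟨r, hr, rfl⟩ := Finset.mem_image.mp hp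
    have := mem_particles_of_cmEq h hcm _ hQ hR hr
    rwa [eval_derivative_phasePoly] at this
  · rw [← card_positions, h, card_positions]
    refine (Finset.card_image_of_injOn fun p hp q hq hpq => Q.distinct hp hq ?_).ge
    exact (Prod.ext_iff.mp hpq).1

end ParticleSystem

end

section

/-! ### The bispectral involution on particle systems -/

/-- The formula is needed wherever the wave function is defined, not only generically: the roots of
q and of τ are exactly the eigenvalues of L and of M. -/
theorem IsCMPair.exists_hasWave {ι : Type*} [Fintype ι] [DecidableEq ι] {M L : Matrix ι ι ℂ}
    (hcm : IsCMPair M L) : ∃ W : RationalSolution, W.HasWave M L ∧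
      ∀ x, W.tau (times₂ x 0) ≠ 0 → ∃ R, W.IsKernel x R ∧
        ∀ z, W.q z ≠ 0 → R.eval z = W.q z * (1 - cmFun M L x z) := by
  obtain ⟨W, hq, hW⟩ := hcm.exists_rationalSolution
  have hlax : ∀ k, X * adjSum L k - ∑ j, C (L k j) * adjSum L j = W.qPoly :=
    fun k => (adjSum_lax L k).trans hq.symm
  have hcmf : W.HasCMForm M L (adjSum L) := ⟨hlax, (eventually_det_ne_zero M).mono hW⟩
  refine ⟨W, hcmf.hasWave, fun x hx => ⟨_, hW x ?_, fun z hz => ?_⟩⟩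
  · obtain ⟨a, ha, h⟩ := hcmf.hasWave.hasPositions hcm
    rw [h] at hx
    have h1 := right_ne_zero_of_mul hx
    rw [← eval_charpoly, (IsAlgClosed.splits M.charpoly).eq_prod_roots_of_monic M.charpoly_monic,
      eval_multiset_prod, Multiset.map_map]
    simpa using h1
  · refine RationalSolution.eval_cmKernel hlax ?_ M x
    rwa [← eval_charpoly, ← hq, RationalSolution.eval_qPoly]

/-- Both solutions are built from the matrices of P and their transposes. The momenta of the first
one are those of P because the wave function determines them. -/
theorem ParticleSystem.exists_isBispectralImage (P : ParticleSystem) :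
    ∃ W V : RationalSolution, W.HasParticleSystem P ∧ W.IsBispectralImage V := by
  obtain ⟨W, hW, hWx⟩ := P.isCMPair.exists_hasWave
  obtain ⟨V, hV, hVx⟩ := P.isCMPair.transpose.exists_hasWave
  refine ⟨W, V, ?_, ?_⟩
  · have h1 := hW.hasPositions P.isCMPair
    rw [P.roots_charpoly_posMat] at h1
    obtain ⟨P', hP', hWP'⟩ := h1.exists_hasParticleSystem P.nodup_positions
    have h2 := ParticleSystem.eq_of_cmEq hP' P.isCMPair
      ⟨Set.univ, univ_mem, fun _ _ _ _ => rfl⟩ (hWP'.hasWave.cmEq hW)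
    rwa [h2] at hWP'
  · obtain ⟨ψW, hψW⟩ := W.exists_isWaveFunction
    obtain ⟨ψV, hψV⟩ := V.exists_isWaveFunction
    refine ⟨ψW, ψV, hψW, hψV, fun x z hVt hVq hWt hWq => ?_⟩
    obtain ⟨R, hR, hRz⟩ := hVx x hVt
    obtain ⟨S, hS, hSx⟩ := hWx z hWt
    obtain ⟨R', hR', hRz'⟩ := hψV.exists_isKernel hVt
    obtain ⟨S', hS', hSx'⟩ := hψW.exists_isKernel hWt
    rw [hRz' z hVq, hSx' x hWq, hR'.eq hR ((V.tau_eq_zero_iff x 0).not.mp hVt),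
      hS'.eq hS ((W.tau_eq_zero_iff z 0).not.mp hWt), hRz z hVq, hSx x hWq,
      mul_div_cancel_left₀ _ hVq, mul_div_cancel_left₀ _ hWq, cmFun_transpose, mul_comm x z]

variable {P P' Q R : ParticleSystem} {t : Times}

theorem RationalSolution.HasParticleSystem.hasWave_of_isBispectralImage {W V : RationalSolution}
    (h : W.HasParticleSystem P) (hV : W.IsBispectralImage V) :
    V.HasWave P.laxMat.transpose P.posMat.transpose :=
  h.hasWave.isBispectralImage hV

theorem RationalSolution.HasParticleSystem.hasPositions_of_isBispectralImage
    {W V : RationalSolution} (h : W.HasParticleSystem P) (hV : W.IsBispectralImage V) :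
    V.HasPositions P.laxMat.charpoly.roots := by
  rw [← Matrix.charpoly_transpose]
  exact (h.hasWave_of_isBispectralImage hV).hasPositions P.isCMPair.transpose

/-- The positions of `β P` are the eigenvalues of the Lax matrix. -/
theorem betaPositionsEq_iff {M : Multiset ℂ} :
    BetaPositionsEq P M ↔ M = P.laxMat.charpoly.roots := by
  constructor
  · rintro ⟨W, V, hW, hV, hM⟩
    exact hM.unique (hW.hasPositions_of_isBispectralImage hV)
  · rintro rfl
    obtain ⟨W, V, hW, hV⟩ := P.exists_isBispectralImage
    exact ⟨W, V, hW, hV, hW.hasPositions_of_isBispectralImage hV⟩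

theorem BetaEq.positions (h : BetaEq P R) : R.positions = P.laxMat.charpoly.roots := by
  obtain ⟨W, V, hW, hV, hR⟩ := h
  exact hR.1.unique (hW.hasPositions_of_isBispectralImage hV)

theorem BetaEq.cmEq (h : BetaEq P R) :
    CMEq R.posMat R.laxMat P.laxMat.transpose P.posMat.transpose := by
  obtain ⟨W, V, hW, hV, hR⟩ := h
  exact hR.hasWave.cmEq (hW.hasWave_of_isBispectralImage hV)

theorem BetaEq.unique (h : BetaEq P Q) (h' : BetaEq P R) : R = Q :=
  ParticleSystem.eq_of_cmEq (h'.positions.trans h.positions.symm) P.isCMPair.transpose h.cmEq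
    h'.cmEq

theorem exists_betaEq (h : P.laxMat.charpoly.roots.Nodup) : ∃ Q, BetaEq P Q := by
  obtain ⟨W, V, hW, hV⟩ := P.exists_isBispectralImage
  obtain ⟨Q, -, hQ⟩ := (hW.hasPositions_of_isBispectralImage hV).exists_hasParticleSystem h
  exact ⟨Q, W, V, hW, hV, hQ⟩

/-- The flowed solution has two descriptions: by the diagonal pair of P' and by the moved pair of P.
No conjugation between the pairs is needed. -/
theorem FlowsTo.cmEq (h : FlowsTo t P P') : CMEq P'.posMat P'.laxMat
    (P.posMat - aeval P.laxMat (derivative (phasePoly t))) P.laxMat := by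
  obtain ⟨W, hW, hW'⟩ := h
  obtain ⟨w, hw⟩ := hW.exists_hasCMForm
  exact hW'.hasWave.cmEq (RationalSolution.HasCMForm.flow P.isCMPair hw t).hasWave

theorem FlowsTo.charpoly_laxMat (h : FlowsTo t P P') : P'.laxMat.charpoly = P.laxMat.charpoly := by
  have h1 := h.cmEq.transpose.charpoly_eq P'.isCMPair.transpose
    (P.isCMPair.sub_aeval _).transpose
  rwa [Matrix.charpoly_transpose, Matrix.charpoly_transpose] at h1

theorem FlowsTo.betaEq_linearMotion (h : FlowsTo t P P') (hQ : BetaEq P Q) (hR : BetaEq P' R) :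
    R = Q.linearMotion t := by
  refine ParticleSystem.eq_linearMotion_of_cmEq ?_ P.isCMPair.transpose t hQ.cmEq ?_
  · rw [hR.positions, hQ.positions, h.charpoly_laxMat]
  · have h1 := hR.cmEq.trans h.cmEq.transpose
    rwa [Matrix.transpose_sub, transpose_aeval] at h1

end

end CalogeroMoser

end

theorem mainTheorem4 (P : CalogeroMoser.ParticleSystem) :
    ∃ Z : Multiset ℂ,
      (∀ M : Multiset ℂ, CalogeroMoser.BetaPositionsEq P M ↔ M = Z) ∧
      (∀ (t : CalogeroMoser.Times) (P' : CalogeroMoser.ParticleSystem),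
        CalogeroMoser.FlowsTo t P P' →
          ∀ M : Multiset ℂ, CalogeroMoser.BetaPositionsEq P' M ↔ M = Z) ∧
      (Z.Nodup → ∃ Q : CalogeroMoser.ParticleSystem,
        Q.positions = Z ∧
        (∀ R : CalogeroMoser.ParticleSystem, CalogeroMoser.BetaEq P R ↔ R = Q) ∧
        ∀ (t : CalogeroMoser.Times) (P' : CalogeroMoser.ParticleSystem),
          CalogeroMoser.FlowsTo t P P' →
            ∀ R : CalogeroMoser.ParticleSystem,
              CalogeroMoser.BetaEq P' R ↔ R = Q.linearMotion t) := by
  refine ⟨P.laxMat.charpoly.roots, fun M => CalogeroMoser.betaPositionsEq_iff, ?_, fun hZ => ?_⟩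
  · intro t P' h M
    rw [CalogeroMoser.betaPositionsEq_iff, h.charpoly_laxMat]
  · obtain ⟨Q, hQ⟩ := CalogeroMoser.exists_betaEq hZ
    refine ⟨Q, hQ.positions, fun R => ⟨hQ.unique, fun h => h ▸ hQ⟩, fun t P' h R => ?_⟩
    refine ⟨h.betaEq_linearMotion hQ, fun hR => ?_⟩
    -- The flow preserves the spectrum of L, so β(P') exists as a system with distinct positions;
    -- the computed motion then identifies it.
    obtain ⟨Q', hQ'⟩ := CalogeroMoser.exists_betaEq (P := P') (by rwa [h.charpoly_laxMat])
    rw [hR, ← h.betaEq_linearMotion hQ hQ']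
    exact hQ'
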